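/- **Setting.** Let $m_1,m_2,\dots$ be i.i.d. random variables on a probability space $(\Omega,\mathcal F,\mathbb P)$ whose common law has a smooth density $\mu$ supported in $[m_{\min},m_{\max}]$ with $m_{\min}>0$; let $\mathbb E$ be the expectation and $\bar m=\mathbb E(m_1)$. Let $\beta\in C^0([0,1])$ be strictly positive, and let $\bar p,\bar r\in C^1([0,1])$ with $\bar r(0)=\bar r(1)=0$ and $\int_0^1\bar p(y)\,dy=0$. For $n\ge 1$ consider on $L^2(\mathbb R^{n-1};\mathbb C)$ the operators (closures of the operators on the Schwartz space given by) $r_x=$ multiplication by $\xi_x$ for $1\le x\le n-1$, $r_0=r_n=0$, and $$p_x=-i\Big(\frac{\partial}{\partial \xi_{x-1}}-\frac{\partial}{\partial \xi_x}\Big),\qquad 1\le x\le n,\qquad \frac{\partial}{\partial \xi_0}=\frac{\partial}{\partial \xi_n}=0 .$$ For a realization of the masses let $\rho^n=Z_n^{-1}\exp(-H^n_\beta)$, with $Z_n=\operatorname{Tr}\exp(-H^n_\beta)$, where $$H^n_\beta=\frac12\sum_{x=1}^n\Big[\frac{\beta(x/n)}{m_x}\Big(p_x-\frac{m_x}{\bar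 m}\,\bar p(x/n)\Big)^2+\beta(x/n)\big(r_x-\bar r(x/n)\big)^2\Big],$$ and write $\langle a\rangle_{\rho^n}=\operatorname{Tr}(\rho^n a)$. The fluctuation energy of particle $x$ is $$\tilde e_x=\frac12\Big(\frac{\tilde p_x^{\,2}}{m_x}+\tilde r_x^{\,2}\Big),\qquad \tilde p_x=p_x-\langle p_x\rangle_{\rho^n},\quad \tilde r_x=r_x-\langle r_x\rangle_{\rho^n}.$$ **Theorem.** Almost surely, for every $n\ge1$, the state $\rho^n$ and the averages $\langle p_x\rangle_{\rho^n}$, $\langle r_x\rangle_{\rho^n}$, $\langle\tilde e_x\rangle_{\rho^n}$ $(1\le x\le n)$ are well defined, with $\langle\tilde e_x\rangle_{\rho^n}$ real; and each $\langle\tilde e_x\rangle_{\rho^n}$ is an integrable random variable. For every $y\in(0,1)$ the limit $$\mathrm f^\mu_\beta(y)=\lim_{n\to\infty}\mathbb E\big(\langle\tilde e_{[ny]}\rangle_{\rho^n}\big)$$ exists, where $[\cdot]$ denotes the integer part, and $\mathrm f^\mu_\beta$ is integrable on $(0,1)$. For every $g\in C^0([0,1])$, almost surely, $$\lim_{n\to\infty}\frac1n\sum_{x=1}^n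 g\Big(\frac xn\Big)\langle\tilde e_x\rangle_{\rho^n}=\int_0^1 g(y)\,\mathrm f^\mu_\beta(y)\,dy .$$ -/

import Mathlib

open MeasureTheory ProbabilityTheory Filter Topology Set
open scoped SchwartzMap ContDiff

noncomputable section

namespace QuantumChain

/-! ## The Hilbert space and the operators on its Schwartz core -/

/-- The configuration space `ℝ^(n-1)` of the `n - 1` elongations of a chain of `n` particles. -/
abbrev Config (n : ℕ) : Type := EuclideanSpace ℝ (Fin (n - 1))

/-- The Hilbert space `L²(ℝ^(n-1); ℂ)`, with respect to Lebesgue measure. -/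
abbrev Hilb (n : ℕ) : Type := Lp ℂ 2 (volume : Measure (Config n))

/-- Schwartz functions on `ℝ^(n-1)`: the common core on which all operators are defined. -/
abbrev Core (n : ℕ) : Type := 𝓢(Config n, ℂ)

/-- The inclusion of the Schwartz space into `L²`. -/
def incl (n : ℕ) : Core n →ₗ[ℂ] Hilb n :=
  (SchwartzMap.toLpCLM ℂ ℂ 2 (volume : Measure (Config n))).toLinearMap

/-- The elongation operator `r_x`: multiplication by the coordinate `ξ_x` for `1 ≤ x ≤ n - 1`,
and `0` for the other values of `x` (boundary condition `r_0 = r_n = 0`).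
Sites are counted from `1`, coordinates of `ℝ^(n-1)` from `0`. -/
def elongation (n x : ℕ) : Module.End ℂ (Core n) :=
  if h : 1 ≤ x ∧ x < n then
    (SchwartzMap.smulLeftCLM ℂ
      (fun ξ : Config n => ((ξ ⟨x - 1, by omega⟩ : ℝ) : ℂ))).toLinearMap
  else 0

/-- The partial derivative `∂/∂ξ_x` for `1 ≤ x ≤ n - 1`, and `0` for the other values of `x`. -/
def partialDeriv (n x : ℕ) : Module.End ℂ (Core n) :=
  if h : 1 ≤ x ∧ x < n then
    (LineDeriv.lineDerivOpCLM ℂ (Core n)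
      (EuclideanSpace.single (⟨x - 1, by omega⟩ : Fin (n - 1)) (1 : ℝ))).toLinearMap
  else 0

/-- The momentum operator `p_x = -i (∂/∂ξ_{x-1} - ∂/∂ξ_x)`, `1 ≤ x ≤ n`. -/
def momentum (n x : ℕ) : Module.End ℂ (Core n) :=
  (-Complex.I) • (partialDeriv n (x - 1) - partialDeriv n x)

/-- A scalar, seen as a multiple of the identity operator. -/
def scalarOp (n : ℕ) (c : ℂ) : Module.End ℂ (Core n) := c • 1

/-- The pseudo-Hamiltonian
`½ ∑_{x=1}^n [ (β(x/n)/m_x) (p_x - (m_x/m̄) p̄(x/n))² + β(x/n) (r_x - r̄(x/n))² ]`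
of the locally Gibbs state, on the Schwartz space. -/
def pseudoHamiltonian (n : ℕ) (β pbar rbar : ℝ → ℝ) (mbar : ℝ) (mass : ℕ → ℝ) :
    Module.End ℂ (Core n) :=
  (1 / 2 : ℂ) • ∑ x ∈ Finset.Icc 1 n,
    (((β (x / n) / mass x : ℝ) : ℂ) •
        (momentum n x - scalarOp n ((mass x / mbar * pbar (x / n) : ℝ) : ℂ)) ^ 2
      + ((β (x / n) : ℝ) : ℂ) •
        (elongation n x - scalarOp n ((rbar (x / n) : ℝ) : ℂ)) ^ 2)

/-! ## Closures, Gibbs states and averages -/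

/-- The graph of the closure (in `L²`) of an operator defined on the Schwartz space. -/
def closureGraph {n : ℕ} (A : Module.End ℂ (Core n)) : Submodule ℂ (Hilb n × Hilb n) :=
  (LinearMap.range ((incl n).prod ((incl n).comp A))).topologicalClosure

/-- `ρ = exp(-A) / Tr exp(-A)`, where `A` also denotes its closure: `A` has an orthonormal basis of
eigenvectors `b i` with real eigenvalues `E i`, `exp(-A)` is the operator `b i ↦ exp(-E i) b i`,
and its trace `Z = ∑ exp(-E i)` is finite. -/
def IsGibbsState {n : ℕ} (A : Module.End ℂ (Core n)) (ρ : Hilb n →L[ℂ] Hilb n) : Prop :=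
  ∃ (ι : Type) (b : HilbertBasis ι ℂ (Hilb n)) (E : ι → ℝ),
    (∀ i, (b i, (E i : ℂ) • b i) ∈ closureGraph A) ∧
    Summable (fun i => Real.exp (-E i)) ∧
    ∀ i, ρ (b i) = ((Real.exp (-E i) / ∑' j, Real.exp (-E j) : ℝ) : ℂ) • b i

/-- `T` is trace class with trace `τ`: in every orthonormal basis the diagonal entries of `T` are
(unconditionally, hence absolutely) summable with sum `τ`. -/
def HasTrace {n : ℕ} (T : Hilb n →L[ℂ] Hilb n) (τ : ℂ) : Prop :=
  ∀ (ι : Type) (c : HilbertBasis ι ℂ (Hilb n)), HasSum (fun i => inner ℂ (c i) (T (c i))) τ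

/-- The observable `a` (the closure of an operator on the Schwartz space) has average `v` in the
state `ρ`: the operator `aρ` is everywhere defined, bounded and trace class, with trace `v`. -/
def HasAverage {n : ℕ} (ρ : Hilb n →L[ℂ] Hilb n) (a : Module.End ℂ (Core n)) (v : ℂ) : Prop :=
  ∃ T : Hilb n →L[ℂ] Hilb n, (∀ u, (ρ u, T u) ∈ closureGraph a) ∧ HasTrace T v

/-- The locally Gibbs state `ρ^n`: the state `exp(-H) / Z` of the pseudo-Hamiltonian `H`. -/
def gibbsState (n : ℕ) (β pbar rbar : ℝ → ℝ) (mbar : ℝ) (mass : ℕ → ℝ) :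
    Hilb n →L[ℂ] Hilb n :=
  Classical.epsilon (IsGibbsState (pseudoHamiltonian n β pbar rbar mbar mass))

/-- The average `⟨a⟩_ρ = Tr(ρ a)`. -/
def average {n : ℕ} (ρ : Hilb n →L[ℂ] Hilb n) (a : Module.End ℂ (Core n)) : ℂ :=
  Classical.epsilon (HasAverage ρ a)

/-- The fluctuation `a - ⟨a⟩_ρ` of the observable `a`. -/
def fluctuation {n : ℕ} (ρ : Hilb n →L[ℂ] Hilb n) (a : Module.End ℂ (Core n)) :
    Module.End ℂ (Core n) :=
  a - scalarOp n (average ρ a)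

/-- The fluctuation energy `ẽ_x = ½ (p̃_x² / m_x + r̃_x²)` of the particle `x`, where
`p̃_x = p_x - ⟨p_x⟩_ρ` and `r̃_x = r_x - ⟨r_x⟩_ρ`. -/
def fluctuationEnergy {n : ℕ} (ρ : Hilb n →L[ℂ] Hilb n) (mass : ℕ → ℝ) (x : ℕ) :
    Module.End ℂ (Core n) :=
  (1 / 2 : ℂ) • (((1 / mass x : ℝ) : ℂ) • fluctuation ρ (momentum n x) ^ 2
    + fluctuation ρ (elongation n x) ^ 2)

/-- The thermal energy `⟨ẽ_x⟩_{ρ^n}` (a real number) for given masses `mass 1, …, mass n`. -/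
def thermalEnergy (n : ℕ) (β pbar rbar : ℝ → ℝ) (mbar : ℝ) (mass : ℕ → ℝ) (x : ℕ) : ℝ :=
  (average (gibbsState n β pbar rbar mbar mass)
    (fluctuationEnergy (gibbsState n β pbar rbar mbar mass) mass x)).re

/-- All objects that enter `⟨ẽ_x⟩_{ρ^n}`, `1 ≤ x ≤ n`, exist for the given masses: the state `ρ^n`,
the averages of `p_x` and `r_x`, and the (real) average of `ẽ_x`. -/
structure WellDefined (n : ℕ) (β pbar rbar : ℝ → ℝ) (mbar : ℝ) (mass : ℕ → ℝ) : Prop where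
  state : IsGibbsState (pseudoHamiltonian n β pbar rbar mbar mass)
    (gibbsState n β pbar rbar mbar mass)
  momentum_average : ∀ x ∈ Finset.Icc 1 n, HasAverage (gibbsState n β pbar rbar mbar mass)
    (momentum n x) (average (gibbsState n β pbar rbar mbar mass) (momentum n x))
  elongation_average : ∀ x ∈ Finset.Icc 1 n, HasAverage (gibbsState n β pbar rbar mbar mass)
    (elongation n x) (average (gibbsState n β pbar rbar mbar mass) (elongation n x))
  energy_average : ∀ x ∈ Finset.Icc 1 n, HasAverage (gibbsState n β pbar rbar mbar mass)
    (fluctuationEnergy (gibbsState n β pbar rbar mbar mass) mass x)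
    (thermalEnergy n β pbar rbar mbar mass x : ℂ)

end QuantumChain

end

namespace QuantumChain

/-! ## Closures of symmetric operators, Gibbs states and averages -/

/-! The pseudo-Hamiltonian is quadratic, so the thermal energies can be computed exactly. Put `a_x =
√(β(x/n)/m_x)` on sites and `b_x = √β(x/n)` on bonds, and let `D` be the weighted discrete gradient
`chainGrad` with zero boundary values. The elongations are centred by `r̄` itself. The momenta sum
to zero and cannot be centred freely, but they can be displaced so that the remaining linear term is
a multiple of a telescoping sum and drops out (`exists_displacement`). Diagonalising `D*D` gives
orthonormal modes `w_k` with eigenvalues `λ_k > 0`, and up to a constant the Hamiltonian is `∑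
(ν_k/2)(q_k² + p_k²)` with `ν_k = √λ_k` and canonical pairs `(q_k, p_k)`. Their vacuum is a
displaced, boosted Gaussian. Polynomials times a Gaussian are dense, so the Fock vectors are an
orthonormal eigenbasis of Schwartz functions. The Gibbs state and its averages are then products of
geometric series, and symmetry of the operators makes them unique. The outcome, `thermalEnergy_eq`,
is `2β(x/n)⟨ẽ_x⟩ = ∑_k ((D w_k)(x)²/λ_k + w_k(x)²) h(λ_k)`, `h(t) = (√t/2) coth(√t/2)`, in which
`p̄` and `r̄` no longer appear.

The second point is locality. The function `h` extends continuously to `0`, the `λ_k` lie in an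
interval independent of `n` and of the masses, and the weights have total at most `2`. By
Weierstrass, `h` may be replaced by a polynomial `p` at a uniformly small cost. For a polynomial the
mode sum is a diagonal entry of `p(DD*)` plus one of `p(D*D)`, hence depends only on the masses and
temperatures within distance `deg p` of `x`. The `n` sites carry only `n - 1` modes, and there is no
bond `n`; this corrects the constant coefficient alone, by `O(1/n)` and by a term at `x = n`
(`modeSum_polynomial`).

The third point is probability. Bounded functions of finite windows of independent masses obey a
strong law: residue classes separate the windows, and Hoeffding with Borel–Cantelli concludes
(`ae_tendsto_average_sub_integral`). By stationarity, the expectation over a bulk window depends on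
the site only through the nearby values of `β`, and these tend to `β(y)`. Both facts pass to `⟨ẽ_x⟩`
by the uniform approximation. Dominated convergence of Riemann sums then turns the averaged
expectations into `∫ g f`. -/

theorem incl_apply {n : ℕ} (f : Core n) : incl n f = f.toLp 2 volume := rfl

theorem inner_incl {n : ℕ} (f g : Core n) :
    inner ℂ (incl n f) (incl n g) = ∫ ξ, inner ℂ (f ξ) (g ξ) := by
  exact SchwartzMap.inner_toL2_toL2_eq f g

theorem denseRange_incl (n : ℕ) : DenseRange (incl n) :=
  SchwartzMap.denseRange_toLpCLM (F := ℂ) (by norm_num)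

/-- Formal symmetry of an operator on the Schwartz core. -/
def FormallySymmetric {n : ℕ} (A : Module.End ℂ (Core n)) : Prop :=
  ∀ f g, inner ℂ (incl n (A f)) (incl n g) = inner ℂ (incl n f) (incl n (A g))

namespace FormallySymmetric

variable {n : ℕ} {A B : Module.End ℂ (Core n)}

theorem add (hA : FormallySymmetric A) (hB : FormallySymmetric B) : FormallySymmetric (A + B) := by
  intro f g
  simp [inner_add_left, inner_add_right, hA f g, hB f g]

theorem real_smul (c : ℝ) (hA : FormallySymmetric A) : FormallySymmetric ((c : ℂ) • A) := by
  intro f g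
  rw [LinearMap.smul_apply, LinearMap.smul_apply, map_smul, map_smul, inner_smul_left,
    inner_smul_right, hA f g, Complex.conj_ofReal]

theorem sum {ι : Type*} (s : Finset ι) {A : ι → Module.End ℂ (Core n)}
    (hA : ∀ i ∈ s, FormallySymmetric (A i)) : FormallySymmetric (∑ i ∈ s, A i) := by
  classical
  induction s using Finset.induction_on with
  | empty => intro f g; simp
  | insert i s hi ih =>
    rw [Finset.sum_insert hi]
    exact (hA i (by simp)).add (ih fun j hj => hA j (by simp [hj]))

theorem sq (hA : FormallySymmetric A) : FormallySymmetric (A ^ 2) := by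
  intro f g
  rw [pow_two, Module.End.mul_apply, Module.End.mul_apply, hA, hA]

theorem scalarOp (c : ℝ) : FormallySymmetric (scalarOp n (c : ℂ)) := by
  intro f g
  simp only [QuantumChain.scalarOp, LinearMap.smul_apply, Module.End.one_apply, map_smul]
  rw [inner_smul_left, inner_smul_right, Complex.conj_ofReal]

/-- Both sides are continuous in `p`, so formal symmetry extends from the graph to its closure. -/
theorem inner_closureGraph_core (hA : FormallySymmetric A) {p : Hilb n × Hilb n}
    (hp : p ∈ closureGraph A) (g : Core n) :
    inner ℂ p.2 (incl n g) = inner ℂ p.1 (incl n (A g)) := by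
  have hcl : IsClosed {p : Hilb n × Hilb n |
      inner ℂ p.2 (incl n g) = inner ℂ p.1 (incl n (A g))} :=
    isClosed_eq (by fun_prop) (by fun_prop)
  refine hcl.closure_subset_iff.2 ?_ hp
  rintro _ ⟨f, rfl⟩
  exact hA f g

theorem inner_closureGraph (hA : FormallySymmetric A) {p q : Hilb n × Hilb n}
    (hp : p ∈ closureGraph A) (hq : q ∈ closureGraph A) :
    inner ℂ p.2 q.1 = inner ℂ p.1 q.2 := by
  have hcl : IsClosed {q : Hilb n × Hilb n | inner ℂ p.2 q.1 = inner ℂ p.1 q.2} :=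
    isClosed_eq (by fun_prop) (by fun_prop)
  refine hcl.closure_subset_iff.2 ?_ hq
  rintro _ ⟨f, rfl⟩
  exact hA.inner_closureGraph_core hp f

/-- A densely defined symmetric operator is closable: the image is determined by its inner products
with the dense set of Schwartz functions. This is what makes `closureGraph` the graph of an
operator. -/
theorem closureGraph_snd_unique (hA : FormallySymmetric A) {u y z : Hilb n}
    (hy : (u, y) ∈ closureGraph A) (hz : (u, z) ∈ closureGraph A) : y = z := by
  refine (denseRange_incl n).eq_of_inner_left ℂ fun g => ?_
  rw [hA.inner_closureGraph_core hy, hA.inner_closureGraph_core hz]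

end FormallySymmetric

theorem mem_closureGraph {n : ℕ} (A : Module.End ℂ (Core n)) (f : Core n) :
    (incl n f, incl n (A f)) ∈ closureGraph A :=
  Submodule.le_topologicalClosure _ ⟨f, rfl⟩

/-- A bounded operator `b i ↦ v i` with `∑ ‖v i‖ < ∞` has trace `∑ ⟨b i, v i⟩` in every basis. -/
theorem hasTrace_of_summable_norm {n : ℕ} {ι : Type} (b : HilbertBasis ι ℂ (Hilb n))
    (v : ι → Hilb n) (hv : Summable fun i => ‖v i‖) (T : Hilb n →L[ℂ] Hilb n)
    (hT : ∀ i, T (b i) = v i) : HasTrace T (∑' i, inner ℂ (b i) (v i)) := by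
  intro κ c
  have hb : ∀ i, ‖b i‖ = 1 := fun i => b.orthonormal.1 i
  have hsq : ∀ u : Hilb n, HasSum (fun j => ‖inner ℂ (c j) u‖ ^ 2) (‖u‖ ^ 2) := by
    intro u
    have h := c.hasSum_inner_mul_inner u u
    rw [inner_self_eq_norm_sq_to_K] at h
    have h2 := Complex.hasSum_re h
    convert h2 using 1
    · ext j
      rw [← inner_conj_symm u (c j), mul_comm, RCLike.mul_conj]
      norm_cast
    · norm_cast
  -- Cauchy–Schwarz for the coefficients in the basis `c`, combined with Parseval.
  have hprod : ∀ u w : Hilb n, Summable (fun j => ‖inner ℂ (c j) u‖ * ‖inner ℂ (c j) w‖) ∧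
      ∑' j, ‖inner ℂ (c j) u‖ * ‖inner ℂ (c j) w‖ ≤ ‖u‖ * ‖w‖ := by
    intro u w
    have h := Real.inner_le_Lp_mul_Lq_tsum_of_nonneg (p := 2) (q := 2)
      (f := fun j => ‖inner ℂ (c j) u‖) (g := fun j => ‖inner ℂ (c j) w‖)
      (by constructor <;> norm_num) (fun _ => norm_nonneg _) (fun _ => norm_nonneg _)
      (by simpa using (hsq u).summable) (by simpa using (hsq w).summable)
    refine ⟨Real.summable_mul_of_Lp_Lq_of_nonneg (p := 2) (q := 2)
      (by constructor <;> norm_num) (fun _ => norm_nonneg _) (fun _ => norm_nonneg _)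
      (by simpa using (hsq u).summable) (by simpa using (hsq w).summable),
      h.trans (le_of_eq ?_)⟩
    have e : ∀ u : Hilb n, (∑' j, ‖inner ℂ (c j) u‖ ^ (2 : ℝ)) ^ (1 / 2 : ℝ) = ‖u‖ := by
      intro u
      have : (∑' j, ‖inner ℂ (c j) u‖ ^ (2 : ℝ)) = ‖u‖ ^ 2 := by
        simpa using (hsq u).tsum_eq
      rw [this, ← Real.sqrt_eq_rpow, Real.sqrt_sq (norm_nonneg _)]
    rw [e, e]
  -- This double family is absolutely summable. Summed over `j` first it gives `⟨b i, v i⟩`, summed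
  -- over `i` first it gives `⟨c j, T (c j)⟩`; Fubini equates the two totals.
  let F : ι × κ → ℂ := fun p => inner ℂ (b p.1) (c p.2) * inner ℂ (c p.2) (v p.1)
  have hF : Summable F := by
    refine Summable.of_norm ?_
    rw [summable_prod_of_nonneg (fun _ => norm_nonneg _)]
    have e : ∀ i j, ‖F (i, j)‖ = ‖inner ℂ (c j) (b i)‖ * ‖inner ℂ (c j) (v i)‖ := by
      intro i j
      simp only [F, norm_mul]
      rw [norm_inner_symm]
    simp only [e]
    refine ⟨fun i => (hprod _ _).1, Summable.of_nonneg_of_le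
      (fun i => tsum_nonneg fun j => by positivity) (fun i => ?_) hv⟩
    simpa [hb i] using (hprod (b i) (v i)).2
  have h1 : ∀ i, HasSum (fun j => F (i, j)) (inner ℂ (b i) (v i)) := fun i =>
    c.hasSum_inner_mul_inner (b i) (v i)
  have h2 : ∀ j, HasSum (fun i => F (i, j)) (inner ℂ (c j) (T (c j))) := by
    intro j
    have h := ((b.hasSum_repr (c j)).mapL T).mapL (innerSL ℂ (c j))
    simpa [F, hT, b.repr_apply_apply, inner_smul_right] using h
  have h3 := hF.hasSum.prod_fiberwise h1
  have h4 := ((Equiv.prodComm κ ι).hasSum_iff.2 hF.hasSum).prod_fiberwise h2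
  rw [h3.tsum_eq]
  exact h4

/-- The operator is the sum of the rank-one operators `u ↦ ⟨b i, u⟩ v i`, which converges absolutely
in operator norm. -/
theorem exists_clm_of_summable_norm {n : ℕ} {ι : Type} (b : HilbertBasis ι ℂ (Hilb n))
    (v : ι → Hilb n) (hv : Summable fun i => ‖v i‖) :
    ∃ T : Hilb n →L[ℂ] Hilb n, ∀ i, T (b i) = v i := by
  classical
  let R : ι → (Hilb n →L[ℂ] Hilb n) := fun i => (innerSL ℂ (b i)).smulRight (v i)
  have hR : Summable R := by
    refine Summable.of_norm_bounded hv fun i => ?_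
    simp only [R]
    rw [ContinuousLinearMap.norm_smulRight_apply, innerSL_apply_norm, b.orthonormal.1 i, one_mul]
  refine ⟨∑' i, R i, fun j => ?_⟩
  have h := hR.hasSum.mapL (ContinuousLinearMap.apply ℂ (Hilb n) (b j))
  refine h.unique ?_
  convert hasSum_ite_eq j (v j) using 2 with i
  have := (orthonormal_iff_ite.1 b.orthonormal) i j
  simp only [R, ContinuousLinearMap.apply_apply, ContinuousLinearMap.smulRight_apply,
    innerSL_apply_apply, this]
  split_ifs with h1
  · simp [h1]
  · simp

theorem HasTrace.unique {n : ℕ} {T : Hilb n →L[ℂ] Hilb n} {τ τ' : ℂ}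
    (h : HasTrace T τ) (h' : HasTrace T τ') : τ = τ' := by
  obtain ⟨w, b, -⟩ := exists_hilbertBasis ℂ (Hilb n)
  exact (h w b).unique (h' w b)

theorem HasAverage.unique {n : ℕ} {ρ : Hilb n →L[ℂ] Hilb n} {a : Module.End ℂ (Core n)}
    (ha : FormallySymmetric a) {v v' : ℂ} (h : HasAverage ρ a v) (h' : HasAverage ρ a v') :
    v = v' := by
  obtain ⟨T, hT, ht⟩ := h
  obtain ⟨T', hT', ht'⟩ := h'
  have : T = T' := by
    ext1 u
    exact ha.closureGraph_snd_unique (hT u) (hT' u)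
  subst this
  exact ht.unique ht'

/-- `average` is a choice among all admissible values. For a symmetric observable the operator `aρ`,
and hence its trace, is unique, so any value found by computation is the chosen one. -/
theorem HasAverage.average_eq {n : ℕ} {ρ : Hilb n →L[ℂ] Hilb n} {a : Module.End ℂ (Core n)}
    (ha : FormallySymmetric a) {v : ℂ} (h : HasAverage ρ a v) : average ρ a = v :=
  HasAverage.unique ha (Classical.epsilon_spec (p := HasAverage ρ a) ⟨v, h⟩) h

/-- The average of an observable in a state that is diagonal in a basis of Schwartz functions. -/
theorem hasAverage_of_eigenbasis {n : ℕ} {ι : Type} (b : HilbertBasis ι ℂ (Hilb n))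
    (f : ι → Core n) (hf : ∀ i, b i = incl n (f i)) (p : ι → ℝ) (ρ : Hilb n →L[ℂ] Hilb n)
    (hρ : ∀ i, ρ (b i) = (p i : ℂ) • b i) (a : Module.End ℂ (Core n))
    (ha : Summable fun i => |p i| * ‖incl n (a (f i))‖) :
    HasAverage ρ a (∑' i, (p i : ℂ) * inner ℂ (incl n (f i)) (incl n (a (f i)))) := by
  have hv : Summable fun i => ‖(p i : ℂ) • incl n (a (f i))‖ := by
    simpa only [norm_smul, Complex.norm_real, Real.norm_eq_abs] using ha
  obtain ⟨T, hT⟩ := exists_clm_of_summable_norm b _ hv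
  refine ⟨T, fun u => ?_, ?_⟩
  -- The pair `(ρ u, T u)` is a limit of finite combinations of the pairs `(p i • b i, p i • a (f
  -- i))`, all of which lie in the graph.
  · have h := (b.hasSum_repr u).mapL (ρ.prod T)
    refine (Submodule.isClosed_topologicalClosure _).mem_of_tendsto h
      (Eventually.of_forall fun s => Submodule.sum_mem _ fun i _ => ?_)
    rw [map_smul]
    refine Submodule.smul_mem _ _ ?_
    have := Submodule.smul_mem _ (p i : ℂ) (mem_closureGraph a (f i))
    rw [ContinuousLinearMap.prod_apply, hρ, hT, hf]
    exact this
  · have := hasTrace_of_summable_norm b _ hv T hT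
    simpa only [inner_smul_right, hf] using this

/-- The Gibbs state of a symmetric operator is unique. -/
theorem IsGibbsState.unique {n : ℕ} {A : Module.End ℂ (Core n)} (hA : FormallySymmetric A)
    {ρ ρ' : Hilb n →L[ℂ] Hilb n} (h : IsGibbsState A ρ) (h' : IsGibbsState A ρ') : ρ = ρ' := by
  obtain ⟨ι, b, E, hE, hs, hρ⟩ := h
  obtain ⟨κ, c, E', hE', hs', hρ'⟩ := h'
  -- Eigenvectors of a symmetric operator with different eigenvalues are orthogonal.
  have hort : ∀ i j, inner ℂ (b i) (c j) ≠ 0 → E i = E' j := by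
    intro i j hij
    have := hA.inner_closureGraph (hE i) (hE' j)
    simp only [inner_smul_left, inner_smul_right, Complex.conj_ofReal] at this
    exact_mod_cast mul_right_cancel₀ hij this
  -- Only those `b i` with `E i = E' j` occur in the expansion of `c j`, so `ρ` acts on `c j` as a
  -- scalar.
  have hdiag : ∀ j, ρ (c j) = ((Real.exp (-E' j) / ∑' k, Real.exp (-E k) : ℝ) : ℂ) • c j := by
    intro j
    have h1 := (b.hasSum_repr (c j)).mapL ρ
    have h2 := (b.hasSum_repr (c j)).const_smul
      ((Real.exp (-E' j) / ∑' k, Real.exp (-E k) : ℝ) : ℂ)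
    refine h1.unique ?_
    convert h2 using 2 with i
    rw [map_smul, hρ, smul_comm]
    by_cases hij : inner ℂ (b i) (c j) = 0
    · simp [b.repr_apply_apply, hij]
    · rw [hort i j hij]
  -- The trace of `ρ` is `1` in the basis `b` and the quotient of the two partition functions in the
  -- basis `c`.
  have hZ : Nonempty ι → ∑' k, Real.exp (-E' k) = ∑' k, Real.exp (-E k) := by
    intro hne
    have hpos : 0 < ∑' k, Real.exp (-E k) :=
      hs.tsum_pos (fun _ => (Real.exp_pos _).le) hne.some (Real.exp_pos _)
    have hv : Summable fun i =>
        ‖((Real.exp (-E i) / ∑' k, Real.exp (-E k) : ℝ) : ℂ) • b i‖ := by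
      simp_rw [norm_smul, b.orthonormal.1, mul_one, Complex.norm_real, Real.norm_eq_abs]
      exact (hs.div_const _).abs
    have ht := hasTrace_of_summable_norm b _ hv ρ hρ
    have h1 : ∑' i, inner ℂ (b i) (((Real.exp (-E i) / ∑' k, Real.exp (-E k) : ℝ) : ℂ) • b i)
        = 1 := by
      have : ∀ i, inner ℂ (b i) (((Real.exp (-E i) / ∑' k, Real.exp (-E k) : ℝ) : ℂ) • b i)
          = ((Real.exp (-E i) / ∑' k, Real.exp (-E k) : ℝ) : ℂ) := by
        intro i
        rw [inner_smul_right, inner_self_eq_norm_sq_to_K, b.orthonormal.1 i]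
        simp
      simp_rw [this]
      rw [← Complex.ofReal_tsum, tsum_div_const, div_self hpos.ne', Complex.ofReal_one]
    rw [h1] at ht
    have h2 := ht κ c
    have h3 : ∀ j, inner ℂ (c j) (ρ (c j))
        = ((Real.exp (-E' j) / ∑' k, Real.exp (-E k) : ℝ) : ℂ) := by
      intro j
      rw [hdiag, inner_smul_right, inner_self_eq_norm_sq_to_K, c.orthonormal.1 j]
      simp
    simp_rw [h3] at h2
    have h4 := h2.tsum_eq
    rw [← Complex.ofReal_tsum, tsum_div_const] at h4
    have h5 : (∑' k, Real.exp (-E' k)) / (∑' k, Real.exp (-E k)) = 1 := by exact_mod_cast h4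
    exact (div_eq_one_iff_eq hpos.ne').1 h5
  rcases isEmpty_or_nonempty ι with hι | hι
  · have hz : ∀ u : Hilb n, u = 0 := by
      intro u
      have := b.hasSum_repr u
      exact this.unique hasSum_empty
    ext1 u
    rw [hz (ρ u), hz (ρ' u)]
  · have h6 : ∀ j, ρ (c j) = ρ' (c j) := fun j => by rw [hdiag, hρ', hZ hι]
    ext1 u
    have h1 := (c.hasSum_repr u).mapL ρ
    have h2 := (c.hasSum_repr u).mapL ρ'
    simp only [map_smul, h6] at h1 h2
    exact h1.unique h2

theorem gibbsState_eq {n : ℕ} {β pbar rbar : ℝ → ℝ} {mbar : ℝ} {mass : ℕ → ℝ}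
    (hA : FormallySymmetric (pseudoHamiltonian n β pbar rbar mbar mass))
    {ρ : Hilb n →L[ℂ] Hilb n} (h : IsGibbsState (pseudoHamiltonian n β pbar rbar mbar mass) ρ) :
    gibbsState n β pbar rbar mbar mass = ρ :=
  IsGibbsState.unique hA (Classical.epsilon_spec (p := IsGibbsState _) ⟨ρ, h⟩) h

/-! ## Gaussian Schwartz functions -/

theorem iteratedDeriv_cexp_ofReal_mul (c : ℂ) (i : ℕ) (t : ℝ) :
    iteratedDeriv i (fun t : ℝ => Complex.exp (c * t)) t = c ^ i * Complex.exp (c * t) := by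
  induction i generalizing t with
  | zero => simp
  | succ i ih =>
    rw [iteratedDeriv_succ, funext ih]
    have h1 : HasDerivAt (fun t : ℝ => c * (t : ℂ)) c t := by
      simpa using (Complex.ofRealCLM.hasDerivAt (x := t)).const_mul c
    have h := (h1.cexp).const_mul (c ^ i)
    rw [h.deriv]
    ring

theorem contDiff_cexp_ofReal_mul (c : ℂ) :
    ContDiff ℝ ∞ (fun t : ℝ => Complex.exp (c * t)) := by
  have : ContDiff ℝ ∞ (fun t : ℝ => (t : ℂ)) := Complex.ofRealCLM.contDiff
  fun_prop

theorem hasTemperateGrowth_cexp_I_mul :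
    (fun t : ℝ => Complex.exp (Complex.I * t)).HasTemperateGrowth := by
  refine ⟨contDiff_cexp_ofReal_mul _, fun i => ⟨0, 1, fun t => ?_⟩⟩
  rw [norm_iteratedFDeriv_eq_norm_iteratedDeriv, iteratedDeriv_cexp_ofReal_mul]
  simp [mul_comm Complex.I, Complex.norm_exp_ofReal_mul_I]

variable {E : Type*} [NormedAddCommGroup E] [InnerProductSpace ℝ E]

/-- The standard Gaussian `exp (-‖x‖² / 2)` as a Schwartz function. -/
noncomputable def gaussianSchwartz (E : Type*) [NormedAddCommGroup E] [InnerProductSpace ℝ E] : 𝓢(E, ℂ) where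
  toFun x := Complex.exp ((1 : ℂ) * ((-(1 / 2) * ‖x‖ ^ 2 : ℝ) : ℂ))
  smooth' := (contDiff_cexp_ofReal_mul 1).comp (contDiff_const.mul (contDiff_norm_sq ℝ))
  decay' := by
    intro k n
    have hf : (fun x : E => (-(1 / 2) * ‖x‖ ^ 2 : ℝ)).HasTemperateGrowth :=
      (Function.HasTemperateGrowth.const _).mul (Function.hasTemperateGrowth_norm_sq E)
    obtain ⟨l, C, hC0, hC⟩ := hf.norm_iteratedFDeriv_le_uniform n
    refine ⟨n.factorial * (max 1 C) ^ n *
      ((k + l * n).factorial * Real.exp (3 / 2)), fun x => ?_⟩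
    -- Faà di Bruno bound: every derivative of `exp` at `-‖x‖²/2` is the Gaussian itself, and the
    -- derivatives of the exponent grow polynomially.
    have hD := norm_iteratedFDeriv_comp_le (𝕜 := ℝ) (n := n)
      (contDiff_cexp_ofReal_mul 1) hf.1 (by exact_mod_cast le_top) x
      (C := Real.exp (-(1 / 2) * ‖x‖ ^ 2)) (D := max 1 C * (1 + ‖x‖) ^ l)
      (fun i _ => by
        rw [norm_iteratedFDeriv_eq_norm_iteratedDeriv, iteratedDeriv_cexp_ofReal_mul]
        rw [one_pow, one_mul, one_mul, Complex.norm_exp, Complex.ofReal_re])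
      (fun i h1 hi => by
        refine (hC i hi x).trans ?_
        have h2 : (1 : ℝ) ≤ max 1 C * (1 + ‖x‖) ^ l :=
          one_le_mul_of_one_le_of_one_le (le_max_left _ _)
            (one_le_pow₀ (by linarith [norm_nonneg x]))
        calc C * (1 + ‖x‖) ^ l ≤ max 1 C * (1 + ‖x‖) ^ l := by
              gcongr; exact le_max_right _ _
          _ ≤ _ := le_self_pow₀ h2 (by omega))
    have h3 : ‖x‖ ^ k ≤ (1 + ‖x‖) ^ k := by gcongr; linarith [norm_nonneg x]
    -- The polynomial is absorbed through `r^N ≤ N! e^r` at `r = 1 + ‖x‖`, and `1 + ‖x‖ - ‖x‖²/2 ≤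
    -- 3/2`.
    have h4 : (1 + ‖x‖) ^ (k + l * n) * Real.exp (-(1 / 2) * ‖x‖ ^ 2)
        ≤ (k + l * n).factorial * Real.exp (3 / 2) := by
      have h5 := Real.pow_div_factorial_le_exp (1 + ‖x‖) (by positivity) (k + l * n)
      rw [div_le_iff₀ (by positivity)] at h5
      calc _ ≤ Real.exp (1 + ‖x‖) * (k + l * n).factorial * Real.exp (-(1 / 2) * ‖x‖ ^ 2) := by
            gcongr
        _ = (k + l * n).factorial * Real.exp (1 + ‖x‖ + -(1 / 2) * ‖x‖ ^ 2) := by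
            rw [Real.exp_add (1 + ‖x‖)]; ring
        _ ≤ _ := by
            gcongr
            nlinarith [sq_nonneg (‖x‖ - 1)]
    calc _ ≤ (1 + ‖x‖) ^ k * (n.factorial * Real.exp (-(1 / 2) * ‖x‖ ^ 2) *
          (max 1 C * (1 + ‖x‖) ^ l) ^ n) := by gcongr; exact hD
      _ = n.factorial * (max 1 C) ^ n *
          ((1 + ‖x‖) ^ (k + l * n) * Real.exp (-(1 / 2) * ‖x‖ ^ 2)) := by
          rw [mul_pow, pow_add, pow_mul]; ring
      _ ≤ _ := by gcongr

theorem gaussianSchwartz_apply (x : E) :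
    gaussianSchwartz E x = Complex.exp ((-(1 / 2) * ‖x‖ ^ 2 : ℝ) : ℂ) := by
  change Complex.exp ((1 : ℂ) * _) = _
  rw [one_mul]

/-- The displaced, deformed and boosted Gaussian `exp (-‖T (x - s)‖² / 2 + i ⟨d, x⟩)`. -/
noncomputable def gaussianWave (T : E ≃L[ℝ] E) (s d : E) : 𝓢(E, ℂ) :=
  SchwartzMap.smulLeftCLM ℂ (fun x : E => Complex.exp (Complex.I * (inner ℝ d x : ℝ)))
    (SchwartzMap.compSubConstCLM ℂ s
      (SchwartzMap.compCLMOfContinuousLinearEquiv ℂ T (gaussianSchwartz E)))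

theorem gaussianWave_apply (T : E ≃L[ℝ] E) (s d x : E) :
    gaussianWave T s d x =
      Complex.exp (Complex.I * (inner ℝ d x : ℝ) + ((-(1 / 2) * ‖T (x - s)‖ ^ 2 : ℝ) : ℂ)) := by
  have h : (fun x : E => Complex.exp (Complex.I * (inner ℝ d x : ℝ))).HasTemperateGrowth :=
    hasTemperateGrowth_cexp_I_mul.comp (Function.hasTemperateGrowth_inner_right d)
  rw [gaussianWave, SchwartzMap.smulLeftCLM_apply_apply h, SchwartzMap.compSubConstCLM_apply,
    SchwartzMap.compCLMOfContinuousLinearEquiv_apply, Function.comp_apply, gaussianSchwartz_apply,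
    smul_eq_mul, Complex.exp_add]

theorem norm_gaussianWave (T : E ≃L[ℝ] E) (s d x : E) :
    ‖gaussianWave T s d x‖ = Real.exp (-(1 / 2) * ‖T (x - s)‖ ^ 2) := by
  rw [gaussianWave_apply, Complex.norm_exp, Complex.add_re, Complex.ofReal_re]
  simp

theorem lineDerivOp_gaussianWave (T : E ≃L[ℝ] E) (s d v x : E) :
    LineDeriv.lineDerivOp v (gaussianWave T s d) x =
      (Complex.I * (inner ℝ d v : ℝ) - (inner ℝ (T (x - s)) (T v) : ℝ)) *
        gaussianWave T s d x := by
  rw [SchwartzMap.lineDerivOp_apply, lineDeriv]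
  have h1 : HasDerivAt (fun t : ℝ => x + t • v) v 0 := by
    simpa using ((hasDerivAt_id (0 : ℝ)).smul_const v).const_add x
  have h2 : HasDerivAt (fun t : ℝ => inner ℝ d (x + t • v)) (inner ℝ d v) 0 := by
    simpa using (hasDerivAt_const (0 : ℝ) d).inner ℝ h1
  have h3 : HasDerivAt (fun t : ℝ => T (x + t • v - s)) (T v) 0 := by
    have := (T : E →L[ℝ] E).hasFDerivAt.comp_hasDerivAt (0 : ℝ) (h1.sub_const s)
    exact this
  have h4 := h3.norm_sq
  have h5 := (h2.ofReal_comp.const_mul Complex.I).add (h4.const_mul (-(1 / 2))).ofReal_comp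
  have h6 := h5.cexp
  rw [funext (fun t : ℝ => gaussianWave_apply T s d (x + t • v)), gaussianWave_apply]
  refine h6.deriv.trans ?_
  simp only [Pi.add_apply, zero_smul, add_zero]
  push_cast
  ring

/-! ## Position and momentum operators -/

/-- Multiplication by the coordinate `ξ_j`. -/
noncomputable def mulOp (n : ℕ) (j : Fin (n - 1)) : Module.End ℂ (Core n) :=
  (SchwartzMap.smulLeftCLM ℂ (fun ξ : Config n => ((ξ j : ℝ) : ℂ))).toLinearMap

/-- The partial derivative with respect to `ξ_j`. -/
noncomputable def derivOp (n : ℕ) (j : Fin (n - 1)) : Module.End ℂ (Core n) :=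
  (LineDeriv.lineDerivOpCLM ℂ (Core n) (EuclideanSpace.single j (1 : ℝ))).toLinearMap

variable {n : ℕ}

theorem hasTemperateGrowth_coord (j : Fin (n - 1)) :
    (fun ξ : Config n => ((ξ j : ℝ) : ℂ)).HasTemperateGrowth :=
  Function.Complex.hasTemperateGrowth_ofReal.comp
    (EuclideanSpace.proj j : Config n →L[ℝ] ℝ).hasTemperateGrowth

theorem mulOp_apply (j : Fin (n - 1)) (f : Core n) (ξ : Config n) :
    mulOp n j f ξ = (ξ j : ℂ) * f ξ :=
  SchwartzMap.smulLeftCLM_apply_apply (hasTemperateGrowth_coord j) f ξ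

theorem derivOp_apply (j : Fin (n - 1)) (f : Core n) :
    derivOp n j f = LineDeriv.lineDerivOp (EuclideanSpace.single j (1 : ℝ)) f := rfl

theorem derivOp_apply_apply (j : Fin (n - 1)) (f : Core n) (ξ : Config n) :
    derivOp n j f ξ = fderiv ℝ f ξ (EuclideanSpace.single j (1 : ℝ)) :=
  SchwartzMap.lineDerivOp_apply_eq_fderiv _ _ _

theorem commutator_mulOp_mulOp (j k : Fin (n - 1)) :
    mulOp n j * mulOp n k - mulOp n k * mulOp n j = 0 := by
  ext f ξ
  simp only [LinearMap.sub_apply, Module.End.mul_apply, sub_apply,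
    mulOp_apply, LinearMap.zero_apply, zero_apply]
  ring

theorem commutator_derivOp_derivOp (j k : Fin (n - 1)) :
    derivOp n j * derivOp n k - derivOp n k * derivOp n j = 0 := by
  ext f ξ
  have h : ∀ j k, derivOp n j (derivOp n k f) ξ = fderiv ℝ (fderiv ℝ f) ξ
      (EuclideanSpace.single j (1 : ℝ)) (EuclideanSpace.single k (1 : ℝ)) := by
    intro j k
    rw [derivOp_apply_apply]
    have : (derivOp n k f : Config n → ℂ) =
        fun ξ => fderiv ℝ f ξ (EuclideanSpace.single k (1 : ℝ)) :=
      funext fun ξ => derivOp_apply_apply k f ξ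
    rw [this, fderiv_clm_apply
      (((f.smooth 2).fderiv_right (m := 1) (by norm_num)).differentiable (by norm_num) ξ)
      (by fun_prop)]
    simp
  simp only [LinearMap.sub_apply, Module.End.mul_apply, sub_apply, h,
    LinearMap.zero_apply, zero_apply]
  have := ((f.smooth 2).contDiffAt (x := ξ)).isSymmSndFDerivAt (by simp)
  rw [this.eq, sub_self]

theorem commutator_mulOp_derivOp (j k : Fin (n - 1)) :
    mulOp n j * derivOp n k - derivOp n k * mulOp n j = if j = k then (-1 : Module.End ℂ (Core n)) else 0 := by
  ext f ξ
  have h : derivOp n k (mulOp n j f) ξ =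
      (if j = k then 1 else 0) * f ξ + (ξ j : ℂ) * derivOp n k f ξ := by
    rw [derivOp_apply_apply, derivOp_apply_apply]
    have e : (mulOp n j f : Config n → ℂ) = fun ξ => (ξ j : ℂ) * f ξ :=
      funext fun ξ => mulOp_apply j f ξ
    have h1 : HasFDerivAt (fun ξ : Config n => ((ξ j : ℝ) : ℂ))
        (Complex.ofRealCLM.comp
          (EuclideanSpace.proj j : Config n →L[ℝ] ℝ)) ξ :=
      (Complex.ofRealCLM.comp
          (EuclideanSpace.proj j : Config n →L[ℝ] ℝ)).hasFDerivAt
    have h2 : HasFDerivAt (fun ξ : Config n => (ξ j : ℂ) * f ξ) _ ξ :=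
      h1.mul (f.differentiableAt (x := ξ)).hasFDerivAt
    rw [e, h2.fderiv]
    have h3 : (EuclideanSpace.proj j : Config n →L[ℝ] ℝ) (EuclideanSpace.single k (1 : ℝ)) =
        if j = k then 1 else 0 := by
      simp [PiLp.single_apply]
    simp only [add_apply, smul_apply, smul_eq_mul,
      ContinuousLinearMap.comp_apply, Complex.ofRealCLM_apply, h3]
    split_ifs
    · push_cast; ring
    · push_cast; ring
  simp only [LinearMap.sub_apply, Module.End.mul_apply, sub_apply, h,
    mulOp_apply]
  split_ifs <;> simp

theorem formallySymmetric_mulOp (j : Fin (n - 1)) : FormallySymmetric (mulOp n j) := by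
  intro f g
  rw [inner_incl, inner_incl]
  congr 1
  ext ξ
  rw [mulOp_apply, mulOp_apply]
  simp only [RCLike.inner_apply, map_mul, Complex.conj_ofReal]
  ring

theorem formallySymmetric_derivOp (j : Fin (n - 1)) :
    FormallySymmetric ((-Complex.I) • derivOp n j) := by
  intro f g
  -- Integration by parts for the real bilinear pairing `(z, w) ↦ z̄ w`; the factor `-i` turns
  -- antisymmetry into symmetry.
  have h := SchwartzMap.integral_bilinear_lineDerivOp_right_eq_neg_left (μ := volume) f g
    ((ContinuousLinearMap.mul ℝ ℂ).comp (Complex.conjCLE : ℂ →L[ℝ] ℂ))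
    (EuclideanSpace.single j (1 : ℝ))
  rw [LinearMap.smul_apply, LinearMap.smul_apply, map_smul, map_smul, inner_smul_left,
    inner_smul_right, inner_incl, inner_incl]
  have h1 : ∀ f g : Core n, ∫ ξ, inner ℂ (f ξ) (g ξ) = ∫ ξ,
      ((ContinuousLinearMap.mul ℝ ℂ).comp (Complex.conjCLE : ℂ →L[ℝ] ℂ)) (f ξ) (g ξ) := by
    intro f g
    congr 1
    ext ξ
    simp [RCLike.inner_apply, mul_comm]
  rw [h1, h1, derivOp_apply, derivOp_apply, h]
  simp

theorem commutator_sum {κ : Type*} [Fintype κ] (u v : κ → ℂ) (A B : κ → Module.End ℂ (Core n)) :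
    (∑ j, u j • A j) * (∑ k, v k • B k) - (∑ k, v k • B k) * (∑ j, u j • A j) =
      ∑ j, ∑ k, (u j * v k) • (A j * B k - B k * A j) := by
  rw [Finset.sum_mul_sum, Finset.sum_mul_sum, Finset.sum_comm (γ := κ) (s := Finset.univ)
    (f := fun i j => v i • B i * u j • A j), ← Finset.sum_sub_distrib]
  refine Finset.sum_congr rfl fun j _ => ?_
  rw [← Finset.sum_sub_distrib]
  refine Finset.sum_congr rfl fun k _ => ?_
  rw [smul_mul_smul_comm, smul_mul_smul_comm, mul_comm (v k), smul_sub]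

theorem commutator_sub_scalarOp (c d : ℂ) (A B : Module.End ℂ (Core n)) :
    (A - scalarOp n c) * (B - scalarOp n d) - (B - scalarOp n d) * (A - scalarOp n c) =
      A * B - B * A := by
  simp only [scalarOp, sub_mul, mul_sub, smul_mul_assoc, mul_smul_comm, one_mul, mul_one]
  module

/-- The position operator `∑ u_j (ξ_j - s_j)`. -/
noncomputable def posOp (n : ℕ) (s u : Fin (n - 1) → ℝ) : Module.End ℂ (Core n) :=
  ∑ j, (u j : ℂ) • (mulOp n j - scalarOp n (s j))

/-- The momentum operator `∑ v_j (-i ∂_j - d_j)`. -/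
noncomputable def momOp (n : ℕ) (d v : Fin (n - 1) → ℝ) : Module.End ℂ (Core n) :=
  ∑ j, (v j : ℂ) • ((-Complex.I) • derivOp n j - scalarOp n (d j))

theorem formallySymmetric_posOp (s u : Fin (n - 1) → ℝ) : FormallySymmetric (posOp n s u) := by
  refine FormallySymmetric.sum _ fun j _ => FormallySymmetric.real_smul _ ?_
  have h := (formallySymmetric_mulOp j).add
    ((FormallySymmetric.scalarOp (n := n) (s j)).real_smul (-1))
  convert h using 1
  simp [sub_eq_add_neg]

theorem formallySymmetric_momOp (d v : Fin (n - 1) → ℝ) : FormallySymmetric (momOp n d v) := by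
  refine FormallySymmetric.sum _ fun j _ => FormallySymmetric.real_smul _ ?_
  have h := (formallySymmetric_derivOp j).add
    ((FormallySymmetric.scalarOp (n := n) (d j)).real_smul (-1))
  convert h using 1
  simp [sub_eq_add_neg]

theorem commute_posOp (s u u' : Fin (n - 1) → ℝ) : Commute (posOp n s u) (posOp n s u') := by
  rw [commute_iff_eq, ← sub_eq_zero, posOp, posOp, commutator_sum]
  simp [commutator_sub_scalarOp, commutator_mulOp_mulOp]

theorem commute_momOp (d v v' : Fin (n - 1) → ℝ) : Commute (momOp n d v) (momOp n d v') := by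
  rw [commute_iff_eq, ← sub_eq_zero, momOp, momOp, commutator_sum]
  simp only [commutator_sub_scalarOp, smul_mul_smul_comm, ← smul_sub, commutator_derivOp_derivOp]
  simp

theorem commutator_posOp_momOp (s d u v : Fin (n - 1) → ℝ) :
    posOp n s u * momOp n d v - momOp n d v * posOp n s u =
      (Complex.I * ((∑ j, u j * v j : ℝ) : ℂ)) • 1 := by
  rw [posOp, momOp, commutator_sum]
  simp only [commutator_sub_scalarOp, mul_smul_comm, smul_mul_assoc, ← smul_sub,
    commutator_mulOp_derivOp]
  have : ∀ j k : Fin (n - 1), ((u j : ℂ) * (v k : ℂ)) • (-Complex.I) •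
      (if j = k then (-1 : Module.End ℂ (Core n)) else 0) =
      if j = k then (Complex.I * ((u j * v j : ℝ) : ℂ)) • (1 : Module.End ℂ (Core n)) else 0 := by
    intro j k
    split_ifs with h
    · subst h
      rw [smul_neg, neg_smul, neg_neg, smul_smul]
      congr 1
      push_cast
      ring
    · simp
  simp only [this, Finset.sum_ite_eq, Finset.mem_univ, if_true]
  rw [← Finset.sum_smul]
  congr 1
  push_cast
  rw [Finset.mul_sum]

/-! ## Canonical pairs and their Fock basis -/

/-- A complete system of canonical pairs `(q_k, p_k)` on the Schwartz core together with its
vacuum vector. -/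
structure CanonicalPairs (n : ℕ) where
  q : Fin (n - 1) → Module.End ℂ (Core n)
  p : Fin (n - 1) → Module.End ℂ (Core n)
  commute_q : ∀ k l, Commute (q k) (q l)
  commute_p : ∀ k l, Commute (p k) (p l)
  ccr : ∀ k l, q k * p l - p l * q k = if k = l then Complex.I • 1 else 0
  symm_q : ∀ k, FormallySymmetric (q k)
  symm_p : ∀ k, FormallySymmetric (p k)
  vac : Core n
  norm_vac : ‖incl n vac‖ = 1
  annihilate : ∀ k, q k vac + Complex.I • p k vac = 0
  -- Cyclicity of the vacuum under the positions alone. It is the only analytic input to the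
  -- completeness of the Fock basis.
  complete : ∀ V : Submodule ℂ (Core n), vac ∈ V → (∀ k, ∀ f ∈ V, q k f ∈ V) →
    ∀ u : Hilb n, (∀ f ∈ V, inner ℂ (incl n f) u = 0) → u = 0

namespace CanonicalPairs

variable {n : ℕ} (M : CanonicalPairs n)

/-- The annihilation operator of the mode `k`. -/
noncomputable def ann (k : Fin (n - 1)) : Module.End ℂ (Core n) :=
  ((√2 : ℝ) : ℂ)⁻¹ • (M.q k + Complex.I • M.p k)

/-- The creation operator of the mode `k`. -/
noncomputable def cre (k : Fin (n - 1)) : Module.End ℂ (Core n) :=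
  ((√2 : ℝ) : ℂ)⁻¹ • (M.q k - Complex.I • M.p k)

theorem sqrt_two_inv_mul_self : ((√2 : ℝ) : ℂ)⁻¹ * ((√2 : ℝ) : ℂ)⁻¹ = 1 / 2 := by
  rw [← mul_inv, ← Complex.ofReal_mul, Real.mul_self_sqrt (by norm_num)]
  norm_num

theorem q_eq (k : Fin (n - 1)) : M.q k = ((√2 : ℝ) : ℂ)⁻¹ • (M.ann k + M.cre k) := by
  simp only [ann, cre, ← smul_add, smul_smul, sqrt_two_inv_mul_self]
  module

theorem p_eq (k : Fin (n - 1)) :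
    M.p k = (-Complex.I * ((√2 : ℝ) : ℂ)⁻¹) • (M.ann k - M.cre k) := by
  simp only [ann, cre, ← smul_sub, smul_smul, mul_assoc, sqrt_two_inv_mul_self]
  rw [show M.q k + Complex.I • M.p k - (M.q k - Complex.I • M.p k) =
    (2 * Complex.I) • M.p k by module, smul_smul]
  rw [show -Complex.I * (1 / 2) * (2 * Complex.I) = 1 by
    linear_combination -Complex.I_mul_I, one_smul]

theorem q_mul_p (k l : Fin (n - 1)) :
    M.q k * M.p l = M.p l * M.q k + if k = l then Complex.I • 1 else 0 := by
  rw [← M.ccr k l]; abel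

theorem ann_mul_cre (k l : Fin (n - 1)) :
    M.ann k * M.cre l = M.cre l * M.ann k + if k = l then 1 else 0 := by
  have h1 := M.q_mul_p k l
  have h2 := M.q_mul_p l k
  rw [ann, cre, smul_mul_assoc, mul_smul_comm, smul_mul_assoc, mul_smul_comm, smul_smul, smul_smul,
    sqrt_two_inv_mul_self]
  simp only [add_mul, mul_sub, sub_mul,
    mul_add, smul_mul_assoc, mul_smul_comm, h1, h2, (M.commute_q k l).eq, (M.commute_p k l).eq]
  rcases eq_or_ne k l with h | h
  · subst h
    simp only [if_true, smul_add, smul_sub, smul_smul, Complex.I_mul_I]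
    module
  · simp only [h, h.symm, if_false, add_zero]
    module

theorem commute_cre (k l : Fin (n - 1)) : Commute (M.cre k) (M.cre l) := by
  have h1 := M.q_mul_p k l
  have h2 := M.q_mul_p l k
  rw [commute_iff_eq]
  simp only [cre, sub_mul,
    mul_sub, smul_mul_assoc, mul_smul_comm, h1, h2, (M.commute_q k l).eq, (M.commute_p k l).eq]
  rcases eq_or_ne k l with h | h
  · subst h; rfl
  · simp only [h, h.symm, if_false, add_zero]
    module

theorem ann_vac (k : Fin (n - 1)) : M.ann k M.vac = 0 := by
  rw [ann, LinearMap.smul_apply, LinearMap.add_apply, LinearMap.smul_apply, M.annihilate k,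
    smul_zero]

theorem inner_cre (k : Fin (n - 1)) (f g : Core n) :
    inner ℂ (incl n (M.cre k f)) (incl n g) = inner ℂ (incl n f) (incl n (M.ann k g)) := by
  have h1 := M.symm_q k f g
  have h2 := M.symm_p k f g
  simp only [ann, cre, LinearMap.smul_apply, LinearMap.sub_apply, LinearMap.add_apply]
  rw [map_smul, map_smul, inner_smul_left, inner_smul_right, map_sub, map_add, map_smul, map_smul,
    inner_sub_left, inner_add_right, inner_smul_left, inner_smul_right, h1, h2]
  simp only [map_inv₀, Complex.conj_ofReal, Complex.conj_I]
  ring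

theorem inner_ann (k : Fin (n - 1)) (f g : Core n) :
    inner ℂ (incl n (M.ann k f)) (incl n g) = inner ℂ (incl n f) (incl n (M.cre k g)) := by
  rw [← inner_conj_symm, ← M.inner_cre, inner_conj_symm]

/-- The normalised power `(a_k^*)^m / √m!`. -/
noncomputable def crePow (k : Fin (n - 1)) (m : ℕ) : Module.End ℂ (Core n) :=
  ((√(m.factorial : ℝ))⁻¹ : ℂ) • M.cre k ^ m

theorem crePow_zero (k : Fin (n - 1)) : M.crePow k 0 = 1 := by simp [crePow]

theorem sqrt_factorial_ne_zero (m : ℕ) : ((√(m.factorial : ℝ) : ℝ) : ℂ) ≠ 0 := by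
  rw [Complex.ofReal_ne_zero]
  positivity

theorem sqrt_factorial_succ (m : ℕ) : ((√((m + 1).factorial : ℝ) : ℝ) : ℂ) =
    (√((m : ℝ) + 1) : ℝ) * (√(m.factorial : ℝ) : ℝ) := by
  rw [← Complex.ofReal_mul, ← Real.sqrt_mul (by positivity), Nat.factorial_succ]
  push_cast
  rfl

theorem sqrt_succ_ne_zero (m : ℕ) : ((√((m : ℝ) + 1) : ℝ) : ℂ) ≠ 0 := by
  rw [Complex.ofReal_ne_zero]
  positivity

theorem cre_mul_crePow (k : Fin (n - 1)) (m : ℕ) :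
    M.cre k * M.crePow k m = ((√((m : ℝ) + 1) : ℝ) : ℂ) • M.crePow k (m + 1) := by
  rw [crePow, crePow, mul_smul_comm, ← pow_succ', smul_smul, sqrt_factorial_succ]
  congr 1
  have := sqrt_succ_ne_zero m
  have := sqrt_factorial_ne_zero m
  field_simp

theorem ann_mul_cre_pow (k : Fin (n - 1)) (m : ℕ) :
    M.ann k * M.cre k ^ (m + 1) = M.cre k ^ (m + 1) * M.ann k + ((m + 1 : ℕ) : ℂ) • M.cre k ^ m := by
  induction m with
  | zero => simp [M.ann_mul_cre k k]
  | succ m ih =>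
    rw [pow_succ, ← mul_assoc, ih, add_mul, mul_assoc, M.ann_mul_cre k k, if_pos rfl, mul_add,
      mul_one, ← mul_assoc, ← pow_succ, smul_mul_assoc, ← pow_succ]
    push_cast
    module

theorem ann_mul_crePow (k : Fin (n - 1)) (m : ℕ) :
    M.ann k * M.crePow k m =
      M.crePow k m * M.ann k + ((√(m : ℝ) : ℝ) : ℂ) • M.crePow k (m - 1) := by
  cases m with
  | zero => simp [crePow]
  | succ m =>
    rw [crePow, crePow, mul_smul_comm, ann_mul_cre_pow, smul_add, smul_mul_assoc, smul_smul,
      smul_smul, sqrt_factorial_succ, Nat.add_sub_cancel]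
    congr 2
    have h1 := sqrt_succ_ne_zero m
    have h2 := sqrt_factorial_ne_zero m
    have h3 : ((√((m : ℝ) + 1) : ℝ) : ℂ) * (√((m : ℝ) + 1) : ℝ) = (m : ℂ) + 1 := by
      rw [← Complex.ofReal_mul, Real.mul_self_sqrt (by positivity)]
      push_cast; rfl
    push_cast
    field_simp
    rw [pow_two, h3]

theorem commute_crePow (k l : Fin (n - 1)) (i j : ℕ) : Commute (M.crePow k i) (M.crePow l j) :=
  (((M.commute_cre k l).pow_pow i j).smul_left _).smul_right _

theorem commute_ann_crePow {k l : Fin (n - 1)} (h : k ≠ l) (j : ℕ) :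
    Commute (M.ann k) (M.crePow l j) := by
  refine (Commute.pow_right ?_ j).smul_right _
  rw [commute_iff_eq, M.ann_mul_cre, if_neg h, add_zero]

theorem pairwise_commute_crePow (α : Fin (n - 1) → ℕ) (s : Finset (Fin (n - 1))) :
    (s : Set (Fin (n - 1))).Pairwise (Function.onFun Commute fun k => M.crePow k (α k)) :=
  fun _ _ _ _ _ => M.commute_crePow _ _ _ _

/-- The product `∏ (a_k^*)^(α k) / √(α k)!`. -/
noncomputable def creProd (α : Fin (n - 1) → ℕ) (s : Finset (Fin (n - 1))) :
    Module.End ℂ (Core n) :=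
  s.noncommProd (fun k => M.crePow k (α k)) (M.pairwise_commute_crePow α s)

/-- The normalised Fock vectors. -/
noncomputable def fock (α : Fin (n - 1) → ℕ) : Core n := M.creProd α Finset.univ M.vac

/-- All creation operators commute, so the factor of mode `k` can be pulled to the front and the
ladder operators of `k` act as for a single oscillator. -/
theorem fock_update (α : Fin (n - 1) → ℕ) (k : Fin (n - 1)) (m : ℕ) :
    M.fock (Function.update α k m) =
      M.crePow k m (M.creProd α (Finset.univ.erase k) M.vac) := by
  rw [fock, creProd, ← Finset.mul_noncommProd_erase Finset.univ (Finset.mem_univ k),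
    Module.End.mul_apply, Function.update_self, creProd]
  congr 2
  refine Finset.noncommProd_congr rfl (fun l hl => ?_) _
  rw [Function.update_of_ne (Finset.ne_of_mem_erase hl)]

theorem fock_eq (α : Fin (n - 1) → ℕ) (k : Fin (n - 1)) :
    M.fock α = M.crePow k (α k) (M.creProd α (Finset.univ.erase k) M.vac) := by
  rw [← fock_update, Function.update_eq_self]

theorem cre_fock (α : Fin (n - 1) → ℕ) (k : Fin (n - 1)) :
    M.cre k (M.fock α) =
      ((√((α k : ℝ) + 1) : ℝ) : ℂ) • M.fock (Function.update α k (α k + 1)) := by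
  rw [M.fock_eq α k, fock_update, ← Module.End.mul_apply, cre_mul_crePow]
  rfl

/-- The annihilator of `k` commutes with the other modes and kills the vacuum. The truncated `α k -
1` at `α k = 0` is harmless because its coefficient is `√0`. -/
theorem ann_fock (α : Fin (n - 1) → ℕ) (k : Fin (n - 1)) :
    M.ann k (M.fock α) =
      ((√(α k : ℝ) : ℝ) : ℂ) • M.fock (Function.update α k (α k - 1)) := by
  have h : M.ann k (M.creProd α (Finset.univ.erase k) M.vac) = 0 := by
    have hc : Commute (M.ann k) (M.creProd α (Finset.univ.erase k)) :=
      Finset.noncommProd_commute _ _ _ _ fun l hl =>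
        M.commute_ann_crePow (Finset.ne_of_mem_erase hl).symm _
    rw [← Module.End.mul_apply, hc.eq, Module.End.mul_apply, ann_vac, map_zero]
  rw [M.fock_eq α k, fock_update, ← Module.End.mul_apply, ann_mul_crePow, LinearMap.add_apply,
    Module.End.mul_apply, h, map_zero, zero_add]
  rfl

theorem fock_zero : M.fock 0 = M.vac := by
  have : M.creProd 0 Finset.univ = 1 := by
    refine Finset.noncommProd_induction _ _ _ (fun A => A = 1) ?_ rfl ?_
    · rintro _ _ rfl rfl; simp
    · intro k _; exact M.crePow_zero k
  rw [fock, this]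
  rfl

theorem cre_ann_fock (α : Fin (n - 1) → ℕ) (k : Fin (n - 1)) :
    M.cre k (M.ann k (M.fock α)) = (α k : ℂ) • M.fock α := by
  rw [ann_fock, map_smul, cre_fock]
  rcases Nat.eq_zero_or_pos (α k) with h | h
  · simp [h]
  · simp only [Function.update_self, Function.update_idem, smul_smul]
    rw [Nat.sub_add_cancel h, Function.update_eq_self, ← Complex.ofReal_mul, Nat.cast_sub h]
    simp

/-- Induction on the total occupation. For an occupied mode, `‖a_k f_α‖² = ⟨f_α, a_k^* a_k f_α⟩ =
α_k ‖f_α‖²`, while `a_k f_α` is `√α_k` times a Fock vector of lower occupation. -/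
theorem norm_fock (α : Fin (n - 1) → ℕ) : ‖incl n (M.fock α)‖ = 1 := by
  induction hN : ∑ k, α k generalizing α with
  | zero =>
    have : α = 0 := by
      ext k
      exact (Finset.sum_eq_zero_iff.1 hN) k (Finset.mem_univ k)
    rw [this, fock_zero, norm_vac]
  | succ N ih =>
    obtain ⟨k, hk⟩ : ∃ k, 0 < α k := by
      by_contra! h
      have : ∑ k, α k = 0 := Finset.sum_eq_zero fun k _ => by simpa using h k
      omega
    have h1 := ih (Function.update α k (α k - 1)) (by
      rw [Finset.sum_update_of_mem (Finset.mem_univ k)]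
      have := Finset.add_sum_erase Finset.univ α (Finset.mem_univ k)
      rw [← Finset.sdiff_singleton_eq_erase] at this
      omega)
    have h2 := M.inner_ann k (M.fock α) (M.ann k (M.fock α))
    have h3 : ((√(α k : ℝ) : ℝ) : ℂ) ^ 2 = α k := by
      rw [← Complex.ofReal_pow, Real.sq_sqrt (by positivity)]
      simp
    rw [cre_ann_fock, ann_fock, map_smul, map_smul, inner_smul_left, inner_smul_right,
      inner_smul_right, inner_self_eq_norm_sq_to_K, inner_self_eq_norm_sq_to_K, h1,
      Complex.conj_ofReal, ← mul_assoc, ← pow_two, h3] at h2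
    have h4 := mul_left_cancel₀ (by exact_mod_cast hk.ne') h2
    have h5 : (1 : ℝ) ^ 2 = ‖incl n (M.fock α)‖ ^ 2 := by exact_mod_cast h4
    nlinarith [norm_nonneg (incl n (M.fock α))]

/-- The number operator of a mode on which `α` and `β` differ is symmetric and has different
eigenvalues on the two vectors. -/
theorem inner_fock_of_ne {α β : Fin (n - 1) → ℕ} (h : α ≠ β) :
    inner ℂ (incl n (M.fock α)) (incl n (M.fock β)) = 0 := by
  obtain ⟨k, hk⟩ := Function.ne_iff.1 h
  have h1 := M.inner_cre k (M.ann k (M.fock α)) (M.fock β)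
  rw [M.inner_ann, cre_ann_fock, cre_ann_fock, map_smul, map_smul, inner_smul_left,
    inner_smul_right] at h1
  by_contra h2
  have h3 := mul_right_cancel₀ h2 h1
  rw [Complex.conj_natCast] at h3
  exact hk (by exact_mod_cast h3)

theorem inner_fock (α β : Fin (n - 1) → ℕ) :
    inner ℂ (incl n (M.fock α)) (incl n (M.fock β)) = if α = β then 1 else 0 := by
  split_ifs with h
  · rw [h, inner_self_eq_norm_sq_to_K, norm_fock]; simp
  · exact M.inner_fock_of_ne h

theorem orthonormal_fock : Orthonormal ℂ fun α => incl n (M.fock α) :=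
  ⟨M.norm_fock, fun _ _ h => M.inner_fock_of_ne h⟩

/-- The span of the Fock vectors contains the vacuum and is stable under `q_k = (a_k + a_k^*)/√2`,
so cyclicity of the vacuum applies. -/
theorem fock_complete (u : Hilb n) (hu : ∀ α, inner ℂ (incl n (M.fock α)) u = 0) : u = 0 := by
  refine M.complete (Submodule.span ℂ (Set.range M.fock)) ?_ ?_ u ?_
  · rw [← M.fock_zero]
    exact Submodule.subset_span ⟨0, rfl⟩
  · intro k f hf
    induction hf using Submodule.span_induction with
    | mem f hf =>
      obtain ⟨α, rfl⟩ := hf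
      rw [q_eq, LinearMap.smul_apply, LinearMap.add_apply, ann_fock, cre_fock]
      exact Submodule.smul_mem _ _ (Submodule.add_mem _
        (Submodule.smul_mem _ _ (Submodule.subset_span ⟨_, rfl⟩))
        (Submodule.smul_mem _ _ (Submodule.subset_span ⟨_, rfl⟩)))
    | zero => simp
    | add f g _ _ hf hg => rw [map_add]; exact Submodule.add_mem _ hf hg
    | smul c f _ hf => rw [map_smul]; exact Submodule.smul_mem _ _ hf
  · intro f hf
    induction hf using Submodule.span_induction with
    | mem f hf =>
      obtain ⟨α, rfl⟩ := hf
      exact hu α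
    | zero => simp
    | add f g _ _ hf hg => rw [map_add, inner_add_left, hf, hg, add_zero]
    | smul c f _ hf => rw [map_smul, inner_smul_left, hf, mul_zero]

/-- The Fock basis of `L²`. -/
noncomputable def fockBasis : HilbertBasis (Fin (n - 1) → ℕ) ℂ (Hilb n) :=
  HilbertBasis.mkOfOrthogonalEqBot M.orthonormal_fock (by
    rw [Submodule.eq_bot_iff]
    intro u hu
    rw [Submodule.mem_orthogonal] at hu
    exact M.fock_complete u fun α => hu _ (Submodule.subset_span ⟨α, rfl⟩))

theorem fockBasis_apply (α : Fin (n - 1) → ℕ) : M.fockBasis α = incl n (M.fock α) := by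
  simp [fockBasis]

end CanonicalPairs

/-! ## Sums over occupation numbers -/

/-- On a box of occupation numbers, the sum of products factorises. Every finite set lies in a box,
which bounds partial sums from above; the growing boxes `range N` reach the product of the sums.
Nonnegativity makes the total a supremum. -/
theorem hasSum_pi_prod {κ : Type*} [Fintype κ] [DecidableEq κ] {f : κ → ℕ → ℝ} {S : κ → ℝ}
    (hf : ∀ k m, 0 ≤ f k m) (hS : ∀ k, HasSum (f k) (S k)) :
    HasSum (fun α : κ → ℕ => ∏ k, f k (α k)) (∏ k, S k) := by
  refine hasSum_of_isLUB_of_nonneg _ (fun α => Finset.prod_nonneg fun k _ => hf k _) ⟨?_, ?_⟩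
  · rintro _ ⟨s, rfl⟩
    have hsub : s ⊆ Fintype.piFinset fun k => s.image fun α => α k := by
      intro α hα
      rw [Fintype.mem_piFinset]
      exact fun k => Finset.mem_image_of_mem _ hα
    calc ∑ α ∈ s, ∏ k, f k (α k)
        ≤ ∑ α ∈ Fintype.piFinset (fun k => s.image fun α => α k), ∏ k, f k (α k) :=
          Finset.sum_le_sum_of_subset_of_nonneg hsub fun α _ _ =>
            Finset.prod_nonneg fun k _ => hf k _
      _ = ∏ k, ∑ m ∈ s.image (fun α => α k), f k m := (Finset.prod_univ_sum _ _).symm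
      _ ≤ ∏ k, S k := Finset.prod_le_prod
          (fun k _ => Finset.sum_nonneg fun m _ => hf k m)
          (fun k _ => sum_le_hasSum _ (fun m _ => hf k m) (hS k))
  · intro B hB
    have hlim : Tendsto (fun N : ℕ => ∏ k, ∑ m ∈ Finset.range N, f k m) atTop (𝓝 (∏ k, S k)) :=
      tendsto_finsetProd _ fun k _ => (hS k).tendsto_sum_nat
    refine le_of_tendsto hlim (Eventually.of_forall fun N => ?_)
    rw [Finset.prod_univ_sum]
    exact hB ⟨_, rfl⟩

/-- The thermal occupation `(1/2) coth (ν/2)` of a mode of frequency `ν`. -/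
noncomputable def thermalFactor (ν : ℝ) : ℝ :=
  (1 / 2) * ((1 + Real.exp (-ν)) / (1 - Real.exp (-ν)))

theorem hasSum_geometric_mul {ν : ℝ} (hν : 0 < ν) :
    HasSum (fun m : ℕ => Real.exp (-ν) ^ m * ((m : ℝ) + 1 / 2))
      ((1 - Real.exp (-ν))⁻¹ * thermalFactor ν) := by
  have hq : Real.exp (-ν) < 1 := by
    rw [Real.exp_lt_one_iff]
    linarith
  have hg := hasSum_geometric_of_lt_one (Real.exp_pos (-ν)).le hq
  have h1 := hasSum_coe_mul_geometric_of_norm_lt_one (𝕜 := ℝ) (r := Real.exp (-ν))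
    (by rwa [Real.norm_of_nonneg (Real.exp_pos _).le])
  have e : (1 - Real.exp (-ν))⁻¹ * thermalFactor ν =
      Real.exp (-ν) / (1 - Real.exp (-ν)) ^ 2 + 1 / 2 * (1 - Real.exp (-ν))⁻¹ := by
    have : 1 - Real.exp (-ν) ≠ 0 := by linarith
    rw [thermalFactor]
    field_simp
    ring
  have e' : (fun m : ℕ => Real.exp (-ν) ^ m * ((m : ℝ) + 1 / 2)) =
      fun m : ℕ => (m : ℝ) * Real.exp (-ν) ^ m + 1 / 2 * Real.exp (-ν) ^ m :=
    funext fun m => by ring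
  rw [e, e']
  exact h1.add (hg.mul_left (1 / 2))

section weights

variable {κ : Type*} [Fintype κ] (ν : κ → ℝ)

/-- The Boltzmann weight of an occupation number. -/
noncomputable def boltzmann (α : κ → ℕ) : ℝ := ∏ k, Real.exp (-ν k) ^ α k

/-- The partition function of the modes, without the zero-point energy. -/
noncomputable def partition : ℝ := ∏ k, (1 - Real.exp (-ν k))⁻¹

variable {ν}

theorem exp_neg_lt_one {κ : Type*} {ν : κ → ℝ} (hν : ∀ k, 0 < ν k) (k : κ) : Real.exp (-ν k) < 1 := by
  rw [Real.exp_lt_one_iff]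
  linarith [hν k]

theorem partition_pos (hν : ∀ k, 0 < ν k) : 0 < partition ν :=
  Finset.prod_pos fun k _ => inv_pos.2 (sub_pos.2 (exp_neg_lt_one hν k))

theorem hasSum_boltzmann [DecidableEq κ] (hν : ∀ k, 0 < ν k) : HasSum (boltzmann ν) (partition ν) :=
  hasSum_pi_prod (fun k m => by positivity) fun k =>
    hasSum_geometric_of_lt_one (Real.exp_pos _).le (exp_neg_lt_one hν k)

theorem hasSum_boltzmann_mul [DecidableEq κ] (hν : ∀ k, 0 < ν k) (k : κ) :
    HasSum (fun α => boltzmann ν α * ((α k : ℝ) + 1 / 2)) (partition ν * thermalFactor (ν k)) := by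
  -- The weight `m + 1/2` is inserted in the factor `k` only, which keeps the product form.
  have h := hasSum_pi_prod (κ := κ)
    (f := fun j m => Real.exp (-ν j) ^ m * if j = k then (m : ℝ) + 1 / 2 else 1)
    (S := fun j => (1 - Real.exp (-ν j))⁻¹ * if j = k then thermalFactor (ν k) else 1)
    (fun j m => by split_ifs <;> positivity) (fun j => by
      have hq := exp_neg_lt_one hν j
      have hg := hasSum_geometric_of_lt_one (Real.exp_pos (-ν j)).le hq
      by_cases hj : j = k
      · simpa [hj] using hasSum_geometric_mul (hν k)
      · simpa [hj] using hg)
  simp only [Finset.prod_mul_distrib, Finset.prod_ite_eq', Finset.mem_univ, if_true] at h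
  exact h

theorem one_add_sum_le_prod [DecidableEq κ] (α : κ → ℕ) : (1 : ℝ) + ∑ k, (α k : ℝ) ≤ ∏ k, ((α k : ℝ) + 1) := by
  induction (Finset.univ : Finset κ) using Finset.induction_on with
  | empty => simp
  | insert k s hk ih =>
    rw [Finset.sum_insert hk, Finset.prod_insert hk]
    have : 0 ≤ ∑ j ∈ s, (α j : ℝ) := Finset.sum_nonneg fun _ _ => by positivity
    nlinarith [mul_le_mul_of_nonneg_left ih (by positivity : (0 : ℝ) ≤ α k + 1),
      mul_nonneg (Nat.cast_nonneg (α := ℝ) (α k)) this]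

/-- Two fields applied to a Fock vector cost at most a multiple of `(∑ α_k + 2)²`. This is dominated
by `4 ∏ (α_k + 1)²`, which factorises over the modes. -/
theorem summable_boltzmann_mul_sq [DecidableEq κ] (hν : ∀ k, 0 < ν k) :
    Summable fun α => boltzmann ν α * ((∑ k, (α k : ℝ)) + 2) ^ 2 := by
  have h := (hasSum_pi_prod (κ := κ)
    (f := fun j m => Real.exp (-ν j) ^ m * ((m : ℝ) + 1) ^ 2)
    (fun j m => by positivity) (fun j => by
      have hq : ‖Real.exp (-ν j)‖ < 1 := by
        rw [Real.norm_of_nonneg (Real.exp_pos _).le]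
        exact exp_neg_lt_one hν j
      have h0 := summable_pow_mul_geometric_of_norm_lt_one (R := ℝ) 0 hq
      have h1 := summable_pow_mul_geometric_of_norm_lt_one (R := ℝ) 1 hq
      have h2 := summable_pow_mul_geometric_of_norm_lt_one (R := ℝ) 2 hq
      have h3 : Summable fun m : ℕ => Real.exp (-ν j) ^ m * ((m : ℝ) + 1) ^ 2 := by
        refine ((h2.add (h1.mul_left 2)).add h0).congr fun m => ?_
        ring
      exact h3.hasSum)).summable
  refine Summable.of_nonneg_of_le (fun α => ?_) (fun α => ?_) (h.mul_left 4)
  · exact mul_nonneg (Finset.prod_nonneg fun _ _ => by positivity) (sq_nonneg _)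
  · rw [Finset.prod_mul_distrib, Finset.prod_pow]
    have h1 := one_add_sum_le_prod α
    have h0 : 0 ≤ ∑ k, (α k : ℝ) := Finset.sum_nonneg fun _ _ => by positivity
    have h2 : ((∑ k, (α k : ℝ)) + 2) ^ 2 ≤ 4 * (∏ k, ((α k : ℝ) + 1)) ^ 2 := by nlinarith
    calc _ ≤ boltzmann ν α * (4 * (∏ k, ((α k : ℝ) + 1)) ^ 2) :=
          mul_le_mul_of_nonneg_left h2 (Finset.prod_nonneg fun _ _ => by positivity)
      _ = _ := by rw [boltzmann]; ring

end weights

open scoped ComplexConjugate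

/-! ## Thermal averages in the Fock basis -/

namespace CanonicalPairs

variable {n : ℕ} (M : CanonicalPairs n)

/-- The field operator `z a_k + z̄ a_k^*`. -/
noncomputable def field (z : ℂ) (k : Fin (n - 1)) : Module.End ℂ (Core n) :=
  z • M.ann k + conj z • M.cre k

/-- A real linear combination of field operators. -/
noncomputable def lin (z : ℂ) (x : Fin (n - 1) → ℝ) : Module.End ℂ (Core n) :=
  ∑ k, (x k : ℂ) • M.field z k

theorem sum_smul_q (x : Fin (n - 1) → ℝ) :
    ∑ k, (x k : ℂ) • M.q k = M.lin ((√2 : ℝ) : ℂ)⁻¹ x := by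
  refine Finset.sum_congr rfl fun k _ => ?_
  rw [field, q_eq, smul_add, map_inv₀, Complex.conj_ofReal]

theorem sum_smul_p (x : Fin (n - 1) → ℝ) :
    ∑ k, (x k : ℂ) • M.p k = M.lin (-Complex.I * ((√2 : ℝ) : ℂ)⁻¹) x := by
  refine Finset.sum_congr rfl fun k _ => ?_
  rw [field, p_eq, smul_sub, map_mul, map_neg, Complex.conj_I, map_inv₀, Complex.conj_ofReal]
  module

theorem formallySymmetric_field (z : ℂ) (k : Fin (n - 1)) : FormallySymmetric (M.field z k) := by
  intro f g
  simp only [field, LinearMap.add_apply, LinearMap.smul_apply, map_add, map_smul, inner_add_left,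
    inner_add_right, inner_smul_left, inner_smul_right, M.inner_ann, M.inner_cre,
    Complex.conj_conj]
  ring

theorem formallySymmetric_lin (z : ℂ) (x : Fin (n - 1) → ℝ) : FormallySymmetric (M.lin z x) :=
  FormallySymmetric.sum _ fun k _ => (M.formallySymmetric_field z k).real_smul _

theorem field_fock (z : ℂ) (k : Fin (n - 1)) (α : Fin (n - 1) → ℕ) :
    M.field z k (M.fock α) =
      (z * (√(α k : ℝ) : ℝ)) • M.fock (Function.update α k (α k - 1)) +
        (conj z * (√((α k : ℝ) + 1) : ℝ)) • M.fock (Function.update α k (α k + 1)) := by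
  rw [field, LinearMap.add_apply, LinearMap.smul_apply, LinearMap.smul_apply, ann_fock, cre_fock,
    smul_smul, smul_smul]

theorem inner_fock_field (z : ℂ) (k : Fin (n - 1)) (α : Fin (n - 1) → ℕ) :
    inner ℂ (incl n (M.fock α)) (incl n (M.field z k (M.fock α))) = 0 := by
  rw [field_fock, map_add, map_smul, map_smul, inner_add_right, inner_smul_right,
    inner_smul_right, M.inner_fock, M.inner_fock]
  have h1 : α ≠ Function.update α k (α k + 1) := fun h => by
    have := congr_fun h k
    simp at this
  rw [if_neg h1]
  split_ifs with h
  · have := congr_fun h k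
    rw [Function.update_self] at this
    have h0 : α k = 0 := by omega
    simp [h0]
  · simp

/-- A field moves one occupation number by one, so different modes, and raising versus lowering,
give orthogonal vectors. On the diagonal the two squared norms add up to `|z|²(α_k + (α_k + 1))`. -/
theorem inner_field_field (z : ℂ) (k l : Fin (n - 1)) (α : Fin (n - 1) → ℕ) :
    inner ℂ (incl n (M.field z k (M.fock α))) (incl n (M.field z l (M.fock α))) =
      if k = l then ((Complex.normSq z * (2 * α k + 1) : ℝ) : ℂ) else 0 := by
  rw [field_fock, field_fock]
  simp only [map_add, map_smul, inner_add_left, inner_add_right, inner_smul_left,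
    inner_smul_right, M.inner_fock]
  have h1 : ∀ k l, Function.update α k (α k - 1) ≠ Function.update α l (α l + 1) := fun k l h => by
    have := congr_fun h l
    rw [Function.update_self, Function.update_apply] at this
    split_ifs at this with h2
    · subst h2; omega
    · omega
  rw [if_neg (h1 k l), if_neg (h1 l k).symm]
  rcases eq_or_ne k l with h | h
  · subst h
    simp only [if_true, map_mul, Complex.conj_ofReal, Complex.conj_conj, mul_one, mul_zero,
      add_zero, zero_add]
    have e1 : ((√(α k : ℝ) : ℝ) : ℂ) * (√(α k : ℝ) : ℝ) = α k := by
      rw [← Complex.ofReal_mul, Real.mul_self_sqrt (by positivity)]; simp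
    have e2 : ((√((α k : ℝ) + 1) : ℝ) : ℂ) * (√((α k : ℝ) + 1) : ℝ) = α k + 1 := by
      rw [← Complex.ofReal_mul, Real.mul_self_sqrt (by positivity)]; push_cast; rfl
    have e3 := Complex.normSq_eq_conj_mul_self (z := z)
    push_cast
    rw [e3]
    linear_combination (conj z * z) * e1 + (conj z * z) * e2
  · have h2 : Function.update α k (α k + 1) ≠ Function.update α l (α l + 1) := fun h' => by
      have := congr_fun h' k
      rw [Function.update_self, Function.update_of_ne h] at this
      omega
    rw [if_neg h2, if_neg h]
    -- Lowerings in two different modes can coincide only by truncation, at `α k = 0`, where the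
    -- coefficient `√(α k)` vanishes.
    split_ifs with h3
    · have := congr_fun h3 k
      rw [Function.update_self, Function.update_of_ne h] at this
      have h0 : α k = 0 := by omega
      simp [h0]
    · simp

theorem inner_fock_lin (z : ℂ) (x : Fin (n - 1) → ℝ) (α : Fin (n - 1) → ℕ) :
    inner ℂ (incl n (M.fock α)) (incl n (M.lin z x (M.fock α))) = 0 := by
  simp only [lin, LinearMap.sum_apply, LinearMap.smul_apply, map_sum, map_smul, inner_sum,
    inner_smul_right, inner_fock_field, mul_zero, Finset.sum_const_zero]

theorem inner_lin_lin (z : ℂ) (x : Fin (n - 1) → ℝ) (α : Fin (n - 1) → ℕ) :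
    inner ℂ (incl n (M.lin z x (M.fock α))) (incl n (M.lin z x (M.fock α))) =
      ((∑ k, x k ^ 2 * (2 * Complex.normSq z) * ((α k : ℝ) + 1 / 2) : ℝ) : ℂ) := by
  simp only [lin, LinearMap.sum_apply, LinearMap.smul_apply, map_sum, map_smul, inner_sum, sum_inner,
    inner_smul_right, inner_smul_left, inner_field_field, Complex.conj_ofReal, mul_ite, mul_zero,
    Finset.sum_ite_eq', Finset.mem_univ, if_true]
  push_cast
  refine Finset.sum_congr rfl fun k _ => ?_
  ring

theorem inner_lin_sq (z : ℂ) (x : Fin (n - 1) → ℝ) (α : Fin (n - 1) → ℕ) :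
    inner ℂ (incl n (M.fock α)) (incl n ((M.lin z x ^ 2) (M.fock α))) =
      ((∑ k, x k ^ 2 * (2 * Complex.normSq z) * ((α k : ℝ) + 1 / 2) : ℝ) : ℂ) := by
  rw [← inner_lin_lin, M.formallySymmetric_lin z x, pow_two, Module.End.mul_apply]

/-- One linear field raises the occupation by at most one and costs a factor `2(∑ α_k + 1)`.
Allowing a general `B` lets the bound be iterated, first with the inclusion and then with the
inclusion after one field. -/
theorem norm_map_lin_le (z : ℂ) (hz : ‖z‖ ≤ 1) (x : Fin (n - 1) → ℝ) (B : Core n →ₗ[ℂ] Hilb n)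
    (K : ℝ → ℝ) (hK : Monotone K)
    (hB : ∀ α, ‖B (M.fock α)‖ ≤ K (∑ k, (α k : ℝ))) (α : Fin (n - 1) → ℕ) :
    ‖B (M.lin z x (M.fock α))‖ ≤
      (∑ k, |x k|) * (2 * (∑ k, (α k : ℝ) + 1)) * K (∑ k, (α k : ℝ) + 1) := by
  have hα : ∀ k, (α k : ℝ) ≤ ∑ k, (α k : ℝ) := fun k =>
    Finset.single_le_sum (f := fun k => (α k : ℝ)) (fun _ _ => by positivity) (Finset.mem_univ k)
  have hs : ∀ (k : Fin (n - 1)) (m : ℕ), m ≤ α k + 1 →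
      ‖B (M.fock (Function.update α k m))‖ ≤ K (∑ k, (α k : ℝ) + 1) := by
    intro k m hm
    refine (hB _).trans (hK ?_)
    have h1 : ∑ j, Function.update α k m j ≤ ∑ j, α j + 1 := by
      rw [Finset.sum_update_of_mem (Finset.mem_univ k)]
      have := Finset.add_sum_erase Finset.univ α (Finset.mem_univ k)
      rw [← Finset.sdiff_singleton_eq_erase] at this
      omega
    exact_mod_cast h1
  have h0 : 0 ≤ ∑ k, (α k : ℝ) := Finset.sum_nonneg fun _ _ => by positivity
  have hK0 : 0 ≤ K (∑ k, (α k : ℝ) + 1) := (norm_nonneg _).trans ((hB α).trans (hK (by linarith)))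
  have hsq : ∀ t : ℝ, 0 ≤ t → t ≤ ∑ k, (α k : ℝ) + 1 → √t ≤ ∑ k, (α k : ℝ) + 1 := by
    intro t _ ht
    rw [Real.sqrt_le_left (by linarith)]
    nlinarith
  rw [lin, LinearMap.sum_apply, map_sum]
  refine (norm_sum_le _ _).trans ?_
  rw [Finset.sum_mul, Finset.sum_mul]
  refine Finset.sum_le_sum fun k _ => ?_
  rw [LinearMap.smul_apply, map_smul, norm_smul, Complex.norm_real, Real.norm_eq_abs, mul_assoc]
  refine mul_le_mul_of_nonneg_left ?_ (abs_nonneg _)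
  rw [field_fock, map_add, map_smul, map_smul]
  refine (norm_add_le _ _).trans ?_
  rw [norm_smul, norm_smul, norm_mul, norm_mul, RCLike.norm_conj, Complex.norm_real,
    Complex.norm_real, Real.norm_of_nonneg (Real.sqrt_nonneg _),
    Real.norm_of_nonneg (Real.sqrt_nonneg _)]
  have h1 : ‖z‖ * √(α k : ℝ) ≤ ∑ k, (α k : ℝ) + 1 :=
    (mul_le_of_le_one_left (Real.sqrt_nonneg _) hz).trans
      (hsq _ (by positivity) (by linarith [hα k]))
  have h2 : ‖z‖ * √((α k : ℝ) + 1) ≤ ∑ k, (α k : ℝ) + 1 :=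
    (mul_le_of_le_one_left (Real.sqrt_nonneg _) hz).trans
      (hsq _ (by positivity) (by linarith [hα k]))
  have h3 := mul_le_mul h1 (hs k (α k - 1) (by omega)) (norm_nonneg _) (by linarith)
  have h4 := mul_le_mul h2 (hs k (α k + 1) le_rfl) (norm_nonneg _) (by linarith)
  linarith

theorem norm_lin_fock_le (z : ℂ) (hz : ‖z‖ ≤ 1) (x : Fin (n - 1) → ℝ) (α : Fin (n - 1) → ℕ) :
    ‖incl n (M.lin z x (M.fock α))‖ ≤ (∑ k, |x k|) * (2 * (∑ k, (α k : ℝ) + 1)) := by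
  have h := M.norm_map_lin_le z hz x (incl n) (fun _ => 1) monotone_const
    (fun α => (M.norm_fock α).le) α
  simpa using h

theorem norm_lin_sq_fock_le (z : ℂ) (hz : ‖z‖ ≤ 1) (x : Fin (n - 1) → ℝ) (α : Fin (n - 1) → ℕ) :
    ‖incl n ((M.lin z x ^ 2) (M.fock α))‖ ≤
      (4 * (∑ k, |x k|) ^ 2) * (∑ k, (α k : ℝ) + 2) ^ 2 := by
  have hx : 0 ≤ ∑ k, |x k| := Finset.sum_nonneg fun _ _ => abs_nonneg _
  have h := M.norm_map_lin_le z hz x ((incl n).comp (M.lin z x))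
    (fun t => (∑ k, |x k|) * (2 * (t + 1)))
    (fun s t hst => mul_le_mul_of_nonneg_left (by linarith) hx)
    (fun α => M.norm_lin_fock_le z hz x α) α
  rw [pow_two, Module.End.mul_apply]
  have h0 : 0 ≤ ∑ k, (α k : ℝ) := Finset.sum_nonneg fun _ _ => by positivity
  refine h.trans ?_
  have : (2 * (∑ k, (α k : ℝ) + 1)) * (2 * (∑ k, (α k : ℝ) + 1 + 1)) ≤
      4 * (∑ k, (α k : ℝ) + 2) ^ 2 := by nlinarith
  have h2 := mul_le_mul_of_nonneg_left this (sq_nonneg (∑ k, |x k|))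
  calc _ = (∑ k, |x k|) ^ 2 *
        ((2 * (∑ k, (α k : ℝ) + 1)) * (2 * (∑ k, (α k : ℝ) + 1 + 1))) := by ring
    _ ≤ _ := h2
    _ = _ := by ring

/-- The Hamiltonian of independent oscillators of frequencies `ν k`. -/
noncomputable def oscillatorHam (ν : Fin (n - 1) → ℝ) (c : ℝ) : Module.End ℂ (Core n) :=
  ∑ k, ((ν k / 2 : ℝ) : ℂ) • (M.q k ^ 2 + M.p k ^ 2) + scalarOp n c

theorem q_sq_add_p_sq (k : Fin (n - 1)) :
    M.q k ^ 2 + M.p k ^ 2 = (2 : ℂ) • (M.cre k * M.ann k) + 1 := by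
  have h := M.ann_mul_cre k k
  rw [if_pos rfl] at h
  rw [q_eq, p_eq, smul_pow, smul_pow, mul_pow, pow_two (((√2 : ℝ) : ℂ)⁻¹),
    sqrt_two_inv_mul_self, neg_sq, Complex.I_sq, pow_two, pow_two]
  simp only [add_mul, mul_add, sub_mul, mul_sub, h]
  module

theorem oscillatorHam_fock (ν : Fin (n - 1) → ℝ) (c : ℝ) (α : Fin (n - 1) → ℕ) :
    M.oscillatorHam ν c (M.fock α) =
      ((∑ k, ν k * ((α k : ℝ) + 1 / 2) + c : ℝ) : ℂ) • M.fock α := by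
  simp only [oscillatorHam, q_sq_add_p_sq, LinearMap.add_apply, LinearMap.sum_apply,
    LinearMap.smul_apply, Module.End.mul_apply, Module.End.one_apply, cre_ann_fock, scalarOp]
  rw [Complex.ofReal_add, add_smul, Complex.ofReal_sum, Finset.sum_smul]
  congr 1
  refine Finset.sum_congr rfl fun k _ => ?_
  push_cast
  module

/-- The Gibbs state of independent oscillators, and its averages of observables that are linear
and quadratic in the fields. -/
theorem exists_gibbsState {ν : Fin (n - 1) → ℝ} (hν : ∀ k, 0 < ν k) (c : ℝ) :
    ∃ ρ : Hilb n →L[ℂ] Hilb n, IsGibbsState (M.oscillatorHam ν c) ρ ∧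
      (∀ (z : ℂ) (x : Fin (n - 1) → ℝ) (a : ℝ), ‖z‖ ≤ 1 →
        HasAverage ρ (scalarOp n a + M.lin z x) a) ∧
      ∀ (z w : ℂ) (x y : Fin (n - 1) → ℝ) (μ : ℝ), Complex.normSq z = 1 / 2 →
        Complex.normSq w = 1 / 2 →
        HasAverage ρ ((1 / 2 : ℂ) • ((μ : ℂ) • M.lin z x ^ 2 + M.lin w y ^ 2))
          (((1 / 2) * (μ * ∑ k, x k ^ 2 * thermalFactor (ν k) +
            ∑ k, y k ^ 2 * thermalFactor (ν k)) : ℝ) : ℂ) := by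
  classical
  let E : (Fin (n - 1) → ℕ) → ℝ := fun α => ∑ k, ν k * ((α k : ℝ) + 1 / 2) + c
  -- The zero-point energy and the constant `c` give a common factor, which cancels in the
  -- normalised weights.
  let C : ℝ := Real.exp (-(∑ k, ν k * (1 / 2) + c))
  have hE : ∀ α, Real.exp (-E α) = C * boltzmann ν α := by
    intro α
    simp only [E, C, boltzmann, ← Real.exp_nat_mul, ← Real.exp_sum, ← Real.exp_add]
    congr 1
    have h : ∑ k, ν k * ((α k : ℝ) + 1 / 2) = ∑ k, ν k * (1 / 2) + ∑ k, (α k : ℝ) * ν k := by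
      rw [← Finset.sum_add_distrib]
      exact Finset.sum_congr rfl fun k _ => by ring
    rw [h]
    simp only [mul_neg, Finset.sum_neg_distrib]
    ring
  have hC : 0 < C := Real.exp_pos _
  have hW := partition_pos hν
  have hb0 : ∀ α, 0 ≤ boltzmann ν α := fun α => Finset.prod_nonneg fun _ _ => by positivity
  have hsumE : HasSum (fun α => Real.exp (-E α)) (C * partition ν) := by
    simpa only [hE] using (hasSum_boltzmann hν).mul_left C
  let p : (Fin (n - 1) → ℕ) → ℝ := fun α => Real.exp (-E α) / ∑' α, Real.exp (-E α)
  have hp : ∀ α, p α = (partition ν)⁻¹ * boltzmann ν α := by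
    intro α
    simp only [p]
    rw [hsumE.tsum_eq, hE]
    field_simp
  have hp0 : ∀ α, 0 ≤ p α := fun α => by rw [hp]; exact mul_nonneg (inv_pos.2 hW).le (hb0 α)
  have hp1 : HasSum p 1 := by
    rw [funext hp, ← inv_mul_cancel₀ hW.ne']
    exact (hasSum_boltzmann hν).mul_left _
  have hpk : ∀ k, HasSum (fun α => p α * ((α k : ℝ) + 1 / 2)) (thermalFactor (ν k)) := by
    intro k
    have := (hasSum_boltzmann_mul hν k).mul_left (partition ν)⁻¹
    rw [inv_mul_cancel_left₀ hW.ne'] at this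
    simpa only [hp, mul_assoc] using this
  have hp2 : Summable fun α => p α * (∑ k, (α k : ℝ) + 2) ^ 2 := by
    simpa only [hp, mul_assoc] using (summable_boltzmann_mul_sq hν).mul_left (partition ν)⁻¹
  have hpq : ∀ x : Fin (n - 1) → ℝ, HasSum (fun α => p α * ∑ k, x k ^ 2 * ((α k : ℝ) + 1 / 2))
      (∑ k, x k ^ 2 * thermalFactor (ν k)) := by
    intro x
    have := hasSum_sum (s := Finset.univ) fun k _ => (hpk k).mul_left (x k ^ 2)
    refine this.congr_fun ?_
    intro α
    rw [Finset.mul_sum]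
    exact Finset.sum_congr rfl fun k _ => by ring
  have hs0 : ∀ α : Fin (n - 1) → ℕ, 0 ≤ ∑ k, (α k : ℝ) := fun α =>
    Finset.sum_nonneg fun _ _ => by positivity
  obtain ⟨ρ, hρ⟩ := exists_clm_of_summable_norm M.fockBasis
    (fun α => (p α : ℂ) • M.fockBasis α) (by
      simp_rw [norm_smul, M.fockBasis.orthonormal.1, mul_one, Complex.norm_real, Real.norm_eq_abs]
      exact hp1.summable.abs)
  have hz1 : ∀ z : ℂ, Complex.normSq z = 1 / 2 → ‖z‖ ≤ 1 := by
    intro z hz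
    rw [Complex.normSq_eq_norm_sq] at hz
    nlinarith [norm_nonneg z]
  refine ⟨ρ, ⟨_, M.fockBasis, E, fun α => ?_, hsumE.summable, hρ⟩, ?_, ?_⟩
  · rw [M.fockBasis_apply, ← map_smul, ← M.oscillatorHam_fock]
    exact mem_closureGraph _ _
  · intro z x a hz
    have h := hasAverage_of_eigenbasis M.fockBasis M.fock M.fockBasis_apply p ρ hρ
      (scalarOp n a + M.lin z x) (by
        have hx : 0 ≤ ∑ k, |x k| := Finset.sum_nonneg fun _ _ => abs_nonneg _
        refine Summable.of_nonneg_of_le (fun α => by positivity) (fun α => ?_)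
          (hp2.mul_left (|a| + 2 * ∑ k, |x k|))
        have h1 : ‖incl n ((scalarOp n a + M.lin z x) (M.fock α))‖ ≤
            |a| + (∑ k, |x k|) * (2 * (∑ k, (α k : ℝ) + 1)) := by
          rw [LinearMap.add_apply, map_add]
          refine (norm_add_le _ _).trans (add_le_add ?_ (M.norm_lin_fock_le z hz x α))
          rw [scalarOp, LinearMap.smul_apply, map_smul, norm_smul, Module.End.one_apply,
            M.norm_fock, Complex.norm_real, Real.norm_eq_abs, mul_one]
        have h2 : |a| + (∑ k, |x k|) * (2 * (∑ k, (α k : ℝ) + 1)) ≤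
            (|a| + 2 * ∑ k, |x k|) * (∑ k, (α k : ℝ) + 2) ^ 2 := by
          have h3 : (1 : ℝ) ≤ (∑ k, (α k : ℝ) + 2) ^ 2 := by nlinarith [hs0 α]
          have h4 : ∑ k, (α k : ℝ) + 1 ≤ (∑ k, (α k : ℝ) + 2) ^ 2 := by nlinarith [hs0 α]
          nlinarith [mul_le_mul_of_nonneg_left h3 (abs_nonneg a),
            mul_le_mul_of_nonneg_left h4 hx]
        rw [abs_of_nonneg (hp0 α)]
        calc _ ≤ p α * ((|a| + 2 * ∑ k, |x k|) * (∑ k, (α k : ℝ) + 2) ^ 2) :=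
              mul_le_mul_of_nonneg_left (h1.trans h2) (hp0 α)
          _ = _ := by ring)
    convert h using 1
    have : ∀ α, (p α : ℂ) * inner ℂ (incl n (M.fock α))
        (incl n ((scalarOp n a + M.lin z x) (M.fock α))) = ((p α * a : ℝ) : ℂ) := by
      intro α
      rw [LinearMap.add_apply, map_add, inner_add_right, M.inner_fock_lin, scalarOp,
        LinearMap.smul_apply, map_smul, inner_smul_right, Module.End.one_apply, M.inner_fock]
      simp
    rw [tsum_congr this, ← Complex.ofReal_tsum, tsum_mul_right, hp1.tsum_eq, one_mul]
  · intro z w x y μ hz hw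
    have h := hasAverage_of_eigenbasis M.fockBasis M.fock M.fockBasis_apply p ρ hρ
      ((1 / 2 : ℂ) • ((μ : ℂ) • M.lin z x ^ 2 + M.lin w y ^ 2)) (by
        refine Summable.of_nonneg_of_le (fun α => by positivity) (fun α => ?_)
          (hp2.mul_left (|μ| * (4 * (∑ k, |x k|) ^ 2) + 4 * (∑ k, |y k|) ^ 2))
        have h1 : ‖incl n (((1 / 2 : ℂ) • ((μ : ℂ) • M.lin z x ^ 2 + M.lin w y ^ 2)) (M.fock α))‖ ≤
            |μ| * ((4 * (∑ k, |x k|) ^ 2) * (∑ k, (α k : ℝ) + 2) ^ 2) +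
              (4 * (∑ k, |y k|) ^ 2) * (∑ k, (α k : ℝ) + 2) ^ 2 := by
          rw [LinearMap.smul_apply, LinearMap.add_apply, LinearMap.smul_apply, map_smul, map_add,
            map_smul, norm_smul]
          have hhalf : ‖(1 / 2 : ℂ)‖ ≤ 1 := by norm_num
          refine (mul_le_of_le_one_left (norm_nonneg _) hhalf).trans
            ((norm_add_le _ _).trans (add_le_add ?_ (M.norm_lin_sq_fock_le w (hz1 w hw) y α)))
          rw [norm_smul, Complex.norm_real, Real.norm_eq_abs]
          exact mul_le_mul_of_nonneg_left (M.norm_lin_sq_fock_le z (hz1 z hz) x α) (abs_nonneg _)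
        rw [abs_of_nonneg (hp0 α)]
        calc _ ≤ _ := mul_le_mul_of_nonneg_left h1 (hp0 α)
          _ = _ := by ring)
    convert h using 1
    have : ∀ α, (p α : ℂ) * inner ℂ (incl n (M.fock α))
        (incl n (((1 / 2 : ℂ) • ((μ : ℂ) • M.lin z x ^ 2 + M.lin w y ^ 2)) (M.fock α))) =
        (((1 / 2) * (μ * (p α * ∑ k, x k ^ 2 * ((α k : ℝ) + 1 / 2)) +
          p α * ∑ k, y k ^ 2 * ((α k : ℝ) + 1 / 2)) : ℝ) : ℂ) := by
      intro α
      rw [LinearMap.smul_apply, LinearMap.add_apply, LinearMap.smul_apply, map_smul, map_add,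
            map_smul, inner_smul_right, inner_add_right, inner_smul_right, M.inner_lin_sq,
            M.inner_lin_sq, hz, hw]
      norm_num
      ring
    rw [tsum_congr this, ← Complex.ofReal_tsum,
      (((hpq x).mul_left μ).add (hpq y)).mul_left (1 / 2) |>.tsum_eq]

end CanonicalPairs

/-! ## Completeness of polynomials times a Gaussian -/

section moments

variable {E : Type*} [NormedAddCommGroup E] [InnerProductSpace ℝ E] [FiniteDimensional ℝ E]
  [MeasurableSpace E] [BorelSpace E]

/-- The exponential is expanded in its power series; all partial sums are dominated by
`e^(‖t‖‖x‖)|F|`, so vanishing moments make the integral vanish. -/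
theorem integral_cexp_mul_eq_zero_of_moments {F : E → ℂ} (hm : AEStronglyMeasurable F volume)
    (hF : ∀ R : ℝ, Integrable (fun x => Real.exp (R * ‖x‖) * ‖F x‖))
    (hmom : ∀ (t : E) (m : ℕ), ∫ x, ((inner ℝ t x : ℝ) : ℂ) ^ m * F x = 0) (t : E) :
    ∫ x, Complex.exp (Complex.I * (inner ℝ t x : ℝ)) * F x = 0 := by
  have hterm : ∀ m : ℕ, Integrable fun x => ((inner ℝ t x : ℝ) : ℂ) ^ m * F x := by
    intro m
    refine ((hF ‖t‖).const_mul (m.factorial : ℝ)).mono' ?_ (Eventually.of_forall fun x => ?_)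
    · exact ((Complex.continuous_ofReal.comp (continuous_const.inner continuous_id)).pow m
        ).aestronglyMeasurable.mul hm
    · rw [norm_mul, norm_pow, Complex.norm_real, Real.norm_eq_abs, ← mul_assoc]
      refine mul_le_mul_of_nonneg_right ?_ (norm_nonneg _)
      have h1 := Real.pow_div_factorial_le_exp (‖t‖ * ‖x‖) (by positivity) m
      rw [div_le_iff₀ (by positivity), mul_comm (Real.exp _)] at h1
      exact (pow_le_pow_left₀ (abs_nonneg _) (abs_real_inner_le_norm t x) m).trans h1
  let S : ℕ → E → ℂ := fun N x =>
    ∑ m ∈ Finset.range N, (Complex.I * (inner ℝ t x : ℝ)) ^ m / (m.factorial : ℂ) * F x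
  have hSeq : ∀ N x, S N x = ∑ m ∈ Finset.range N,
      (Complex.I ^ m / (m.factorial : ℂ)) * (((inner ℝ t x : ℝ) : ℂ) ^ m * F x) := by
    intro N x
    refine Finset.sum_congr rfl fun m _ => ?_
    rw [mul_pow]
    ring
  have hS0 : ∀ N, ∫ x, S N x = 0 := by
    intro N
    simp_rw [hSeq]
    rw [integral_finsetSum _ fun m _ => (hterm m).const_mul _]
    refine Finset.sum_eq_zero fun m _ => ?_
    rw [integral_const_mul, hmom, mul_zero]
  have hlim := tendsto_integral_of_dominated_convergence (F := S)
    (f := fun x => Complex.exp (Complex.I * (inner ℝ t x : ℝ)) * F x)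
    (fun x => Real.exp (‖t‖ * ‖x‖) * ‖F x‖) (fun N => ?_) (hF ‖t‖)
    (fun N => Eventually.of_forall fun x => ?_) (Eventually.of_forall fun x => ?_)
  · simp_rw [hS0] at hlim
    exact (tendsto_nhds_unique hlim tendsto_const_nhds)
  · rw [funext (hSeq N)]
    exact (integrable_finsetSum _ fun m _ => (hterm m).const_mul _).aestronglyMeasurable
  · simp only [S]
    rw [← Finset.sum_mul, norm_mul]
    refine mul_le_mul_of_nonneg_right ?_ (norm_nonneg _)
    refine (norm_sum_le _ _).trans ?_
    have h2 : ∀ m : ℕ, ‖(Complex.I * ((inner ℝ t x : ℝ) : ℂ)) ^ m / (m.factorial : ℂ)‖ =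
        |inner ℝ t x| ^ m / (m.factorial : ℝ) := by
      intro m
      simp
    simp_rw [h2]
    exact (Real.sum_le_exp_of_nonneg (abs_nonneg _) N).trans
      (Real.exp_le_exp.2 (abs_real_inner_le_norm t x))
  · have h3 := (NormedSpace.expSeries_div_hasSum_exp
      (Complex.I * ((inner ℝ t x : ℝ) : ℂ))).tendsto_sum_nat
    rw [← Complex.exp_eq_exp_ℂ] at h3
    have h4 := h3.mul_const (F x)
    simpa only [S, Finset.sum_mul] using h4

/-- Vanishing moments annihilate the Fourier transform of `F`. Moving the Fourier transform from `F`
to a test function shows that `F` integrates to zero against every Schwartz function. -/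
theorem ae_eq_zero_of_moments {F : E → ℂ} (hm : AEStronglyMeasurable F volume)
    (hF : ∀ R : ℝ, Integrable (fun x => Real.exp (R * ‖x‖) * ‖F x‖))
    (hmom : ∀ (t : E) (m : ℕ), ∫ x, ((inner ℝ t x : ℝ) : ℂ) ^ m * F x = 0) :
    F =ᵐ[volume] 0 := by
  have hint : Integrable F := by
    have := hF 0
    simp only [zero_mul, Real.exp_zero, one_mul] at this
    exact (integrable_norm_iff hm).1 this
  have hfour : FourierTransform.fourier F = 0 := by
    ext w
    rw [Real.fourier_eq']
    have := integral_cexp_mul_eq_zero_of_moments hm hF hmom ((-2 * Real.pi) • w)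
    rw [Pi.zero_apply, ← this]
    congr 1
    ext x
    rw [smul_eq_mul, inner_smul_left, real_inner_comm, mul_comm Complex.I]
    simp
  have hschw : ∀ φ : 𝓢(E, ℂ), ∫ x, φ x * F x = 0 := by
    intro φ
    let ψ : 𝓢(E, ℂ) := FourierTransformInv.fourierInv φ
    have h1 : φ = FourierTransform.fourier ψ := by simp [ψ]
    have h2 := VectorFourier.integral_fourierIntegral_smul_eq_flip (L := innerₗ E)
      (μ := volume) (ν := volume) Real.continuous_fourierChar continuous_inner ψ.integrable hint
    rw [flip_innerₗ] at h2
    have h3 : VectorFourier.fourierIntegral Real.fourierChar volume (innerₗ E) F =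
      FourierTransform.fourier F := rfl
    have h4 : VectorFourier.fourierIntegral Real.fourierChar volume (innerₗ E) ψ =
      (φ : E → ℂ) := by rw [h1]; rfl
    rw [h3, h4, hfour] at h2
    simpa using h2
  refine ae_eq_zero_of_integral_contDiff_smul_eq_zero hint.locallyIntegrable
    fun g hg hgc => ?_
  have hg₁ : HasCompactSupport (Complex.ofRealCLM ∘ g) := hgc.comp_left rfl
  have hg₂ : ContDiff ℝ ∞ (Complex.ofRealCLM ∘ g) := by fun_prop
  have := hschw (hg₁.toSchwartzMap hg₂)
  simpa using this

end moments

section gaussian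

variable {E : Type*} [NormedAddCommGroup E] [InnerProductSpace ℝ E] [FiniteDimensional ℝ E]
  [MeasurableSpace E] [BorelSpace E]

theorem memLp_exp_mul_norm_gaussianWave (T : E ≃L[ℝ] E) (s d : E) (R : ℝ) :
    MemLp (fun x => Real.exp (R * ‖x‖) * ‖gaussianWave T s d x‖) 2 volume := by
  obtain ⟨κ, hκ, hT⟩ : ∃ κ : ℝ, 0 < κ ∧ ∀ x, κ * ‖x‖ ≤ ‖T x‖ := by
    refine ⟨(‖(T.symm : E →L[ℝ] E)‖ + 1)⁻¹, by positivity, fun x => ?_⟩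
    rw [inv_mul_le_iff₀ (by positivity)]
    have h := (T.symm : E →L[ℝ] E).le_opNorm (T x)
    rw [ContinuousLinearEquiv.coe_coe, T.symm_apply_apply] at h
    nlinarith [norm_nonneg (T x)]
  let D : E ≃L[ℝ] E := ContinuousLinearEquiv.smulLeft (Units.mk0 (κ / 2) (by positivity))
  have hD : ∀ x, ‖D x‖ = κ / 2 * ‖x‖ := by
    intro x
    change ‖(κ / 2) • x‖ = _
    rw [norm_smul, Real.norm_of_nonneg (by positivity)]
  -- Comparison with the isotropic Gaussian `exp(-κ²‖x‖²/8)`. From `‖T(x - s)‖ ≥ κ‖x - s‖` the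
  -- exponent is at most `-κ²‖x‖²/4 + κ²‖s‖²/2`; half of the quadratic decay absorbs `R‖x‖` at the
  -- price `2R²/κ²`.
  have h := ((gaussianWave D 0 0 : 𝓢(E, ℂ)).memLp 2 volume).const_mul
    ((Real.exp (2 * R ^ 2 / κ ^ 2 + κ ^ 2 * ‖s‖ ^ 2 / 2) : ℝ) : ℂ)
  refine h.of_le ?_ (Eventually.of_forall fun x => ?_)
  · exact Continuous.aestronglyMeasurable (by
      have := (gaussianWave T s d).continuous
      fun_prop)
  · rw [norm_mul, norm_mul, norm_norm, Complex.norm_real, norm_gaussianWave, norm_gaussianWave,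
      sub_zero, hD, Real.norm_of_nonneg (Real.exp_pos _).le,
      Real.norm_of_nonneg (Real.exp_pos _).le, ← Real.exp_add, ← Real.exp_add, Real.exp_le_exp]
    have h1 := hT (x - s)
    have h2 : ‖x‖ ≤ ‖x - s‖ + ‖s‖ := by
      simpa using norm_add_le (x - s) s
    have h3 : ‖x‖ ^ 2 ≤ 2 * ‖x - s‖ ^ 2 + 2 * ‖s‖ ^ 2 := by
      nlinarith [norm_nonneg x, norm_nonneg (x - s), norm_nonneg s, sq_nonneg (‖x - s‖ - ‖s‖)]
    have h4 : κ ^ 2 * ‖x - s‖ ^ 2 ≤ ‖T (x - s)‖ ^ 2 := by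
      rw [← mul_pow]
      exact pow_le_pow_left₀ (by positivity) h1 2
    have h5 : R * ‖x‖ ≤ κ ^ 2 / 8 * ‖x‖ ^ 2 + 2 * R ^ 2 / κ ^ 2 := by
      have h6 : κ ^ 2 / 8 * ‖x‖ ^ 2 + 2 * R ^ 2 / κ ^ 2 - R * ‖x‖ =
          2 * (κ / 4 * ‖x‖ - R / κ) ^ 2 := by
        field_simp
        ring
      nlinarith [sq_nonneg (κ / 4 * ‖x‖ - R / κ)]
    nlinarith [mul_le_mul_of_nonneg_left h3 (sq_nonneg κ)]

/-- A square integrable function that is orthogonal to all polynomials times a Gaussian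
vanishes. -/
theorem ae_eq_zero_of_gaussian_moments (T : E ≃L[ℝ] E) (s d : E) {u : E → ℂ}
    (hu : MemLp u 2 volume)
    (h : ∀ (t : E) (m : ℕ), ∫ x, ((inner ℝ t x : ℝ) : ℂ) ^ m *
      (starRingEnd ℂ (gaussianWave T s d x) * u x) = 0) : u =ᵐ[volume] 0 := by
  have hc : Continuous fun x => starRingEnd ℂ (gaussianWave T s d x) :=
    Complex.continuous_conj.comp (gaussianWave T s d).continuous
  have h0 := ae_eq_zero_of_moments (F := fun x => starRingEnd ℂ (gaussianWave T s d x) * u x)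
    (hc.aestronglyMeasurable.mul hu.1) (fun R => ?_) h
  · filter_upwards [h0] with x hx
    rcases mul_eq_zero.1 hx with h1 | h1
    · have h2 : ‖gaussianWave T s d x‖ = 0 := by
        rw [← RCLike.norm_conj, h1, norm_zero]
      rw [norm_gaussianWave] at h2
      exact absurd h2 (Real.exp_pos _).ne'
    · exact h1
  -- The exponential weight is put on the Gaussian, which stays in `L²`; the product with `u ∈ L²`
  -- is integrable.
  · have h1 := (memLp_exp_mul_norm_gaussianWave T s d R).integrable_mul hu.norm
    refine h1.congr (Eventually.of_forall fun x => ?_)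
    simp only [Pi.mul_apply, norm_mul, RCLike.norm_conj]
    ring

end gaussian

/-! ## Canonical pairs from dual frames -/

section dual

variable {n : ℕ} {U V : Fin (n - 1) → Fin (n - 1) → ℝ}
  (hUV : ∀ k l, ∑ j, U k j * V l j = if k = l then 1 else 0)

/-- A one-sided inverse of a square matrix is two-sided: `U Vᵀ = 1` gives `Vᵀ U = 1`. -/
theorem dual_frames (hUV : ∀ k l, ∑ j, U k j * V l j = if k = l then 1 else 0)
    (i j : Fin (n - 1)) : ∑ k, V k i * U k j = if i = j then 1 else 0 := by
  have h1 : Matrix.of U * (Matrix.of V).transpose = 1 := by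
    ext k l
    rw [Matrix.mul_apply, Matrix.one_apply]
    exact hUV k l
  have h2 := congrArg (fun A : Matrix _ _ ℝ => A i j) (mul_eq_one_comm.1 h1)
  simp only [Matrix.mul_apply, Matrix.one_apply] at h2
  exact h2

/-- The linear change of variables given by a frame with a dual frame. -/
noncomputable def frameEquiv (hUV : ∀ k l, ∑ j, U k j * V l j = if k = l then 1 else 0) :
    Config n ≃L[ℝ] Config n :=
  LinearEquiv.toContinuousLinearEquiv
    { toFun := fun η => WithLp.toLp 2 fun k => ∑ j, U k j * η j
      invFun := fun ζ => WithLp.toLp 2 fun j => ∑ k, V k j * ζ k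
      map_add' := fun η ζ => by
        ext k
        simp [mul_add, Finset.sum_add_distrib]
      map_smul' := fun c η => by
        ext k
        simp [Finset.mul_sum, mul_left_comm]
      left_inv := fun η => by
        ext j
        simp only [Finset.mul_sum]
        rw [Finset.sum_comm]
        simp only [← mul_assoc, ← Finset.sum_mul, dual_frames hUV]
        simp
      right_inv := fun ζ => by
        ext k
        simp only [Finset.mul_sum]
        rw [Finset.sum_comm]
        simp only [← mul_assoc, ← Finset.sum_mul, hUV]
        simp }

theorem frameEquiv_apply (η : Config n) (k : Fin (n - 1)) :
    frameEquiv hUV η k = ∑ j, U k j * η j := rfl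

theorem inner_eq_sum (x y : Config n) : inner ℝ x y = ∑ j, x j * y j := by
  rw [PiLp.inner_apply]
  simp [mul_comm]

theorem posOp_apply (s u : Fin (n - 1) → ℝ) (f : Core n) (ξ : Config n) :
    posOp n s u f ξ = ((∑ j, u j * (ξ j - s j) : ℝ) : ℂ) * f ξ := by
  rw [posOp, LinearMap.sum_apply, sum_apply]
  simp only [LinearMap.smul_apply, LinearMap.sub_apply, smul_apply, sub_apply, mulOp_apply,
    scalarOp, Module.End.one_apply, smul_eq_mul]
  push_cast
  rw [Finset.sum_mul]
  exact Finset.sum_congr rfl fun j _ => by ring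

theorem posOp_gaussianWave (s d : Fin (n - 1) → ℝ) (k : Fin (n - 1)) (ξ : Config n) :
    posOp n s (U k) (gaussianWave (frameEquiv hUV) (WithLp.toLp 2 s) (WithLp.toLp 2 d)) ξ =
      ((frameEquiv hUV (ξ - WithLp.toLp 2 s) k : ℝ) : ℂ) *
        gaussianWave (frameEquiv hUV) (WithLp.toLp 2 s) (WithLp.toLp 2 d) ξ := by
  rw [posOp_apply]
  rfl

/-- With `ζ = U(ξ - s)`, differentiating the Gaussian brings down `-Uᵀζ`, and pairing with the dual
vector `V k` leaves `ζ_k`. The derivative of the phase cancels `d`. Since `q_k` multiplies the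
Gaussian by `ζ_k`, the combination `q_k + i p_k` annihilates it. -/
theorem momOp_gaussianWave (s d : Fin (n - 1) → ℝ) (k : Fin (n - 1)) (ξ : Config n) :
    momOp n d (V k) (gaussianWave (frameEquiv hUV) (WithLp.toLp 2 s) (WithLp.toLp 2 d)) ξ =
      Complex.I * ((frameEquiv hUV (ξ - WithLp.toLp 2 s) k : ℝ) : ℂ) *
        gaussianWave (frameEquiv hUV) (WithLp.toLp 2 s) (WithLp.toLp 2 d) ξ := by
  set g := gaussianWave (frameEquiv hUV) (WithLp.toLp 2 s) (WithLp.toLp 2 d)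
  set ζ := frameEquiv hUV (ξ - WithLp.toLp 2 s)
  rw [momOp, LinearMap.sum_apply, sum_apply]
  have h1 : ∀ j, ((V k j : ℂ) • ((-Complex.I) • derivOp n j - scalarOp n (d j))) g ξ =
      Complex.I * ((V k j * ∑ l, ζ l * U l j : ℝ) : ℂ) * g ξ := by
    intro j
    simp only [LinearMap.smul_apply, LinearMap.sub_apply, smul_apply, sub_apply, derivOp_apply,
      scalarOp, Module.End.one_apply, smul_eq_mul]
    rw [lineDerivOp_gaussianWave, inner_eq_sum, inner_eq_sum]
    have e1 : ∑ i, (WithLp.toLp 2 d : Config n) i * (EuclideanSpace.single j (1 : ℝ)) i = d j := by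
      simp [PiLp.single_apply]
    have e2 : ∀ l, frameEquiv hUV (EuclideanSpace.single j (1 : ℝ)) l = U l j := by
      intro l
      rw [frameEquiv_apply]
      simp [PiLp.single_apply]
    rw [e1]
    simp only [e2]
    push_cast
    linear_combination (-(V k j * d j : ℂ)) * g ξ * Complex.I_mul_I
  simp_rw [h1]
  rw [← Finset.sum_mul, ← Finset.mul_sum, ← Complex.ofReal_sum]
  congr 3
  simp only [Finset.mul_sum]
  rw [Finset.sum_comm]
  have h2 : ∀ l, ∑ j, V k j * (ζ l * U l j) = if l = k then ζ l else 0 := by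
    intro l
    have := hUV l k
    calc _ = ζ l * ∑ j, U l j * V k j := by
          rw [Finset.mul_sum]; exact Finset.sum_congr rfl fun j _ => by ring
      _ = _ := by rw [this]; simp
  simp [h2]

/-- The dual frame recovers the coordinates from the `q_k`, so stability under the `q_k` is
stability under multiplication by all coordinates. -/
theorem mulOp_mem (hUV : ∀ k l, ∑ j, U k j * V l j = if k = l then 1 else 0)
    (s : Fin (n - 1) → ℝ) (W : Submodule ℂ (Core n))
    (hW : ∀ k, ∀ f ∈ W, posOp n s (U k) f ∈ W) (j : Fin (n - 1)) (f : Core n) (hf : f ∈ W) :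
    mulOp n j f ∈ W := by
  have : mulOp n j f = ∑ k, (V k j : ℂ) • posOp n s (U k) f + (s j : ℂ) • f := by
    ext ξ
    rw [add_apply, sum_apply, smul_apply, mulOp_apply]
    simp only [smul_apply, posOp_apply, smul_eq_mul]
    have h1 : ∑ k, V k j * ∑ i, U k i * (ξ i - s i) = ξ j - s j := by
      simp only [Finset.mul_sum]
      rw [Finset.sum_comm]
      simp only [← mul_assoc, ← Finset.sum_mul, dual_frames hUV]
      simp
    have h2 : ∑ k, (V k j : ℂ) * (((∑ i, U k i * (ξ i - s i) : ℝ) : ℂ) * f ξ) =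
        ((ξ j - s j : ℝ) : ℂ) * f ξ := by
      rw [← h1, Complex.ofReal_sum, Finset.sum_mul]
      refine Finset.sum_congr rfl fun k _ => ?_
      push_cast
      ring
    rw [h2]
    push_cast
    ring
  rw [this]
  exact W.add_mem (W.sum_mem fun k _ => W.smul_mem _ (hW k f hf)) (W.smul_mem _ hf)

theorem incl_gaussianWave_ne_zero (T : Config n ≃L[ℝ] Config n) (s d : Config n) :
    incl n (gaussianWave T s d) ≠ 0 := by
  intro h
  have h1 : gaussianWave T s d = 0 := SchwartzMap.injective_toLp 2 volume (by
    have h2 : incl n (gaussianWave T s d) = incl n 0 := by rw [h, map_zero]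
    exact h2)
  have h2 : ‖gaussianWave T s d 0‖ = 0 := by rw [h1]; simp
  rw [norm_gaussianWave] at h2
  exact absurd h2 (Real.exp_pos _).ne'

/-- The canonical pairs associated with a frame, its dual frame, and displacements. -/
noncomputable def framePairs (s d : Fin (n - 1) → ℝ) : CanonicalPairs n :=
  let g : Core n := gaussianWave (frameEquiv hUV) (WithLp.toLp 2 s) (WithLp.toLp 2 d)
  { q := fun k => posOp n s (U k)
    p := fun k => momOp n d (V k)
    commute_q := fun k l => commute_posOp s _ _
    commute_p := fun k l => commute_momOp d _ _
    ccr := fun k l => by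
      rw [commutator_posOp_momOp, hUV]
      split_ifs <;> simp
    symm_q := fun k => formallySymmetric_posOp _ _
    symm_p := fun k => formallySymmetric_momOp _ _
    vac := ((‖incl n g‖⁻¹ : ℝ) : ℂ) • g
    norm_vac := by
      rw [map_smul, norm_smul, Complex.norm_real, norm_inv, norm_norm,
        inv_mul_cancel₀ (norm_ne_zero_iff.2 (incl_gaussianWave_ne_zero _ _ _))]
    annihilate := fun k => by
      ext ξ
      rw [map_smul, map_smul, add_apply, smul_apply, smul_apply, smul_apply,
        posOp_gaussianWave, momOp_gaussianWave, zero_apply]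
      simp only [smul_eq_mul]
      linear_combination ((‖incl n g‖⁻¹ : ℝ) : ℂ) *
        ((frameEquiv hUV (ξ - WithLp.toLp 2 s) k : ℝ) : ℂ) * g ξ * Complex.I_mul_I
    complete := by
      intro W hvac hq u hu
      have hg : g ∈ W := by
        have h1 := W.smul_mem ((‖incl n g‖ : ℝ) : ℂ) hvac
        rwa [smul_smul, ← Complex.ofReal_mul, mul_inv_cancel₀
          (norm_ne_zero_iff.2 (incl_gaussianWave_ne_zero _ _ _)), Complex.ofReal_one,
          one_smul] at h1
      have hmul := mulOp_mem hUV s W hq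
      -- Powers of linear forms times the Gaussian lie in `W`; by the moment criterion they already
      -- determine a vector of `L²`.
      have hpow : ∀ (t : Config n) (m : ℕ), ∃ f ∈ W, ∀ ξ,
          f ξ = ((inner ℝ t ξ : ℝ) : ℂ) ^ m * g ξ := by
        intro t m
        induction m with
        | zero => exact ⟨g, hg, fun ξ => by simp⟩
        | succ m ih =>
          obtain ⟨f, hf, hfe⟩ := ih
          refine ⟨∑ j, (t j : ℂ) • mulOp n j f,
            W.sum_mem fun j _ => W.smul_mem _ (hmul j f hf), fun ξ => ?_⟩
          rw [sum_apply, inner_eq_sum, pow_succ, mul_right_comm, ← inner_eq_sum, ← hfe,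
            inner_eq_sum]
          simp only [smul_apply, mulOp_apply, smul_eq_mul]
          push_cast
          rw [Finset.mul_sum]
          exact Finset.sum_congr rfl fun j _ => by ring
      have h0 := ae_eq_zero_of_gaussian_moments (frameEquiv hUV) (WithLp.toLp 2 s)
        (WithLp.toLp 2 d) (Lp.memLp u) (fun t m => by
          obtain ⟨f, hf, hfe⟩ := hpow t m
          rw [← hu f hf, L2.inner_def]
          refine integral_congr_ae ?_
          filter_upwards [f.coeFn_toLp 2 volume] with ξ hξ
          rw [incl_apply, hξ, hfe, RCLike.inner_apply]
          simp only [map_mul, map_pow, Complex.conj_ofReal]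
          ring)
      exact (Lp.eq_zero_iff_ae_eq_zero).2 h0 }

end dual

/-! ## Normal modes of the chain -/

/-- Extension by zero of a family indexed by the bonds `1, …, n - 1`. -/
def extendBond {n : ℕ} {A : Type*} [Zero A] (u : Fin (n - 1) → A) (x : ℕ) : A :=
  if h : 1 ≤ x ∧ x < n then u ⟨x - 1, by omega⟩ else 0

/-- The weighted discrete gradient, from bonds to sites. -/
def chainGrad (a b u : ℤ → ℝ) (x : ℤ) : ℝ := a x * (b (x - 1) * u (x - 1) - b x * u x)

/-- The adjoint of the weighted discrete gradient, from sites to bonds. -/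
def chainDiv (a b u : ℤ → ℝ) (x : ℤ) : ℝ := b x * (a (x + 1) * u (x + 1) - a x * u x)

/-- Extension by zero to `ℤ`. -/
def extendInt {n : ℕ} (u : Fin (n - 1) → ℝ) (x : ℤ) : ℝ := extendBond u x.toNat

section modes

variable {n : ℕ}

theorem extendBond_succ {A : Type*} [Zero A] (u : Fin (n - 1) → A) (j : Fin (n - 1)) :
    extendBond u (j + 1) = u j := by
  rw [extendBond, dif_pos ⟨by omega, by omega⟩]
  rfl

theorem extendBond_of_not {A : Type*} [Zero A] (u : Fin (n - 1) → A) {x : ℕ}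
    (h : ¬(1 ≤ x ∧ x < n)) : extendBond u x = 0 := dif_neg h

theorem extendInt_succ (u : Fin (n - 1) → ℝ) (j : Fin (n - 1)) :
    extendInt u ((j : ℤ) + 1) = u j := by
  have : ((j : ℤ) + 1).toNat = (j : ℕ) + 1 := by omega
  rw [extendInt, this, extendBond_succ]

theorem extendInt_of_not (u : Fin (n - 1) → ℝ) {x : ℤ} (h : ¬(1 ≤ x ∧ x < n)) :
    extendInt u x = 0 := extendBond_of_not u (by omega)

theorem extendInt_natCast (u : Fin (n - 1) → ℝ) (x : ℕ) : extendInt u x = extendBond u x := by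
  rw [extendInt, Int.toNat_natCast]

theorem extendInt_natCast_sub_one (u : Fin (n - 1) → ℝ) (x : ℕ) :
    extendInt u ((x : ℤ) - 1) = extendBond u (x - 1) := by
  rw [extendInt]
  congr 1
  omega

theorem exists_index {x : ℕ} (h : 1 ≤ x ∧ x < n) : ∃ j : Fin (n - 1), (j : ℕ) + 1 = x :=
  ⟨⟨x - 1, by omega⟩, by simp; omega⟩

theorem extendInt_single (i : Fin (n - 1)) (x : ℤ) :
    extendInt (Pi.single i (1 : ℝ)) x = if x = (i : ℤ) + 1 then 1 else 0 := by
  by_cases h : 1 ≤ x ∧ x < n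
  · obtain ⟨j, hj⟩ := exists_index (n := n) (x := x.toNat) (by omega)
    have hx : x = (j : ℤ) + 1 := by omega
    rw [hx, extendInt_succ, Pi.single_apply]
    congr 1
    simp [Fin.ext_iff]
  · rw [extendInt_of_not _ h, if_neg (by omega)]

theorem extendInt_eq_sum (u : Fin (n - 1) → ℝ) (x : ℤ) :
    extendInt u x = ∑ j, u j * extendInt (Pi.single j (1 : ℝ)) x := by
  by_cases h : 1 ≤ x ∧ x < n
  · obtain ⟨j, hj⟩ := exists_index (n := n) (x := x.toNat) (by omega)
    have hx : x = (j : ℤ) + 1 := by omega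
    rw [hx, extendInt_succ]
    simp only [extendInt_succ, Pi.single_apply]
    simp
  · simp [extendInt_of_not _ h]

theorem chainGrad_sum {ι : Type*} (s : Finset ι) (a b : ℤ → ℝ) (c : ι → ℝ) (u : ι → ℤ → ℝ) (x : ℤ) :
    chainGrad a b (fun x => ∑ i ∈ s, c i * u i x) x = ∑ i ∈ s, c i * chainGrad a b (u i) x := by
  simp only [chainGrad, Finset.mul_sum, ← Finset.sum_sub_distrib]
  exact Finset.sum_congr rfl fun i _ => by ring

theorem chainGrad_extendInt (a b : ℤ → ℝ) (u : Fin (n - 1) → ℝ) (x : ℤ) :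
    chainGrad a b (extendInt u) x =
      ∑ j, u j * chainGrad a b (extendInt (Pi.single j (1 : ℝ))) x := by
  rw [← chainGrad_sum]
  congr 1
  exact funext (extendInt_eq_sum u)

/-- Summation by parts: the unit vector on bond `i + 1` has a gradient only at its two ends, the
sites `i + 1` and `i + 2`, both of which lie in `1, …, n`. -/
theorem sum_chainGrad_single_mul (a b f : ℤ → ℝ) (i : Fin (n - 1)) :
    ∑ x ∈ Finset.Icc 1 n, chainGrad a b (extendInt (Pi.single i (1 : ℝ))) (x : ℤ) * f x =
      chainDiv a b f ((i : ℤ) + 1) := by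
  have hi := i.2
  have h1 : ∀ x : ℕ, chainGrad a b (extendInt (Pi.single i (1 : ℝ))) (x : ℤ) * f x =
      (if x = (i : ℕ) + 2 then a (x : ℤ) * b ((x : ℤ) - 1) * f x else 0) -
        if x = (i : ℕ) + 1 then a (x : ℤ) * b x * f x else 0 := by
    intro x
    rw [chainGrad, extendInt_single, extendInt_single]
    have e1 : ((x : ℤ) - 1 = (i : ℤ) + 1) ↔ x = (i : ℕ) + 2 := by omega
    have e2 : ((x : ℤ) = (i : ℤ) + 1) ↔ x = (i : ℕ) + 1 := by omega
    simp only [e1, e2]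
    split_ifs <;> ring
  simp only [h1, Finset.sum_sub_distrib, Finset.sum_ite_eq', Finset.mem_Icc]
  rw [if_pos (by omega), if_pos (by omega), chainDiv]
  push_cast
  have e3 : ((i : ℤ) + 2 - 1) = (i : ℤ) + 1 := by ring
  have e4 : ((i : ℤ) + 1 + 1) = (i : ℤ) + 2 := by ring
  rw [e3, e4]
  ring

/-- A vanishing gradient makes `b u` constant along the chain, and it is `0` at the left end. Hence
all eigenvalues of the chain are strictly positive. -/
theorem eq_zero_of_chainGrad_eq_zero {a b : ℤ → ℝ} (ha : ∀ x : ℕ, 1 ≤ x → x ≤ n → 0 < a x)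
    (hb : ∀ x : ℕ, 1 ≤ x → x < n → 0 < b x) (u : Fin (n - 1) → ℝ)
    (hu : ∀ x : ℕ, 1 ≤ x → x ≤ n → chainGrad a b (extendInt u) x = 0) : u = 0 := by
  have h1 : ∀ x : ℕ, x < n → b x * extendInt u x = 0 := by
    intro x
    induction x with
    | zero =>
      intro _
      rw [extendInt_of_not u (by simp), mul_zero]
    | succ x ih =>
      intro hx
      have h2 := hu (x + 1) (by omega) hx.le
      rw [chainGrad] at h2
      have h3 := (mul_eq_zero.1 h2).resolve_left (ha (x + 1) (by omega) hx.le).ne'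
      have e : (((x + 1 : ℕ) : ℤ) - 1) = (x : ℤ) := by push_cast; ring
      rw [e, ih (by omega)] at h3
      linarith
  ext j
  have hj := j.2
  have h2 := h1 (j + 1) (by omega)
  have h3 := (mul_eq_zero.1 h2).resolve_left (hb (j + 1) (by omega) (by omega)).ne'
  push_cast at h3
  rwa [extendInt_succ] at h3

/-- The normal modes of the chain. -/
theorem exists_modes (a b : ℤ → ℝ) (ha : ∀ x : ℕ, 1 ≤ x → x ≤ n → 0 < a x)
    (hb : ∀ x : ℕ, 1 ≤ x → x < n → 0 < b x) (hb0 : ∀ x : ℤ, ¬(1 ≤ x ∧ x < n) → b x = 0) :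
    ∃ (lam : Fin (n - 1) → ℝ) (w : Fin (n - 1) → Fin (n - 1) → ℝ),
      (∀ k, 0 < lam k) ∧
      (∀ k l, ∑ j, w k j * w l j = if k = l then 1 else 0) ∧
      (∀ k l, ∑ x ∈ Finset.Icc 1 n,
        chainGrad a b (extendInt (w k)) (x : ℤ) * chainGrad a b (extendInt (w l)) (x : ℤ) =
          if k = l then lam k else 0) ∧
      ∀ k x, chainDiv a b (chainGrad a b (extendInt (w k))) x = lam k * extendInt (w k) x := by
  -- The Gram matrix of the gradients of the unit bond vectors. By summation by parts it represents
  -- divergence after gradient, and it is visibly symmetric.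
  let S : Matrix (Fin (n - 1)) (Fin (n - 1)) ℝ := Matrix.of fun i j =>
    ∑ x ∈ Finset.Icc 1 n, chainGrad a b (extendInt (Pi.single i (1 : ℝ))) (x : ℤ) *
      chainGrad a b (extendInt (Pi.single j (1 : ℝ))) (x : ℤ)
  have hS : S.IsHermitian := by
    ext i j
    simp only [S, Matrix.conjTranspose_apply, Matrix.of_apply, star_trivial]
    exact Finset.sum_congr rfl fun x _ => mul_comm _ _
  let w : Fin (n - 1) → Fin (n - 1) → ℝ := fun k => (hS.eigenvectorBasis k).ofLp
  have hSu : ∀ (u : Fin (n - 1) → ℝ) i,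
      S.mulVec u i = chainDiv a b (chainGrad a b (extendInt u)) ((i : ℤ) + 1) := by
    intro u i
    rw [← sum_chainGrad_single_mul, Matrix.mulVec, dotProduct]
    simp only [S, Matrix.of_apply, Finset.sum_mul]
    rw [Finset.sum_comm]
    refine Finset.sum_congr rfl fun x _ => ?_
    rw [chainGrad_extendInt a b u, Finset.mul_sum]
    exact Finset.sum_congr rfl fun j _ => by ring
  have hw : ∀ k l, ∑ j, w k j * w l j = if k = l then 1 else 0 := by
    intro k l
    have := (orthonormal_iff_ite.1 hS.eigenvectorBasis.orthonormal) k l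
    rw [← this, PiLp.inner_apply]
    simp [w, mul_comm]
  have heig : ∀ k (i : Fin (n - 1)), chainDiv a b (chainGrad a b (extendInt (w k))) ((i : ℤ) + 1) =
      hS.eigenvalues k * w k i := by
    intro k i
    rw [← hSu, hS.mulVec_eigenvectorBasis]
    rfl
  have hgram : ∀ k l, ∑ x ∈ Finset.Icc 1 n,
        chainGrad a b (extendInt (w k)) (x : ℤ) * chainGrad a b (extendInt (w l)) (x : ℤ) =
          if k = l then hS.eigenvalues k else 0 := by
    intro k l
    have h1 : ∀ x : ℕ, chainGrad a b (extendInt (w k)) (x : ℤ) *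
        chainGrad a b (extendInt (w l)) (x : ℤ) = ∑ j, w k j *
          (chainGrad a b (extendInt (Pi.single j (1 : ℝ))) (x : ℤ) *
            chainGrad a b (extendInt (w l)) (x : ℤ)) := by
      intro x
      rw [chainGrad_extendInt a b (w k), Finset.sum_mul]
      exact Finset.sum_congr rfl fun j _ => by ring
    simp only [h1]
    rw [Finset.sum_comm]
    simp only [← Finset.mul_sum, sum_chainGrad_single_mul a b (chainGrad a b (extendInt (w l))),
      heig]
    have h2 : ∑ j, w k j * (hS.eigenvalues l * w l j) =
        hS.eigenvalues l * ∑ j, w k j * w l j := by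
      rw [Finset.mul_sum]
      exact Finset.sum_congr rfl fun j _ => by ring
    rw [h2, hw]
    split_ifs with h
    · rw [h, mul_one]
    · rw [mul_zero]
  refine ⟨hS.eigenvalues, w, fun k => ?_, hw, hgram, fun k x => ?_⟩
  -- The eigenvalue is the squared norm of the gradient of a unit vector; were it zero, the vector
  -- itself would vanish.
  · have h1 := hgram k k
    rw [if_pos rfl] at h1
    rw [← h1]
    refine lt_of_le_of_ne (Finset.sum_nonneg fun x _ => mul_self_nonneg _) fun h => ?_
    have h2 := (Finset.sum_eq_zero_iff_of_nonneg fun x _ => mul_self_nonneg _).1 h.symm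
    have h3 := eq_zero_of_chainGrad_eq_zero ha hb (w k) fun x hx1 hx2 =>
      mul_self_eq_zero.1 (h2 x (Finset.mem_Icc.2 ⟨hx1, hx2⟩))
    have h4 := hw k k
    rw [h3] at h4
    simp at h4
  · by_cases h : 1 ≤ x ∧ x < n
    · obtain ⟨j, hj⟩ := exists_index (n := n) (x := x.toNat) (by omega)
      have hx : x = (j : ℤ) + 1 := by omega
      rw [hx, heig, extendInt_succ]
    · rw [extendInt_of_not _ h, mul_zero, chainDiv, hb0 x h, zero_mul]

end modes

/-! ## The pseudo-Hamiltonian in normal modes -/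

/-- The coefficients `√(β(x/n) / m_x)` of the sites. -/
noncomputable def siteCoef (n : ℕ) (β : ℝ → ℝ) (mass : ℕ → ℝ) (x : ℤ) : ℝ :=
  if 1 ≤ x ∧ x ≤ n then √(β (x / n) / mass x.toNat) else 0

/-- The coefficients `√β(x/n)` of the bonds. -/
noncomputable def bondCoef (n : ℕ) (β : ℝ → ℝ) (x : ℤ) : ℝ :=
  if 1 ≤ x ∧ x < n then √(β (x / n)) else 0

/-- The thermal energy `(√t / 2) coth (√t / 2)` of a mode of squared frequency `t`. -/
noncomputable def modeEnergy (t : ℝ) : ℝ := √t * thermalFactor √t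

variable {n : ℕ}

theorem elongation_eq (x : ℕ) : elongation n x = extendBond (mulOp n) x := rfl

theorem partialDeriv_eq (x : ℕ) : partialDeriv n x = extendBond (derivOp n) x := rfl

theorem sum_smul_posOp (s : Fin (n - 1) → ℝ) (c : Fin (n - 1) → ℝ)
    (u : Fin (n - 1) → Fin (n - 1) → ℝ) :
    ∑ k, (c k : ℂ) • posOp n s (u k) = posOp n s (fun j => ∑ k, c k * u k j) := by
  simp only [posOp, Finset.smul_sum, Complex.ofReal_sum, Finset.sum_smul]
  rw [Finset.sum_comm]
  refine Finset.sum_congr rfl fun j _ => Finset.sum_congr rfl fun k _ => ?_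
  rw [smul_smul, Complex.ofReal_mul]

theorem sum_smul_momOp (d : Fin (n - 1) → ℝ) (c : Fin (n - 1) → ℝ)
    (u : Fin (n - 1) → Fin (n - 1) → ℝ) :
    ∑ k, (c k : ℂ) • momOp n d (u k) = momOp n d (fun j => ∑ k, c k * u k j) := by
  simp only [momOp, Finset.smul_sum, Complex.ofReal_sum, Finset.sum_smul]
  rw [Finset.sum_comm]
  refine Finset.sum_congr rfl fun j _ => Finset.sum_congr rfl fun k _ => ?_
  rw [smul_smul, Complex.ofReal_mul]

theorem posOp_ite (s : Fin (n - 1) → ℝ) (j : Fin (n - 1)) :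
    posOp n s (fun i => if i = j then 1 else 0) = mulOp n j - scalarOp n (s j) := by
  rw [posOp, Finset.sum_eq_single j]
  · simp
  · intro i _ hi
    simp [hi]
  · simp

theorem momOp_ite (d : Fin (n - 1) → ℝ) (j : Fin (n - 1)) :
    momOp n d (fun i => if i = j then 1 else 0) =
      (-Complex.I) • derivOp n j - scalarOp n (d j) := by
  rw [momOp, Finset.sum_eq_single j]
  · simp
  · intro i _ hi
    simp [hi]
  · simp

section frames

variable {U V : Fin (n - 1) → Fin (n - 1) → ℝ}
  (hUV : ∀ k l, ∑ j, U k j * V l j = if k = l then 1 else 0) (s d : Fin (n - 1) → ℝ)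

/-- The relation `q_k = ∑_j U_kj (ξ_j - s_j)` inverted by the dual frame. Off the bonds every term
is zero, in accordance with `r_0 = r_n = 0`. -/
theorem extendBond_mulOp (x : ℕ) :
    extendBond (mulOp n) x = ∑ k, ((extendBond (V k) x : ℝ) : ℂ) • (framePairs hUV s d).q k +
      scalarOp n ((extendBond s x : ℝ) : ℂ) := by
  by_cases h : 1 ≤ x ∧ x < n
  · obtain ⟨j, rfl⟩ := exists_index h
    simp only [extendBond_succ]
    have := sum_smul_posOp s (fun k => V k j) U
    rw [show (∑ k, (V k j : ℂ) • (framePairs hUV s d).q k) =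
      ∑ k, (V k j : ℂ) • posOp n s (U k) from rfl, this]
    have h2 : (fun i => ∑ k, V k j * U k i) = fun i => if i = j then (1 : ℝ) else 0 := by
      ext i
      rw [dual_frames hUV]
      simp only [eq_comm]
    rw [h2, posOp_ite, sub_add_cancel]
  · simp [extendBond_of_not _ h, scalarOp]

theorem extendBond_derivOp (x : ℕ) :
    (-Complex.I) • extendBond (derivOp n) x =
      ∑ k, ((extendBond (U k) x : ℝ) : ℂ) • (framePairs hUV s d).p k +
        scalarOp n ((extendBond d x : ℝ) : ℂ) := by
  by_cases h : 1 ≤ x ∧ x < n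
  · obtain ⟨j, rfl⟩ := exists_index h
    simp only [extendBond_succ]
    have := sum_smul_momOp d (fun k => U k j) V
    rw [show (∑ k, (U k j : ℂ) • (framePairs hUV s d).p k) =
      ∑ k, (U k j : ℂ) • momOp n d (V k) from rfl, this]
    have h2 : (fun i => ∑ k, U k j * V k i) = fun i => if i = j then (1 : ℝ) else 0 := by
      ext i
      rw [← dual_frames hUV i j]
      exact Finset.sum_congr rfl fun k _ => mul_comm _ _
    rw [h2, momOp_ite, sub_add_cancel]
  · simp [extendBond_of_not _ h, scalarOp]

theorem momentum_eq (x : ℕ) :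
    momentum n x =
      ∑ k, ((extendBond (U k) (x - 1) - extendBond (U k) x : ℝ) : ℂ) • (framePairs hUV s d).p k +
        scalarOp n ((extendBond d (x - 1) - extendBond d x : ℝ) : ℂ) := by
  rw [momentum, partialDeriv_eq, partialDeriv_eq, smul_sub, extendBond_derivOp hUV s d,
    extendBond_derivOp hUV s d]
  simp only [Complex.ofReal_sub, sub_smul, Finset.sum_sub_distrib, scalarOp]
  abel

end frames

/-- The squares expand into ordered products `T k * T l`. Their off-diagonal coefficients vanish
individually by `h`, so no commutation relation is needed. -/
theorem sum_smul_sq_eq {ι κ : Type*} [Fintype κ] [DecidableEq κ] (S : Finset ι) (g : ι → ℝ)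
    (A : ι → κ → ℝ) (T : κ → Module.End ℂ (Core n)) (ν : κ → ℝ)
    (h : ∀ k l, ∑ x ∈ S, g x * A x k * A x l = if k = l then ν k else 0) :
    ∑ x ∈ S, (g x : ℂ) • (∑ k, (A x k : ℂ) • T k) ^ 2 = ∑ k, (ν k : ℂ) • T k ^ 2 := by
  have h1 : ∀ x, (g x : ℂ) • (∑ k, (A x k : ℂ) • T k) ^ 2 =
      ∑ k, ∑ l, ((g x * A x k * A x l : ℝ) : ℂ) • (T k * T l) := by
    intro x
    rw [pow_two, Finset.sum_mul_sum, Finset.smul_sum]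
    refine Finset.sum_congr rfl fun k _ => ?_
    rw [Finset.smul_sum]
    refine Finset.sum_congr rfl fun l _ => ?_
    rw [smul_mul_smul_comm, smul_smul]
    push_cast
    rw [mul_assoc]
  simp only [h1]
  rw [Finset.sum_comm]
  refine Finset.sum_congr rfl fun k _ => ?_
  rw [Finset.sum_comm]
  simp only [← Finset.sum_smul, ← Complex.ofReal_sum, h]
  rw [Finset.sum_eq_single k]
  · rw [if_pos rfl, pow_two]
  · intro l _ hl
    simp [hl.symm]
  · simp

theorem add_scalarOp_sq (T : Module.End ℂ (Core n)) (c : ℂ) :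
    (T + scalarOp n c) ^ 2 = T ^ 2 + (2 * c) • T + scalarOp n (c ^ 2) := by
  simp only [scalarOp, pow_two, add_mul, mul_add, smul_mul_assoc, mul_smul_comm, one_mul, mul_one]
  module

/-- A weighted sum of squares of displaced fields is a sum of squares of the modes. -/
theorem sum_smul_add_scalarOp_sq {ι κ : Type*} [Fintype κ] [DecidableEq κ] (S : Finset ι)
    (g e : ι → ℝ) (A : ι → κ → ℝ) (T : κ → Module.End ℂ (Core n)) (ν : κ → ℝ)
    (h : ∀ k l, ∑ x ∈ S, g x * A x k * A x l = if k = l then ν k else 0)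
    (h0 : ∀ k, ∑ x ∈ S, g x * e x * A x k = 0) :
    ∑ x ∈ S, (g x : ℂ) • (∑ k, (A x k : ℂ) • T k + scalarOp n (e x : ℂ)) ^ 2 =
      ∑ k, (ν k : ℂ) • T k ^ 2 + scalarOp n ((∑ x ∈ S, g x * e x ^ 2 : ℝ) : ℂ) := by
  simp only [add_scalarOp_sq, smul_add, Finset.sum_add_distrib]
  rw [sum_smul_sq_eq S g A T ν h]
  -- The terms linear in the modes have the coefficients of `h0`, hence cancel.
  have h1 : ∑ x ∈ S, (g x : ℂ) • ((2 * (e x : ℂ)) • ∑ k, (A x k : ℂ) • T k) = 0 := by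
    have h2 : ∀ x, (g x : ℂ) • ((2 * (e x : ℂ)) • ∑ k, (A x k : ℂ) • T k) =
        ∑ k, ((2 * (g x * e x * A x k) : ℝ) : ℂ) • T k := by
      intro x
      rw [Finset.smul_sum, Finset.smul_sum]
      refine Finset.sum_congr rfl fun k _ => ?_
      rw [smul_smul, smul_smul]
      push_cast
      congr 1
      ring
    simp only [h2]
    rw [Finset.sum_comm]
    simp only [← Finset.sum_smul, ← Complex.ofReal_sum, ← Finset.mul_sum, h0]
    simp
  rw [h1, add_zero]
  congr 1
  simp only [scalarOp, smul_smul, ← Finset.sum_smul]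
  push_cast
  rfl

theorem formallySymmetric_momentum (x : ℕ) : FormallySymmetric (momentum n x) := by
  have h : ∀ y, FormallySymmetric ((-Complex.I) • partialDeriv n y) := by
    intro y
    by_cases h : 1 ≤ y ∧ y < n
    · obtain ⟨j, rfl⟩ := exists_index h
      rw [partialDeriv_eq, extendBond_succ]
      exact formallySymmetric_derivOp j
    · rw [partialDeriv_eq, extendBond_of_not _ h]
      intro f g
      simp
  have h1 := (h (x - 1)).add ((h x).real_smul (-1))
  convert h1 using 1
  rw [momentum, smul_sub]
  push_cast
  module

theorem formallySymmetric_elongation (x : ℕ) : FormallySymmetric (elongation n x) := by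
  by_cases h : 1 ≤ x ∧ x < n
  · obtain ⟨j, rfl⟩ := exists_index h
    rw [elongation_eq, extendBond_succ]
    exact formallySymmetric_mulOp j
  · rw [elongation_eq, extendBond_of_not _ h]
    intro f g
    simp

theorem FormallySymmetric.sub_scalarOp {A : Module.End ℂ (Core n)} (hA : FormallySymmetric A)
    (c : ℝ) : FormallySymmetric (A - QuantumChain.scalarOp n (c : ℂ)) := by
  have h := hA.add ((FormallySymmetric.scalarOp (n := n) c).real_smul (-1))
  convert h using 1
  push_cast
  module

theorem formallySymmetric_pseudoHamiltonian (β pbar rbar : ℝ → ℝ) (mbar : ℝ) (mass : ℕ → ℝ) :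
    FormallySymmetric (pseudoHamiltonian n β pbar rbar mbar mass) := by
  have h2 : (1 / 2 : ℂ) = ((1 / 2 : ℝ) : ℂ) := by norm_num
  rw [pseudoHamiltonian, h2]
  refine FormallySymmetric.real_smul _ (FormallySymmetric.sum _ fun x _ => ?_)
  exact ((((formallySymmetric_momentum x).sub_scalarOp _).sq).real_smul _).add
    ((((formallySymmetric_elongation x).sub_scalarOp _).sq).real_smul _)

/-! ## Thermal energies in terms of the normal modes -/

section quasiFree

variable {n : ℕ} {β pbar rbar : ℝ → ℝ} {mbar : ℝ} {mass : ℕ → ℝ}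

/-- A centred linear field `T` has mean zero, so subtracting the average removes exactly the
displacement `c`. -/
theorem fluctuation_eq_of_hasAverage {ρ : Hilb n →L[ℂ] Hilb n} {a T : Module.End ℂ (Core n)}
    {c : ℝ} (ha : FormallySymmetric a) (haT : a = T + scalarOp n c)
    (h : HasAverage ρ (scalarOp n c + T) c) : HasAverage ρ a c ∧ fluctuation ρ a = T := by
  have h1 : HasAverage ρ a c := by rwa [haT, add_comm]
  refine ⟨h1, ?_⟩
  rw [fluctuation, h1.average_eq ha, haT, add_sub_cancel_right]

theorem wellDefined_of_oscillatorHam (M : CanonicalPairs n) {ν : Fin (n - 1) → ℝ}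
    (hν : ∀ k, 0 < ν k) (C : ℝ)
    (hH : pseudoHamiltonian n β pbar rbar mbar mass = M.oscillatorHam ν C)
    (A B : ℕ → Fin (n - 1) → ℝ) (c s : ℕ → ℝ)
    (hA : ∀ x ∈ Finset.Icc 1 n, momentum n x = ∑ k, (A x k : ℂ) • M.p k + scalarOp n (c x : ℂ))
    (hB : ∀ x ∈ Finset.Icc 1 n, elongation n x = ∑ k, (B x k : ℂ) • M.q k + scalarOp n (s x : ℂ)) :
    WellDefined n β pbar rbar mbar mass ∧ ∀ x ∈ Finset.Icc 1 n,
      thermalEnergy n β pbar rbar mbar mass x =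
        (1 / 2) * ((1 / mass x) * ∑ k, A x k ^ 2 * thermalFactor (ν k) +
          ∑ k, B x k ^ 2 * thermalFactor (ν k)) := by
  obtain ⟨ρ, hρ, hlin, hquad⟩ := M.exists_gibbsState hν C
  rw [← hH] at hρ
  have hst := gibbsState_eq (formallySymmetric_pseudoHamiltonian β pbar rbar mbar mass) hρ
  have hsq : (√2)⁻¹ * (√2)⁻¹ = (1 / 2 : ℝ) := by
    rw [← mul_inv, Real.mul_self_sqrt (by norm_num)]
    norm_num
  have hz1 : Complex.normSq ((√2 : ℝ) : ℂ)⁻¹ = 1 / 2 := by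
    rw [← Complex.ofReal_inv, Complex.normSq_ofReal, hsq]
  have hz2 : Complex.normSq (-Complex.I * ((√2 : ℝ) : ℂ)⁻¹) = 1 / 2 := by
    rw [map_mul, hz1]
    simp
  have hle : ∀ z : ℂ, Complex.normSq z = 1 / 2 → ‖z‖ ≤ 1 := by
    intro z hz
    rw [Complex.normSq_eq_norm_sq] at hz
    nlinarith [norm_nonneg z]
  have hp : ∀ x ∈ Finset.Icc 1 n, HasAverage ρ (momentum n x) (c x) ∧
      fluctuation ρ (momentum n x) = M.lin (-Complex.I * ((√2 : ℝ) : ℂ)⁻¹) (A x) := by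
    intro x hx
    refine fluctuation_eq_of_hasAverage (formallySymmetric_momentum x) ?_ (hlin _ _ _ (hle _ hz2))
    rw [hA x hx, M.sum_smul_p]
  have hr : ∀ x ∈ Finset.Icc 1 n, HasAverage ρ (elongation n x) (s x) ∧
      fluctuation ρ (elongation n x) = M.lin ((√2 : ℝ) : ℂ)⁻¹ (B x) := by
    intro x hx
    refine fluctuation_eq_of_hasAverage (formallySymmetric_elongation x) ?_ (hlin _ _ _ (hle _ hz1))
    rw [hB x hx, M.sum_smul_q]
  have he : ∀ x ∈ Finset.Icc 1 n, HasAverage ρ (fluctuationEnergy ρ mass x)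
      (((1 / 2) * ((1 / mass x) * ∑ k, A x k ^ 2 * thermalFactor (ν k) +
          ∑ k, B x k ^ 2 * thermalFactor (ν k)) : ℝ) : ℂ) := by
    intro x hx
    rw [fluctuationEnergy, (hp x hx).2, (hr x hx).2]
    exact hquad _ _ _ _ _ hz2 hz1
  have hes : ∀ x ∈ Finset.Icc 1 n, FormallySymmetric (fluctuationEnergy ρ mass x) := by
    intro x hx
    have h2 : (1 / 2 : ℂ) = ((1 / 2 : ℝ) : ℂ) := by norm_num
    rw [fluctuationEnergy, (hp x hx).2, (hr x hx).2, h2]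
    exact ((((M.formallySymmetric_lin _ _).sq).real_smul _).add
      ((M.formallySymmetric_lin _ _).sq)).real_smul _
  have hth : ∀ x ∈ Finset.Icc 1 n, thermalEnergy n β pbar rbar mbar mass x =
      (1 / 2) * ((1 / mass x) * ∑ k, A x k ^ 2 * thermalFactor (ν k) +
          ∑ k, B x k ^ 2 * thermalFactor (ν k)) := by
    intro x hx
    rw [thermalEnergy, hst, (he x hx).average_eq (hes x hx), Complex.ofReal_re]
  refine ⟨⟨?_, ?_, ?_, ?_⟩, hth⟩
  · rwa [hst]
  · intro x hx
    rw [hst, (hp x hx).1.average_eq (formallySymmetric_momentum x)]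
    exact (hp x hx).1
  · intro x hx
    rw [hst, (hr x hx).1.average_eq (formallySymmetric_elongation x)]
    exact (hr x hx).1
  · intro x hx
    rw [hth x hx, hst]
    exact he x hx

/-- `hAA` and `hBB` diagonalise the kinetic and potential forms simultaneously, with the same
coefficient `ν k`, so that each mode appears as `q_k² + p_k²`. `hA0` and `hB0` remove the linear
terms, and the squared residual displacements become the constant. -/
theorem exists_pseudoHamiltonian_eq_oscillatorHam (M : CanonicalPairs n) (ν : Fin (n - 1) → ℝ)
    (A B : ℕ → Fin (n - 1) → ℝ) (c s : ℕ → ℝ)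
    (hA : ∀ x ∈ Finset.Icc 1 n, momentum n x = ∑ k, (A x k : ℂ) • M.p k + scalarOp n (c x : ℂ))
    (hB : ∀ x ∈ Finset.Icc 1 n, elongation n x = ∑ k, (B x k : ℂ) • M.q k + scalarOp n (s x : ℂ))
    (hAA : ∀ k l, ∑ x ∈ Finset.Icc 1 n, β (x / n) / mass x * A x k * A x l =
      if k = l then ν k else 0)
    (hBB : ∀ k l, ∑ x ∈ Finset.Icc 1 n, β (x / n) * B x k * B x l = if k = l then ν k else 0)
    (hA0 : ∀ k, ∑ x ∈ Finset.Icc 1 n,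
      β (x / n) / mass x * (c x - mass x / mbar * pbar (x / n)) * A x k = 0)
    (hB0 : ∀ k, ∑ x ∈ Finset.Icc 1 n, β (x / n) * (s x - rbar (x / n)) * B x k = 0) :
    ∃ C, pseudoHamiltonian n β pbar rbar mbar mass = M.oscillatorHam ν C := by
  have h1 := sum_smul_add_scalarOp_sq (Finset.Icc 1 n) (fun x : ℕ => β (x / n) / mass x)
    (fun x : ℕ => c x - mass x / mbar * pbar (x / n)) A M.p ν hAA hA0
  have h2 := sum_smul_add_scalarOp_sq (Finset.Icc 1 n) (fun x : ℕ => β (x / n))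
    (fun x : ℕ => s x - rbar (x / n)) B M.q ν hBB hB0
  refine ⟨1 / 2 * (∑ x ∈ Finset.Icc 1 n,
      β (x / n) / mass x * (c x - mass x / mbar * pbar (x / n)) ^ 2 +
    ∑ x ∈ Finset.Icc 1 n, β (x / n) * (s x - rbar (x / n)) ^ 2), ?_⟩
  have h3 : ∀ (T : Module.End ℂ (Core n)) (u v : ℝ),
      T + scalarOp n (u : ℂ) - scalarOp n (v : ℂ) = T + scalarOp n ((u - v : ℝ) : ℂ) := by
    intro T u v
    simp only [scalarOp]
    push_cast
    module
  have h4 : ∀ x ∈ Finset.Icc 1 n,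
      ((β (x / n) / mass x : ℝ) : ℂ) •
        (momentum n x - scalarOp n ((mass x / mbar * pbar (x / n) : ℝ) : ℂ)) ^ 2
      + ((β (x / n) : ℝ) : ℂ) • (elongation n x - scalarOp n ((rbar (x / n) : ℝ) : ℂ)) ^ 2 =
      ((β (x / n) / mass x : ℝ) : ℂ) • (∑ k, (A x k : ℂ) • M.p k +
        scalarOp n ((c x - mass x / mbar * pbar (x / n) : ℝ) : ℂ)) ^ 2 +
      ((β (x / n) : ℝ) : ℂ) • (∑ k, (B x k : ℂ) • M.q k +
        scalarOp n ((s x - rbar (x / n) : ℝ) : ℂ)) ^ 2 := by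
    intro x hx
    rw [hA x hx, hB x hx, h3, h3]
  rw [pseudoHamiltonian, Finset.sum_congr rfl h4, Finset.sum_add_distrib, h1, h2,
    CanonicalPairs.oscillatorHam]
  have h5 : ∑ k, ((ν k / 2 : ℝ) : ℂ) • (M.q k ^ 2 + M.p k ^ 2) =
      (1 / 2 : ℂ) • (∑ k, (ν k : ℂ) • M.p k ^ 2 + ∑ k, (ν k : ℂ) • M.q k ^ 2) := by
    rw [← Finset.sum_add_distrib, Finset.smul_sum]
    refine Finset.sum_congr rfl fun k _ => ?_
    push_cast
    module
  rw [h5]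
  simp only [scalarOp]
  push_cast
  module

end quasiFree

/-- An orthonormal family of eigenvectors of the weighted Laplacian of the chain. -/
structure NormalModes (n : ℕ) (a b : ℤ → ℝ) where
  lam : Fin (n - 1) → ℝ
  w : Fin (n - 1) → Fin (n - 1) → ℝ
  lam_pos : ∀ k, 0 < lam k
  orthonormal : ∀ k l, ∑ j, w k j * w l j = if k = l then 1 else 0
  gram : ∀ k l, ∑ x ∈ Finset.Icc 1 n,
    chainGrad a b (extendInt (w k)) (x : ℤ) * chainGrad a b (extendInt (w l)) (x : ℤ) =
      if k = l then lam k else 0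
  eigen : ∀ k x, chainDiv a b (chainGrad a b (extendInt (w k))) x = lam k * extendInt (w k) x

theorem sum_Icc_sub (f : ℕ → ℝ) (n : ℕ) :
    ∑ x ∈ Finset.Icc 1 n, (f (x - 1) - f x) = f 0 - f n := by
  induction n with
  | zero => simp
  | succ n ih =>
    rw [Finset.sum_Icc_succ_top (by omega), ih, Nat.add_sub_cancel]
    ring

section coef

variable {n : ℕ} {β : ℝ → ℝ} {mass : ℕ → ℝ}

theorem siteCoef_natCast {x : ℕ} (hx : x ∈ Finset.Icc 1 n) :
    siteCoef n β mass x = √(β (x / n) / mass x) := by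
  rw [Finset.mem_Icc] at hx
  rw [siteCoef, if_pos (by omega), Int.toNat_natCast, Int.cast_natCast]

theorem bondCoef_natCast {x : ℕ} (hx : 1 ≤ x ∧ x < n) : bondCoef n β x = √(β (x / n)) := by
  rw [bondCoef, if_pos (by omega), Int.cast_natCast]

theorem nonempty_normalModes (hm : ∀ x ∈ Finset.Icc 1 n, 0 < mass x)
    (hβ : ∀ x ∈ Finset.Icc 1 n, 0 < β (x / n)) :
    Nonempty (NormalModes n (siteCoef n β mass) (bondCoef n β)) := by
  obtain ⟨lam, w, h1, h2, h3, h4⟩ := exists_modes (n := n) (siteCoef n β mass) (bondCoef n β)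
    (fun x h1 h2 => by
      have hx := Finset.mem_Icc.2 ⟨h1, h2⟩
      rw [siteCoef_natCast hx]
      exact Real.sqrt_pos.2 (div_pos (hβ x hx) (hm x hx)))
    (fun x h1 h2 => by
      rw [bondCoef_natCast ⟨h1, h2⟩]
      exact Real.sqrt_pos.2 (hβ x (Finset.mem_Icc.2 ⟨h1, h2.le⟩)))
    (fun x h => if_neg h)
  exact ⟨⟨lam, w, h1, h2, h3, h4⟩⟩

/-- Displacements of the momenta with vanishing total, equivalent to the prescribed ones. -/
theorem exists_displacement (hm : ∀ x ∈ Finset.Icc 1 n, 0 < mass x)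
    (hβ : ∀ x ∈ Finset.Icc 1 n, 0 < β (x / n)) (c : ℕ → ℝ) :
    ∃ (d : Fin (n - 1) → ℝ) (t : ℝ), ∀ x ∈ Finset.Icc 1 n,
      β (x / n) / mass x * (extendBond d (x - 1) - extendBond d x - c x) = t := by
  by_cases hn : 1 ≤ n
  swap
  · refine ⟨0, 0, fun x hx => ?_⟩
    rw [Finset.mem_Icc] at hx
    omega
  let S : ℝ := ∑ x ∈ Finset.Icc 1 n, mass x / β (x / n)
  have hS : 0 < S := Finset.sum_pos (fun x hx => div_pos (hm x hx) (hβ x hx))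
    ⟨1, Finset.mem_Icc.2 ⟨le_rfl, hn⟩⟩
  -- The unique multiplier for which the corrected displacements `c + t m/β` have total zero. Only
  -- then can they be differences of a `d` that vanishes at both ends.
  let t : ℝ := -(∑ x ∈ Finset.Icc 1 n, c x) / S
  let c' : ℕ → ℝ := fun x => c x + t * (mass x / β (x / n))
  have hc' : ∑ x ∈ Finset.Icc 1 n, c' x = 0 := by
    simp only [c', Finset.sum_add_distrib, ← Finset.mul_sum]
    change _ + t * S = 0
    simp only [t]
    field_simp
    ring
  let D : ℕ → ℝ := fun x => -∑ y ∈ Finset.Icc 1 x, c' y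
  let d : Fin (n - 1) → ℝ := fun j => D (j + 1)
  have hd : ∀ x ≤ n, extendBond d x = D x := by
    intro x hx
    by_cases h : 1 ≤ x ∧ x < n
    · obtain ⟨j, rfl⟩ := exists_index h
      rw [extendBond_succ]
    · rw [extendBond_of_not _ h]
      have h1 : x = 0 ∨ x = n := by omega
      rcases h1 with rfl | rfl
      · simp [D]
      · simp [D, hc']
  refine ⟨d, t, fun x hx => ?_⟩
  have hx' := Finset.mem_Icc.1 hx
  rw [hd _ (by omega), hd _ hx'.2]
  obtain ⟨y, rfl⟩ : ∃ y, x = y + 1 := ⟨x - 1, by omega⟩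
  have h1 := hm _ hx
  have h2 := hβ _ hx
  simp only [D, Nat.add_sub_cancel]
  rw [Finset.sum_Icc_succ_top (by omega)]
  simp only [c']
  field_simp
  ring

variable (N : NormalModes n (siteCoef n β mass) (bondCoef n β))

/-- A mode of frequency `ν` has `⟨q²⟩ = ⟨p²⟩ = thermalFactor ν`, with vanishing correlations between
different modes. Weighted by the squared coefficients of `p̃_x` and `r̃_x`, these give the two sums;
with `λ = ν²` the powers of `ν` combine into `modeEnergy`. -/
theorem thermalEnergy_eq {pbar rbar : ℝ → ℝ} {mbar : ℝ} (hm : ∀ x ∈ Finset.Icc 1 n, 0 < mass x)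
    (hβ : ∀ x ∈ Finset.Icc 1 n, 0 < β (x / n)) :
    WellDefined n β pbar rbar mbar mass ∧ ∀ x ∈ Finset.Icc 1 n,
      thermalEnergy n β pbar rbar mbar mass x = 1 / (2 * β (x / n)) *
        (∑ k, chainGrad (siteCoef n β mass) (bondCoef n β) (extendInt (N.w k)) x ^ 2 / N.lam k *
            modeEnergy (N.lam k) +
          ∑ k, extendInt (N.w k) x ^ 2 * modeEnergy (N.lam k)) := by
  obtain ⟨d, t, hd⟩ := exists_displacement (n := n) (β := β) hm hβ
    (fun x => mass x / mbar * pbar (x / n))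
  let ν : Fin (n - 1) → ℝ := fun k => √(N.lam k)
  have hν : ∀ k, 0 < ν k := fun k => Real.sqrt_pos.2 (N.lam_pos k)
  have hνν : ∀ k, ν k * ν k = N.lam k := fun k => Real.mul_self_sqrt (N.lam_pos k).le
  let r : Fin (n - 1) → ℝ := fun k => √(ν k)
  have hr : ∀ k, 0 < r k := fun k => Real.sqrt_pos.2 (hν k)
  have hrr : ∀ k, r k * r k = ν k := fun k => Real.mul_self_sqrt (hν k).le
  let bb : Fin (n - 1) → ℝ := fun j => bondCoef n β ((j : ℤ) + 1)
  have hbb : ∀ j : Fin (n - 1), bb j = √(β (((j + 1 : ℕ) : ℝ) / n)) := by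
    intro j
    have := bondCoef_natCast (n := n) (β := β) (x := (j : ℕ) + 1) ⟨by omega, by omega⟩
    push_cast at this ⊢
    exact this
  have hj : ∀ j : Fin (n - 1), (j : ℕ) + 1 ∈ Finset.Icc 1 n := fun j =>
    Finset.mem_Icc.2 ⟨by omega, by omega⟩
  have hbpos : ∀ j, 0 < bb j := fun j => by
    rw [hbb]
    exact Real.sqrt_pos.2 (hβ _ (hj j))
  -- The scale `r = √ν = λ^(1/4)` balances the two forms: the momentum part becomes `λ/r² = ν` and
  -- the elongation part `r² = ν`. The factors `b` and `1/b` in `U` and `V` make the frames dual.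
  let U : Fin (n - 1) → Fin (n - 1) → ℝ := fun k j => (r k)⁻¹ * (bb j * N.w k j)
  let V : Fin (n - 1) → Fin (n - 1) → ℝ := fun k j => r k * (N.w k j / bb j)
  let s : Fin (n - 1) → ℝ := fun j => rbar (((j + 1 : ℕ) : ℝ) / n)
  have hUV : ∀ k l, ∑ j, U k j * V l j = if k = l then 1 else 0 := by
    intro k l
    have h1 : ∀ j, U k j * V l j = (r k)⁻¹ * r l * (N.w k j * N.w l j) := by
      intro j
      have := (hbpos j).ne'
      simp only [U, V]
      field_simp
    simp only [h1, ← Finset.mul_sum, N.orthonormal]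
    split_ifs with h
    · rw [h, mul_one, inv_mul_cancel₀ (hr l).ne']
    · rw [mul_zero]
  have hU : ∀ k (x : ℕ), extendBond (U k) x = (r k)⁻¹ * (bondCoef n β x * extendInt (N.w k) x) := by
    intro k x
    by_cases h : 1 ≤ x ∧ x < n
    · obtain ⟨j, rfl⟩ := exists_index h
      rw [extendBond_succ]
      push_cast
      rw [extendInt_succ]
    · rw [extendBond_of_not _ h, extendInt_of_not _ (by omega)]
      simp
  have hUg : ∀ k, ∀ x ∈ Finset.Icc 1 n, siteCoef n β mass x *
      (extendBond (U k) (x - 1) - extendBond (U k) x) =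
      (r k)⁻¹ * chainGrad (siteCoef n β mass) (bondCoef n β) (extendInt (N.w k)) x := by
    intro k x hx
    have hx' := Finset.mem_Icc.1 hx
    have e : ((x - 1 : ℕ) : ℤ) = (x : ℤ) - 1 := by omega
    rw [hU, hU, chainGrad, e]
    ring
  have hsite : ∀ x ∈ Finset.Icc 1 n, siteCoef n β mass x * siteCoef n β mass x =
      β (x / n) / mass x := by
    intro x hx
    rw [siteCoef_natCast hx, Real.mul_self_sqrt (div_pos (hβ x hx) (hm x hx)).le]
  have hV : ∀ k (x : ℕ), x ∈ Finset.Icc 1 n →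
      √(β (x / n)) * extendBond (V k) x = r k * extendBond (N.w k) x := by
    intro k x hx
    by_cases h : 1 ≤ x ∧ x < n
    · obtain ⟨j, rfl⟩ := exists_index h
      rw [extendBond_succ, extendBond_succ, ← hbb]
      have := (hbpos j).ne'
      simp only [V]
      field_simp
    · rw [extendBond_of_not _ h, extendBond_of_not _ h]
      simp
  have hsum : ∀ f : ℕ → ℝ, ∑ x ∈ Finset.Icc 1 n, extendBond (fun j : Fin (n - 1) => f (j + 1)) x =
      ∑ j : Fin (n - 1), f (j + 1) := by
    intro f
    rw [Fin.sum_univ_eq_sum_range (fun j => f (j + 1)) (n - 1)]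
    rcases Nat.eq_zero_or_pos n with rfl | hn
    · simp
    obtain ⟨m, rfl⟩ : ∃ m, n = m + 1 := ⟨n - 1, by omega⟩
    rw [Finset.sum_Icc_succ_top (by omega), extendBond_of_not _ (by omega), add_zero,
      ← Finset.Ico_succ_right_eq_Icc, Finset.sum_Ico_eq_sum_range]
    refine Finset.sum_congr (by simp) fun j hj => ?_
    have hj' : j < m := by simpa using hj
    have := extendBond_succ (n := m + 1) (fun j : Fin (m + 1 - 1) => f (j + 1)) ⟨j, by omega⟩
    rw [add_comm 1 j]
    exact this
  obtain ⟨C, hC⟩ := exists_pseudoHamiltonian_eq_oscillatorHam (n := n) (β := β) (pbar := pbar)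
    (rbar := rbar) (mbar := mbar) (mass := mass) (framePairs hUV s d) ν
    (fun x k => extendBond (U k) (x - 1) - extendBond (U k) x) (fun x k => extendBond (V k) x)
    (fun x => extendBond d (x - 1) - extendBond d x) (fun x => extendBond s x)
    (fun x _ => momentum_eq hUV s d x) (fun x _ => extendBond_mulOp hUV s d x)
    (fun k l => by
      have h1 : ∀ x ∈ Finset.Icc 1 n, β (x / n) / mass x *
          (extendBond (U k) (x - 1) - extendBond (U k) x) *
          (extendBond (U l) (x - 1) - extendBond (U l) x) = (r k)⁻¹ * (r l)⁻¹ *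
          (chainGrad (siteCoef n β mass) (bondCoef n β) (extendInt (N.w k)) x *
            chainGrad (siteCoef n β mass) (bondCoef n β) (extendInt (N.w l)) x) := by
        intro x hx
        rw [← hsite x hx]
        linear_combination (siteCoef n β mass x *
          (extendBond (U l) (x - 1) - extendBond (U l) x)) * hUg k x hx +
          (r k)⁻¹ * chainGrad (siteCoef n β mass) (bondCoef n β) (extendInt (N.w k)) x *
            hUg l x hx
      rw [Finset.sum_congr rfl h1, ← Finset.mul_sum, N.gram]
      split_ifs with h
      · rw [← h, ← hνν, ← hrr]
        have := (hr k).ne'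
        field_simp
      · rw [mul_zero])
    (fun k l => by
      have h1 : ∀ x ∈ Finset.Icc 1 n, β (x / n) * extendBond (V k) x * extendBond (V l) x =
          r k * r l * (extendBond (N.w k) x * extendBond (N.w l) x) := by
        intro x hx
        have h3 := Real.mul_self_sqrt (hβ x hx).le
        linear_combination (√(β (x / n)) * extendBond (V l) x) * hV k x hx +
          r k * extendBond (N.w k) x * hV l x hx - extendBond (V k) x * extendBond (V l) x * h3
      have h2 : ∀ x : ℕ, extendBond (N.w k) x * extendBond (N.w l) x =
          extendBond (fun j => N.w k j * N.w l j) x := by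
        intro x
        by_cases h : 1 ≤ x ∧ x < n
        · obtain ⟨j, rfl⟩ := exists_index h
          simp only [extendBond_succ]
        · simp only [extendBond_of_not _ h, mul_zero]
      have h3 : (fun j => N.w k j * N.w l j) = fun j : Fin (n - 1) =>
          (fun y : ℕ => extendBond (N.w k) y * extendBond (N.w l) y) ((j : ℕ) + 1) := by
        funext j
        simp only [extendBond_succ]
      rw [Finset.sum_congr rfl h1, ← Finset.mul_sum]
      simp only [h2]
      rw [h3, hsum (fun y : ℕ => extendBond (N.w k) y * extendBond (N.w l) y)]
      simp only [extendBond_succ]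
      rw [N.orthonormal]
      split_ifs with h
      · rw [← h, mul_one, hrr]
      · rw [mul_zero])
    -- The weighted residual displacement is the constant `t`, and the coefficients of `p_k`
    -- telescope to zero between the two ends of the chain.
    (fun k => by
      have h1 : ∀ x ∈ Finset.Icc 1 n, β (x / n) / mass x *
          (extendBond d (x - 1) - extendBond d x - mass x / mbar * pbar (x / n)) *
          (extendBond (U k) (x - 1) - extendBond (U k) x) =
          t * (extendBond (U k) (x - 1) - extendBond (U k) x) := by
        intro x hx
        rw [hd x hx]
      rw [Finset.sum_congr rfl h1, ← Finset.mul_sum, sum_Icc_sub, extendBond_of_not _ (by omega),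
        extendBond_of_not _ (by omega)]
      simp)
    -- On bonds the displacement is exactly `r̄`; at `x = n` there may be a residual, but `V k`
    -- vanishes there.
    (fun k => by
      refine Finset.sum_eq_zero fun x _ => ?_
      by_cases h : 1 ≤ x ∧ x < n
      · obtain ⟨j, rfl⟩ := exists_index h
        rw [extendBond_succ]
        simp [s]
      · rw [extendBond_of_not (V k) h, mul_zero])
  obtain ⟨hW, hE⟩ := wellDefined_of_oscillatorHam (framePairs hUV s d) hν C hC
    (fun x k => extendBond (U k) (x - 1) - extendBond (U k) x) (fun x k => extendBond (V k) x)
    (fun x => extendBond d (x - 1) - extendBond d x) (fun x => extendBond s x)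
    (fun x _ => momentum_eq hUV s d x) (fun x _ => extendBond_mulOp hUV s d x)
  refine ⟨hW, fun x hx => ?_⟩
  have hβx := hβ x hx
  have hmx := hm x hx
  rw [hE x hx]
  have hA : ∀ k, (extendBond (U k) (x - 1) - extendBond (U k) x) ^ 2 * thermalFactor (ν k) =
      mass x / β (x / n) *
      (chainGrad (siteCoef n β mass) (bondCoef n β) (extendInt (N.w k)) x ^ 2 / N.lam k *
            modeEnergy (N.lam k)) := by
    intro k
    have h1 := hUg k x hx
    have h2 := hsite x hx
    have h3 : (extendBond (U k) (x - 1) - extendBond (U k) x) ^ 2 * (β (x / n) / mass x) =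
        (ν k)⁻¹ * chainGrad (siteCoef n β mass) (bondCoef n β) (extendInt (N.w k)) x ^ 2 := by
      have h4 : (ν k)⁻¹ = (r k)⁻¹ * (r k)⁻¹ := by rw [← mul_inv, hrr]
      rw [h4, ← h2]
      linear_combination (siteCoef n β mass x *
          (extendBond (U k) (x - 1) - extendBond (U k) x) + (r k)⁻¹ *
          chainGrad (siteCoef n β mass) (bondCoef n β) (extendInt (N.w k)) x) * h1
    have h5 : (extendBond (U k) (x - 1) - extendBond (U k) x) ^ 2 = mass x / β (x / n) *
        ((ν k)⁻¹ * chainGrad (siteCoef n β mass) (bondCoef n β) (extendInt (N.w k)) x ^ 2) := by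
      rw [← h3]
      field_simp
    rw [h5, modeEnergy, ← hνν]
    change _ = mass x / β (x / n) * (_ / (ν k * ν k) * (√(ν k * ν k) * thermalFactor √(ν k * ν k)))
    rw [Real.sqrt_mul_self (hν k).le]
    have := (hν k).ne'
    field_simp
  have hB : ∀ k, extendBond (V k) x ^ 2 * thermalFactor (ν k) =
      1 / β (x / n) * (extendInt (N.w k) x ^ 2 * modeEnergy (N.lam k)) := by
    intro k
    have h1 := hV k x hx
    have h3 := Real.mul_self_sqrt hβx.le
    have h4 : β (x / n) * extendBond (V k) x ^ 2 = ν k * extendBond (N.w k) x ^ 2 := by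
      rw [← hrr]
      linear_combination (√(β (x / n)) * extendBond (V k) x + r k * extendBond (N.w k) x) * h1 -
        extendBond (V k) x ^ 2 * h3
    have h5 : extendBond (V k) x ^ 2 = 1 / β (x / n) * (ν k * extendBond (N.w k) x ^ 2) := by
      rw [← h4]
      field_simp
    rw [h5, modeEnergy, extendInt_natCast]
    ring
  simp only [hA, hB, ← Finset.mul_sum]
  field_simp

end coef

/-! ## Mode sums of polynomials as local functions of the coefficients -/

/-- The weighted Laplacian on bonds. -/
def bondLaplacian (a b u : ℤ → ℝ) : ℤ → ℝ := chainDiv a b (chainGrad a b u)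

/-- The weighted Laplacian on sites. -/
def siteLaplacian (a b u : ℤ → ℝ) : ℤ → ℝ := chainGrad a b (chainDiv a b u)

theorem chainGrad_fun_sum {ι : Type*} (s : Finset ι) (a b : ℤ → ℝ) (c : ι → ℝ) (u : ι → ℤ → ℝ) :
    chainGrad a b (fun x => ∑ i ∈ s, c i * u i x) = fun x => ∑ i ∈ s, c i * chainGrad a b (u i) x :=
  funext fun x => chainGrad_sum s a b c u x

theorem chainDiv_fun_sum {ι : Type*} (s : Finset ι) (a b : ℤ → ℝ) (c : ι → ℝ) (u : ι → ℤ → ℝ) :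
    chainDiv a b (fun x => ∑ i ∈ s, c i * u i x) =
      fun x => ∑ i ∈ s, c i * chainDiv a b (u i) x := by
  funext x
  simp only [chainDiv, Finset.mul_sum, ← Finset.sum_sub_distrib]
  exact Finset.sum_congr rfl fun i _ => by ring

theorem sum_extendBond {n : ℕ} (u : Fin (n - 1) → ℝ) :
    ∑ x ∈ Finset.Icc 1 n, extendBond u x = ∑ j, u j := by
  have h1 : ∀ x : ℕ, extendBond u x =
      ∑ j : Fin (n - 1), if x = (j : ℕ) + 1 then u j else 0 := by
    intro x
    by_cases h : 1 ≤ x ∧ x < n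
    · obtain ⟨i, rfl⟩ := exists_index h
      rw [extendBond_succ, Finset.sum_eq_single i]
      · rw [if_pos rfl]
      · intro j _ hj
        rw [if_neg]
        intro h
        exact hj (Fin.ext (by omega))
      · simp
    · rw [extendBond_of_not _ h]
      exact (Finset.sum_eq_zero fun j _ => if_neg (by omega)).symm
  simp only [h1]
  rw [Finset.sum_comm]
  refine Finset.sum_congr rfl fun j _ => ?_
  rw [Finset.sum_ite_eq', if_pos (Finset.mem_Icc.2 ⟨by omega, by omega⟩)]

namespace NormalModes

variable {n : ℕ} {a b : ℤ → ℝ} (N : NormalModes n a b)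

/-- The `k`-th mode, extended by zero to `ℤ`. -/
def bond (k : Fin (n - 1)) : ℤ → ℝ := extendInt (N.w k)

/-- The gradient of the `k`-th mode. -/
def site (k : Fin (n - 1)) : ℤ → ℝ := chainGrad a b (N.bond k)

theorem complete (i j : Fin (n - 1)) : ∑ k, N.w k i * N.w k j = if i = j then 1 else 0 :=
  dual_frames N.orthonormal i j

theorem eq_sum_bond (f : ℤ → ℝ) (hf : ∀ x : ℤ, ¬(1 ≤ x ∧ x < n) → f x = 0) :
    f = fun z => ∑ k, (∑ j : Fin (n - 1), N.w k j * f ((j : ℤ) + 1)) * N.bond k z := by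
  funext z
  by_cases h : 1 ≤ z ∧ z < n
  · obtain ⟨i, hi⟩ := exists_index (n := n) (x := z.toNat) (by omega)
    have hz : z = (i : ℤ) + 1 := by omega
    subst hz
    simp only [bond, extendInt_succ, Finset.sum_mul]
    rw [Finset.sum_comm]
    have h1 : ∀ j : Fin (n - 1), ∑ k, N.w k j * f ((j : ℤ) + 1) * N.w k i =
        f ((j : ℤ) + 1) * if j = i then 1 else 0 := by
      intro j
      rw [← N.complete, Finset.mul_sum]
      exact Finset.sum_congr rfl fun k _ => by ring
    simp only [h1]
    simp
  · rw [hf z h]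
    simp [bond, extendInt_of_not _ h]

theorem sum_w_mul_chainDiv (f : ℤ → ℝ) (k : Fin (n - 1)) :
    ∑ j : Fin (n - 1), N.w k j * chainDiv a b f ((j : ℤ) + 1) =
      ∑ x ∈ Finset.Icc 1 n, N.site k x * f x := by
  simp only [← sum_chainGrad_single_mul, Finset.mul_sum]
  rw [Finset.sum_comm]
  refine Finset.sum_congr rfl fun x _ => ?_
  rw [site, bond, chainGrad_extendInt, Finset.sum_mul]
  exact Finset.sum_congr rfl fun j _ => by ring

theorem chainDiv_site (k : Fin (n - 1)) :
    chainDiv a b (N.site k) = fun x => N.lam k * N.bond k x := funext (N.eigen k)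

theorem bondLaplacian_sum (c : Fin (n - 1) → ℝ) :
    bondLaplacian a b (fun z => ∑ k, c k * N.bond k z) =
      fun z => ∑ k, c k * N.lam k * N.bond k z := by
  rw [bondLaplacian, chainGrad_fun_sum, chainDiv_fun_sum]
  funext z
  refine Finset.sum_congr rfl fun k _ => ?_
  have := congrFun (N.chainDiv_site k) z
  rw [site] at this
  rw [this, mul_assoc]

theorem siteLaplacian_sum (c : Fin (n - 1) → ℝ) :
    siteLaplacian a b (fun z => ∑ k, c k * N.site k z) =
      fun z => ∑ k, c k * N.lam k * N.site k z := by
  rw [siteLaplacian, chainDiv_fun_sum]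
  simp only [chainDiv_site, ← mul_assoc]
  rw [chainGrad_fun_sum]
  rfl

theorem iterate_bondLaplacian (c : Fin (n - 1) → ℝ) (i : ℕ) :
    (bondLaplacian a b)^[i] (fun z => ∑ k, c k * N.bond k z) =
      fun z => ∑ k, c k * N.lam k ^ i * N.bond k z := by
  induction i with
  | zero => simp
  | succ i ih =>
    rw [Function.iterate_succ_apply', ih, bondLaplacian_sum]
    simp only [pow_succ, mul_assoc]

theorem iterate_siteLaplacian (c : Fin (n - 1) → ℝ) (i : ℕ) :
    (siteLaplacian a b)^[i] (fun z => ∑ k, c k * N.site k z) =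
      fun z => ∑ k, c k * N.lam k ^ i * N.site k z := by
  induction i with
  | zero => simp
  | succ i ih =>
    rw [Function.iterate_succ_apply', ih, siteLaplacian_sum]
    simp only [pow_succ, mul_assoc]

theorem single_eq_sum_bond {x : ℤ} (hx : 1 ≤ x ∧ x < n) :
    (Pi.single x 1 : ℤ → ℝ) = fun z => ∑ k, N.bond k x * N.bond k z := by
  have h1 := N.eq_sum_bond (Pi.single x 1)
    (fun z hz => Pi.single_eq_of_ne (by rintro rfl; exact hz hx) _)
  rw [h1]
  obtain ⟨i, hi⟩ := exists_index (n := n) (x := x.toNat) (by omega)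
  have hxi : x = (i : ℤ) + 1 := by omega
  funext z
  refine Finset.sum_congr rfl fun k _ => ?_
  congr 1
  rw [hxi, bond, extendInt_succ, Finset.sum_eq_single i]
  · simp
  · intro j _ hj
    rw [Pi.single_eq_of_ne, mul_zero]
    intro h
    exact hj (Fin.ext (by omega))
  · simp

/-- The site modes do not span all functions on the sites. The divergence of a unit vector, however,
lives on the bonds, where the modes are complete. -/
theorem chainDiv_single (hb0 : ∀ x : ℤ, ¬(1 ≤ x ∧ x < n) → b x = 0) {x : ℕ}
    (hx : x ∈ Finset.Icc 1 n) :
    chainDiv a b (Pi.single (x : ℤ) 1) = fun z => ∑ k, N.site k x * N.bond k z := by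
  rw [N.eq_sum_bond (chainDiv a b (Pi.single (x : ℤ) 1)) (fun z hz => by
    rw [chainDiv, hb0 z hz, zero_mul])]
  funext z
  refine Finset.sum_congr rfl fun k _ => ?_
  rw [sum_w_mul_chainDiv, Finset.sum_eq_single x]
  · simp
  · intro y _ hy
    rw [Pi.single_eq_of_ne (by exact_mod_cast hy), mul_zero]
  · intro h
    exact absurd hx h

/-- For a genuine bond this is the spectral formula for a diagonal entry of a power of the
Laplacian. At `x = n` all modes vanish, and so does the Laplacian because `b n = 0`; only the power
`0` differs there. -/
theorem sum_bond_sq_mul_pow (hb0 : ∀ x : ℤ, ¬(1 ≤ x ∧ x < n) → b x = 0) {x : ℕ}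
    (hx : x ∈ Finset.Icc 1 n) (i : ℕ) :
    ∑ k, N.bond k x ^ 2 * N.lam k ^ i =
      (bondLaplacian a b)^[i] (Pi.single (x : ℤ) 1) x - if i = 0 ∧ x = n then 1 else 0 := by
  rw [Finset.mem_Icc] at hx
  rcases hx.2.lt_or_eq with h | h
  · rw [N.single_eq_sum_bond (x := (x : ℤ)) (by omega), iterate_bondLaplacian, if_neg (by omega),
      sub_zero]
    exact Finset.sum_congr rfl fun k _ => by ring
  · have h0 : ∀ k, N.bond k x = 0 := fun k => extendInt_of_not _ (by omega)
    simp only [h0]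
    cases i with
    | zero => simp [h]
    | succ i =>
      rw [Function.iterate_succ_apply', bondLaplacian, chainDiv, hb0 x (by omega)]
      simp

theorem sum_site_sq_mul_pow (hb0 : ∀ x : ℤ, ¬(1 ≤ x ∧ x < n) → b x = 0) {x : ℕ}
    (hx : x ∈ Finset.Icc 1 n) (i : ℕ) :
    ∑ k, N.site k x ^ 2 / N.lam k * N.lam k ^ (i + 1) =
      (siteLaplacian a b)^[i + 1] (Pi.single (x : ℤ) 1) x := by
  -- One factor of the Laplacian is spent on projecting the unit vector onto the span of the site
  -- modes. The exponent therefore starts at `1`.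
  rw [Function.iterate_succ_apply, siteLaplacian, N.chainDiv_single hb0 hx, chainGrad_fun_sum]
  change _ = (siteLaplacian a b)^[i] (fun z => ∑ k, N.site k x * N.site k z) x
  rw [iterate_siteLaplacian]
  refine Finset.sum_congr rfl fun k _ => ?_
  have := (N.lam_pos k).ne'
  field_simp
  ring

/-- The kernel of the divergence is spanned by `1 / a`. -/
theorem sum_site_sq_div (ha : ∀ x ∈ Finset.Icc 1 n, 0 < a (x : ℕ))
    (hb : ∀ x : ℕ, 1 ≤ x → x < n → 0 < b x)
    (hb0 : ∀ x : ℤ, ¬(1 ≤ x ∧ x < n) → b x = 0) {x : ℕ} (hx : x ∈ Finset.Icc 1 n) :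
    ∑ k, N.site k x ^ 2 / N.lam k =
      1 - (a x ^ 2)⁻¹ / ∑ z ∈ Finset.Icc 1 n, (a (z : ℕ) ^ 2)⁻¹ := by
  -- The part of the unit vector at `x` orthogonal to the site modes, whose squared norms are the
  -- `λ_k`. It has zero divergence, so `a u` is constant; pairing with `1/a` determines that
  -- constant.
  let u : ℤ → ℝ := fun z => (Pi.single (x : ℤ) 1 : ℤ → ℝ) z -
    ∑ k, (N.site k x / N.lam k) * N.site k z
  have hdiv : ∀ z, chainDiv a b u z = 0 := by
    intro z
    have h1 : chainDiv a b u z = chainDiv a b (Pi.single (x : ℤ) 1) z -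
        chainDiv a b (fun z => ∑ k, (N.site k x / N.lam k) * N.site k z) z := by
      simp only [chainDiv, u]
      ring
    rw [h1, N.chainDiv_single hb0 hx, chainDiv_fun_sum, sub_eq_zero]
    refine Finset.sum_congr rfl fun k _ => ?_
    have := (N.lam_pos k).ne'
    rw [chainDiv_site]
    field_simp
  have hconst : ∀ z : ℕ, z + 1 ∈ Finset.Icc 1 n → a ((z + 1 : ℕ) : ℤ) * u ((z + 1 : ℕ) : ℤ) =
      a 1 * u 1 := by
    intro z
    induction z with
    | zero => simp
    | succ z ih =>
      intro hz
      rw [Finset.mem_Icc] at hz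
      rw [← ih (Finset.mem_Icc.2 ⟨by omega, by omega⟩)]
      have h1 := hdiv ((z + 1 : ℕ) : ℤ)
      rw [chainDiv] at h1
      have h2 := (mul_eq_zero.1 h1).resolve_left (hb (z + 1) (by omega) (by omega)).ne'
      push_cast at h2 ⊢
      linarith
  have hu : ∀ z ∈ Finset.Icc 1 n, u (z : ℕ) = a 1 * u 1 * (a (z : ℕ))⁻¹ := by
    intro z hz
    have h1 := ha z hz
    rw [Finset.mem_Icc] at hz
    obtain ⟨y, rfl⟩ : ∃ y, z = y + 1 := ⟨z - 1, by omega⟩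
    rw [← hconst y (Finset.mem_Icc.2 hz)]
    field_simp
  -- Dividing a gradient by `a` leaves a telescoping difference with zero ends.
  have horth : ∀ k, ∑ z ∈ Finset.Icc 1 n, N.site k (z : ℕ) * (a (z : ℕ))⁻¹ = 0 := by
    intro k
    have h1 : ∀ z ∈ Finset.Icc 1 n, N.site k (z : ℕ) * (a (z : ℕ))⁻¹ =
        (fun y : ℕ => b y * N.bond k y) (z - 1) - (fun y : ℕ => b y * N.bond k y) z := by
      intro z hz
      have h2 := (ha z hz).ne'
      have e : ((z - 1 : ℕ) : ℤ) = (z : ℤ) - 1 := by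
        rw [Finset.mem_Icc] at hz
        omega
      simp only [site, chainGrad, e]
      field_simp
    rw [Finset.sum_congr rfl h1, sum_Icc_sub (fun y : ℕ => b y * N.bond k y)]
    simp only [hb0 ((0 : ℕ) : ℤ) (by omega), hb0 (n : ℤ) (by omega), zero_mul, sub_zero]
  have hpair : ∑ z ∈ Finset.Icc 1 n, u (z : ℕ) * (a (z : ℕ))⁻¹ = (a x)⁻¹ := by
    simp only [u, sub_mul, Finset.sum_sub_distrib, Finset.sum_mul]
    rw [Finset.sum_comm]
    simp only [mul_assoc, ← Finset.mul_sum, horth]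
    rw [Finset.sum_eq_single x]
    · simp
    · intro y _ hy
      rw [Pi.single_eq_of_ne (by exact_mod_cast hy), zero_mul]
    · intro h
      exact absurd hx h
  have hS : 0 < ∑ z ∈ Finset.Icc 1 n, (a (z : ℕ) ^ 2)⁻¹ :=
    Finset.sum_pos (fun z hz => inv_pos.2 (pow_pos (ha z hz) 2)) ⟨x, hx⟩
  have hax := ha x hx
  have h1 : a 1 * u 1 * ∑ z ∈ Finset.Icc 1 n, (a (z : ℕ) ^ 2)⁻¹ = (a x)⁻¹ := by
    rw [← hpair, Finset.mul_sum]
    refine Finset.sum_congr rfl fun z hz => ?_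
    rw [hu z hz, mul_assoc (a 1 * u 1), ← mul_inv, ← pow_two]
  have h2 := hu x hx
  have h3 : u (x : ℤ) = 1 - ∑ k, N.site k x ^ 2 / N.lam k := by
    simp only [u, Pi.single_eq_same]
    congr 1
    exact Finset.sum_congr rfl fun k _ => by ring
  have h4 : a 1 * u 1 = (a x)⁻¹ / ∑ z ∈ Finset.Icc 1 n, (a (z : ℕ) ^ 2)⁻¹ := by
    rw [← h1, mul_div_assoc, div_self hS.ne', mul_one]
  rw [h4] at h2
  have h5 : ∑ k, N.site k x ^ 2 / N.lam k = 1 - u (x : ℤ) := by rw [h3]; ring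
  rw [h5, h2]
  field_simp

/-- The mode sum of a function of the squared frequencies at a site. -/
noncomputable def modeSum (h : ℝ → ℝ) (x : ℕ) : ℝ :=
  ∑ k, N.site k x ^ 2 / N.lam k * h (N.lam k) + ∑ k, N.bond k x ^ 2 * h (N.lam k)

theorem sum_bond_sq_le (x : ℕ) : ∑ k, N.bond k x ^ 2 ≤ 1 := by
  by_cases h : 1 ≤ x ∧ x < n
  · have := congrFun (N.single_eq_sum_bond (x := (x : ℤ)) (by omega)) x
    simp only [Pi.single_eq_same] at this
    rw [this]
    exact (Finset.sum_congr rfl fun k _ => pow_two _).le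
  · have h0 : ∀ k, N.bond k x = 0 := fun k => extendInt_of_not _ (by omega)
    simp [h0]

/-- `λ_k` is the squared norm of the gradient of a unit vector. The bound `(u - v)² ≤ 2u² + 2v²`
counts each bond twice, whence the factor `4`. The bound is uniform in `n`. -/
theorem lam_le {A B : ℝ} (hA : ∀ x, |a x| ≤ A) (hB : ∀ x, |b x| ≤ B) (k : Fin (n - 1)) :
    N.lam k ≤ 4 * A ^ 2 * B ^ 2 := by
  have h1 := N.gram k k
  rw [if_pos rfl] at h1
  have hn : ∑ x ∈ Finset.Icc 1 n, extendBond (N.w k) x ^ 2 = 1 := by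
    have h2 : ∀ x : ℕ, extendBond (N.w k) x ^ 2 = extendBond (fun j => N.w k j * N.w k j) x := by
      intro x
      by_cases h : 1 ≤ x ∧ x < n
      · obtain ⟨j, rfl⟩ := exists_index h
        simp only [extendBond_succ, pow_two]
      · simp [extendBond_of_not _ h]
    simp only [h2]
    rw [sum_extendBond, N.orthonormal, if_pos rfl]
  have hn' : ∑ x ∈ Finset.Icc 1 n, extendBond (N.w k) (x - 1) ^ 2 = 1 := by
    have h3 := sum_Icc_sub (fun x => extendBond (N.w k) x ^ 2) n
    rw [Finset.sum_sub_distrib, hn, extendBond_of_not _ (by omega),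
      extendBond_of_not _ (by omega)] at h3
    linarith
  have h4 : ∀ x ∈ Finset.Icc 1 n, chainGrad a b (extendInt (N.w k)) (x : ℤ) *
      chainGrad a b (extendInt (N.w k)) (x : ℤ) ≤
      2 * A ^ 2 * B ^ 2 * (extendBond (N.w k) (x - 1) ^ 2 + extendBond (N.w k) x ^ 2) := by
    intro x _
    rw [chainGrad, extendInt_natCast_sub_one, extendInt_natCast]
    set p := extendBond (N.w k) (x - 1)
    set q := extendBond (N.w k) x
    have ha2 : a x ^ 2 ≤ A ^ 2 := sq_le_sq' (abs_le.1 (hA x)).1 (abs_le.1 (hA x)).2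
    have hb2 : ∀ z, b z ^ 2 ≤ B ^ 2 := fun z => sq_le_sq' (abs_le.1 (hB z)).1 (abs_le.1 (hB z)).2
    have h5 : (b (x - 1) * p - b x * q) ^ 2 ≤ 2 * B ^ 2 * (p ^ 2 + q ^ 2) := by
      have h6 := mul_le_mul_of_nonneg_right (hb2 (x - 1)) (sq_nonneg p)
      have h7 := mul_le_mul_of_nonneg_right (hb2 x) (sq_nonneg q)
      nlinarith [sq_nonneg (b (x - 1) * p + b x * q)]
    calc _ = a x ^ 2 * (b (x - 1) * p - b x * q) ^ 2 := by ring
      _ ≤ A ^ 2 * (2 * B ^ 2 * (p ^ 2 + q ^ 2)) :=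
          mul_le_mul ha2 h5 (sq_nonneg _) (sq_nonneg _)
      _ = _ := by ring
  have h8 := Finset.sum_le_sum h4
  rw [h1, ← Finset.mul_sum, Finset.sum_add_distrib, hn, hn'] at h8
  linarith

section bounds

variable (ha : ∀ x ∈ Finset.Icc 1 n, 0 < a (x : ℕ)) (hb : ∀ x : ℕ, 1 ≤ x → x < n → 0 < b x)
  (hb0 : ∀ x : ℤ, ¬(1 ≤ x ∧ x < n) → b x = 0) {x : ℕ} (hx : x ∈ Finset.Icc 1 n)
include ha hb hb0 hx

theorem sum_site_sq_div_le : ∑ k, N.site k x ^ 2 / N.lam k ≤ 1 := by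
  rw [N.sum_site_sq_div ha hb hb0 hx]
  have : 0 ≤ (a x ^ 2)⁻¹ / ∑ z ∈ Finset.Icc 1 n, (a (z : ℕ) ^ 2)⁻¹ :=
    div_nonneg (by positivity) (Finset.sum_nonneg fun z _ => by positivity)
  linarith

/-- Site weights and bond weights are nonnegative and each family has total at most `1`, so a
uniform error on the spectrum is at most doubled. -/
theorem abs_modeSum_sub_le {h g : ℝ → ℝ} {ε : ℝ} (hε : 0 ≤ ε)
    (hgh : ∀ k, |h (N.lam k) - g (N.lam k)| ≤ ε) :
    |N.modeSum h x - N.modeSum g x| ≤ 2 * ε := by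
  have h1 : N.modeSum h x - N.modeSum g x =
      ∑ k, N.site k x ^ 2 / N.lam k * (h (N.lam k) - g (N.lam k)) +
        ∑ k, N.bond k x ^ 2 * (h (N.lam k) - g (N.lam k)) := by
    simp only [modeSum, mul_sub, Finset.sum_sub_distrib]
    ring
  have h2 : ∀ c : Fin (n - 1) → ℝ, (∀ k, 0 ≤ c k) → ∑ k, c k ≤ 1 →
      |∑ k, c k * (h (N.lam k) - g (N.lam k))| ≤ ε := by
    intro c hc hc1
    calc _ ≤ ∑ k, |c k * (h (N.lam k) - g (N.lam k))| := Finset.abs_sum_le_sum_abs _ _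
      _ ≤ ∑ k, c k * ε := Finset.sum_le_sum fun k _ => by
          rw [abs_mul, abs_of_nonneg (hc k)]
          exact mul_le_mul_of_nonneg_left (hgh k) (hc k)
      _ = (∑ k, c k) * ε := by rw [Finset.sum_mul]
      _ ≤ 1 * ε := mul_le_mul_of_nonneg_right hc1 hε
      _ = ε := one_mul ε
  rw [h1]
  refine (abs_add_le _ _).trans ?_
  have h3 := h2 (fun k => N.site k x ^ 2 / N.lam k)
    (fun k => div_nonneg (sq_nonneg _) (N.lam_pos k).le) (N.sum_site_sq_div_le ha hb hb0 hx)
  have h4 := h2 (fun k => N.bond k x ^ 2) (fun k => sq_nonneg _) (N.sum_bond_sq_le x)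
  linarith

end bounds

end NormalModes

/-- The local function of the coefficients given by a polynomial in the Laplacians. -/
noncomputable def localEnergy (p : Polynomial ℝ) (a b : ℤ → ℝ) : ℝ :=
  ∑ i ∈ Finset.range (p.natDegree + 1), p.coeff i *
    ((siteLaplacian a b)^[i] (Pi.single 0 1) 0 + (bondLaplacian a b)^[i] (Pi.single 0 1) 0)

theorem chainGrad_shift (a b u : ℤ → ℝ) (x : ℤ) :
    chainGrad (fun z => a (x + z)) (fun z => b (x + z)) (fun z => u (x + z)) =
      fun z => chainGrad a b u (x + z) := by
  funext z
  simp only [chainGrad, add_sub_assoc]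

theorem chainDiv_shift (a b u : ℤ → ℝ) (x : ℤ) :
    chainDiv (fun z => a (x + z)) (fun z => b (x + z)) (fun z => u (x + z)) =
      fun z => chainDiv a b u (x + z) := by
  funext z
  simp only [chainDiv, add_assoc]

theorem iterate_shift (L : (ℤ → ℝ) → (ℤ → ℝ) → (ℤ → ℝ) → ℤ → ℝ)
    (hL : ∀ a b u (x : ℤ), L (fun z => a (x + z)) (fun z => b (x + z)) (fun z => u (x + z)) =
      fun z => L a b u (x + z)) (a b u : ℤ → ℝ) (x : ℤ) (i : ℕ) :
    (L (fun z => a (x + z)) (fun z => b (x + z)))^[i] (fun z => u (x + z)) =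
      fun z => (L a b)^[i] u (x + z) := by
  induction i with
  | zero => rfl
  | succ i ih => rw [Function.iterate_succ_apply', ih, hL, Function.iterate_succ_apply']

theorem bondLaplacian_shift (a b u : ℤ → ℝ) (x : ℤ) :
    bondLaplacian (fun z => a (x + z)) (fun z => b (x + z)) (fun z => u (x + z)) =
      fun z => bondLaplacian a b u (x + z) := by
  rw [bondLaplacian, chainGrad_shift, chainDiv_shift]
  rfl

theorem siteLaplacian_shift (a b u : ℤ → ℝ) (x : ℤ) :
    siteLaplacian (fun z => a (x + z)) (fun z => b (x + z)) (fun z => u (x + z)) =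
      fun z => siteLaplacian a b u (x + z) := by
  rw [siteLaplacian, chainDiv_shift, chainGrad_shift]
  rfl

theorem localEnergy_shift (p : Polynomial ℝ) (a b : ℤ → ℝ) (x : ℤ) :
    localEnergy p (fun z => a (x + z)) (fun z => b (x + z)) =
      ∑ i ∈ Finset.range (p.natDegree + 1), p.coeff i *
        ((siteLaplacian a b)^[i] (Pi.single x 1) x + (bondLaplacian a b)^[i] (Pi.single x 1) x) := by
  have h1 : (Pi.single 0 1 : ℤ → ℝ) = fun z => (Pi.single x 1 : ℤ → ℝ) (x + z) := by
    funext z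
    simp [Pi.single_apply]
  rw [localEnergy, h1]
  simp only [iterate_shift _ siteLaplacian_shift, iterate_shift _ bondLaplacian_shift, add_zero]

/-- Powers of degree at least `1` are exact diagonal entries of the two Laplacians. The missing site
direction `1/a` and the missing bond `n` affect only the constant coefficient. -/
theorem NormalModes.modeSum_polynomial {n : ℕ} {a b : ℤ → ℝ} (N : NormalModes n a b)
    (ha : ∀ x ∈ Finset.Icc 1 n, 0 < a (x : ℕ)) (hb : ∀ x : ℕ, 1 ≤ x → x < n → 0 < b x)
    (hb0 : ∀ x : ℤ, ¬(1 ≤ x ∧ x < n) → b x = 0) {x : ℕ} (hx : x ∈ Finset.Icc 1 n)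
    (p : Polynomial ℝ) :
    N.modeSum (fun t => p.eval t) x =
      localEnergy p (fun z => a (x + z)) (fun z => b (x + z)) - p.coeff 0 *
        ((a x ^ 2)⁻¹ / ∑ z ∈ Finset.Icc 1 n, (a (z : ℕ) ^ 2)⁻¹ + if x = n then 1 else 0) := by
  have h1 : ∀ c : Fin (n - 1) → ℝ, ∑ k, c k * p.eval (N.lam k) =
      ∑ i ∈ Finset.range (p.natDegree + 1), p.coeff i * ∑ k, c k * N.lam k ^ i := by
    intro c
    simp only [Polynomial.eval_eq_sum_range, Finset.mul_sum]
    rw [Finset.sum_comm]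
    exact Finset.sum_congr rfl fun i _ => Finset.sum_congr rfl fun k _ => by ring
  rw [modeSum, h1, h1, localEnergy_shift, ← Finset.sum_add_distrib, Finset.sum_range_succ',
    Finset.sum_range_succ']
  have h2 : ∀ i, p.coeff (i + 1) * ∑ k, N.site k x ^ 2 / N.lam k * N.lam k ^ (i + 1) +
      p.coeff (i + 1) * ∑ k, N.bond k x ^ 2 * N.lam k ^ (i + 1) =
      p.coeff (i + 1) * ((siteLaplacian a b)^[i + 1] (Pi.single (x : ℤ) 1) x +
        (bondLaplacian a b)^[i + 1] (Pi.single (x : ℤ) 1) x) := by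
    intro i
    rw [N.sum_site_sq_mul_pow hb0 hx, N.sum_bond_sq_mul_pow hb0 hx, if_neg (by omega), sub_zero,
      mul_add]
  have h3 := N.sum_bond_sq_mul_pow hb0 hx 0
  have h4 := N.sum_site_sq_div ha hb hb0 hx
  simp only [pow_zero, mul_one, Function.iterate_zero, id_eq, Pi.single_eq_same, true_and] at h3
  simp only [h2, pow_zero, mul_one, h3, h4, Function.iterate_zero, id_eq, Pi.single_eq_same]
  ring

/-! ### Continuity and locality -/

theorem continuous_chainGrad {X : Type*} [TopologicalSpace X] {a b u : X → ℤ → ℝ}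
    (ha : Continuous a) (hb : Continuous b) (hu : Continuous u) :
    Continuous fun t => chainGrad (a t) (b t) (u t) := by
  rw [continuous_pi_iff] at *
  intro z
  simp only [chainGrad]
  exact (ha z).mul (((hb _).mul (hu _)).sub ((hb _).mul (hu _)))

theorem continuous_chainDiv {X : Type*} [TopologicalSpace X] {a b u : X → ℤ → ℝ}
    (ha : Continuous a) (hb : Continuous b) (hu : Continuous u) :
    Continuous fun t => chainDiv (a t) (b t) (u t) := by
  rw [continuous_pi_iff] at *
  intro z
  simp only [chainDiv]
  exact (hb z).mul (((ha _).mul (hu _)).sub ((ha _).mul (hu _)))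

theorem continuous_localEnergy (p : Polynomial ℝ) :
    Continuous fun t : (ℤ → ℝ) × (ℤ → ℝ) => localEnergy p t.1 t.2 := by
  have h1 : ∀ i, Continuous fun t : (ℤ → ℝ) × (ℤ → ℝ) =>
      (siteLaplacian t.1 t.2)^[i] (Pi.single 0 1) := by
    intro i
    induction i with
    | zero => exact continuous_const
    | succ i ih =>
      simp only [Function.iterate_succ_apply']
      exact continuous_chainGrad continuous_fst continuous_snd
        (continuous_chainDiv continuous_fst continuous_snd ih)
  have h2 : ∀ i, Continuous fun t : (ℤ → ℝ) × (ℤ → ℝ) =>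
      (bondLaplacian t.1 t.2)^[i] (Pi.single 0 1) := by
    intro i
    induction i with
    | zero => exact continuous_const
    | succ i ih =>
      simp only [Function.iterate_succ_apply']
      exact continuous_chainDiv continuous_fst continuous_snd
        (continuous_chainGrad continuous_fst continuous_snd ih)
  exact continuous_finsetSum _ fun i _ => continuous_const.mul
    (((continuous_apply _).comp (h1 i)).add ((continuous_apply _).comp (h2 i)))

/-- Each application of `L` looks one neighbour further, so agreement within radius `r + i` gives
equality of the `i`-th iterates within radius `r`. -/
theorem iterate_congr_window (L : (ℤ → ℝ) → (ℤ → ℝ) → (ℤ → ℝ) → ℤ → ℝ)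
    (hL : ∀ a b a' b' u u' (y : ℤ), (∀ z, |z - y| ≤ 1 → a z = a' z ∧ b z = b' z ∧ u z = u' z) →
      L a b u y = L a' b' u' y) {a b a' b' : ℤ → ℝ} (u : ℤ → ℝ) (i : ℕ) :
    ∀ r : ℕ, (∀ z : ℤ, |z| ≤ r + i → a z = a' z ∧ b z = b' z) → ∀ y : ℤ, |y| ≤ r →
      (L a b)^[i] u y = (L a' b')^[i] u y := by
  induction i with
  | zero => intro r _ y _; rfl
  | succ i ih =>
    intro r h y hy
    rw [Function.iterate_succ_apply', Function.iterate_succ_apply']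
    refine hL _ _ _ _ _ _ _ fun z hz => ?_
    have hz' : |z| ≤ r + 1 := by
      rw [abs_le] at *
      omega
    obtain ⟨h1, h2⟩ := h z (by push_cast; omega)
    exact ⟨h1, h2, ih (r + 1) (fun z hz => h z (by push_cast at *; omega)) z
      (by push_cast; exact hz')⟩

theorem bondLaplacian_congr (a b a' b' u u' : ℤ → ℝ) (y : ℤ)
    (h : ∀ z, |z - y| ≤ 1 → a z = a' z ∧ b z = b' z ∧ u z = u' z) :
    bondLaplacian a b u y = bondLaplacian a' b' u' y := by
  obtain ⟨h1, h2, h3⟩ := h y (by simp)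
  obtain ⟨h4, h5, h6⟩ := h (y + 1) (by simp)
  obtain ⟨h7, h8, h9⟩ := h (y - 1) (by simp)
  simp only [bondLaplacian, chainDiv, chainGrad, add_sub_cancel_right, h1, h2, h3, h4, h5, h6, h8, h9]

theorem siteLaplacian_congr (a b a' b' u u' : ℤ → ℝ) (y : ℤ)
    (h : ∀ z, |z - y| ≤ 1 → a z = a' z ∧ b z = b' z ∧ u z = u' z) :
    siteLaplacian a b u y = siteLaplacian a' b' u' y := by
  obtain ⟨h1, h2, h3⟩ := h y (by simp)
  obtain ⟨h4, h5, h6⟩ := h (y + 1) (by simp)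
  obtain ⟨h7, h8, h9⟩ := h (y - 1) (by simp)
  simp only [siteLaplacian, chainDiv, chainGrad, sub_add_cancel, h1, h2, h3, h4, h6, h7, h8, h9]

/-- `localEnergy p` only depends on the coefficients in a window. -/
theorem localEnergy_congr (p : Polynomial ℝ) {a b a' b' : ℤ → ℝ}
    (h : ∀ z : ℤ, |z| ≤ p.natDegree → a z = a' z ∧ b z = b' z) :
    localEnergy p a b = localEnergy p a' b' := by
  refine Finset.sum_congr rfl fun i hi => ?_
  have hi' : i ≤ p.natDegree := by
    rw [Finset.mem_range] at hi
    omega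
  have h' : ∀ z : ℤ, |z| ≤ ((0 : ℕ) : ℤ) + i → a z = a' z ∧ b z = b' z := fun z hz =>
    h z (by push_cast at hz; omega)
  rw [iterate_congr_window _ siteLaplacian_congr _ i 0 h' 0 (by simp),
    iterate_congr_window _ bondLaplacian_congr _ i 0 h' 0 (by simp)]

/-! ## Approximation of the thermal energy by local functions of the masses -/

/-- `ν / (1 - e^(-ν))` is the inverse of a difference quotient of `1 - e^(-ν)` at `0`, where the
derivative is `1`. -/
theorem tendsto_mul_thermalFactor :
    Tendsto (fun ν => ν * thermalFactor ν) (𝓝[≠] 0) (𝓝 1) := by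
  have h1 : HasDerivAt (fun ν : ℝ => 1 - Real.exp (-ν)) 1 0 := by
    have h := ((Real.hasDerivAt_exp (-0)).comp (0 : ℝ) (hasDerivAt_neg (0 : ℝ))).const_sub 1
    simpa using h
  have h2 := (hasDerivAt_iff_tendsto_slope_zero.1 h1).inv₀ one_ne_zero
  have h3 : Tendsto (fun ν : ℝ => (1 / 2) * (1 + Real.exp (-ν))) (𝓝[≠] 0) (𝓝 1) := by
    have : Continuous fun ν : ℝ => (1 / 2) * (1 + Real.exp (-ν)) := by fun_prop
    have h4 := this.tendsto 0
    simp only [neg_zero, Real.exp_zero] at h4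
    norm_num at h4
    exact h4.mono_left nhdsWithin_le_nhds
  have h5 := h3.mul h2
  rw [inv_one, mul_one] at h5
  refine h5.congr fun ν => ?_
  simp only [thermalFactor, zero_add, neg_zero, Real.exp_zero, sub_self, sub_zero, smul_eq_mul,
    mul_inv, inv_inv]
  ring

/-- The eigenvalues are bounded above uniformly but only known to be positive. Filling in the
classical value `1` at `0` gives a continuous function on a compact interval, to which Weierstrass
applies. -/
theorem continuousOn_update_modeEnergy (C : ℝ) :
    ContinuousOn (Function.update modeEnergy 0 1) (Icc 0 C) := by
  rw [continuousOn_update_iff]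
  constructor
  · intro t ht
    have ht0 : 0 < √t := Real.sqrt_pos.2 (lt_of_le_of_ne ht.1.1 (Ne.symm ht.2))
    refine ContinuousAt.continuousWithinAt ?_
    have h1 : 1 - Real.exp (-√t) ≠ 0 := by
      have := Real.exp_lt_one_iff.2 (neg_lt_zero.2 ht0)
      linarith
    unfold modeEnergy thermalFactor
    have h2 : ContinuousAt (fun t : ℝ => √t) t := Real.continuous_sqrt.continuousAt
    have h3 : ContinuousAt (fun t : ℝ => Real.exp (-√t)) t :=
      Real.continuous_exp.continuousAt.comp h2.neg
    exact h2.mul (continuousAt_const.mul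
      ((continuousAt_const.add h3).div (continuousAt_const.sub h3) h1))
  · intro _
    refine tendsto_mul_thermalFactor.comp
      (tendsto_nhdsWithin_of_tendsto_nhds_of_eventually_within _ ?_ ?_)
    · have := Real.continuous_sqrt.tendsto 0
      rw [Real.sqrt_zero] at this
      exact this.mono_left nhdsWithin_le_nhds
    · filter_upwards [self_mem_nhdsWithin] with t ht
      exact (Real.sqrt_pos.2 (lt_of_le_of_ne ht.1.1 (Ne.symm ht.2))).ne'

theorem exists_polynomial_modeEnergy (C : ℝ) {ε : ℝ} (hε : 0 < ε) :
    ∃ p : Polynomial ℝ, ∀ t ∈ Ioc 0 C, |modeEnergy t - p.eval t| ≤ ε := by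
  obtain ⟨p, hp⟩ := exists_polynomial_near_of_continuousOn 0 C _
    (continuousOn_update_modeEnergy C) ε hε
  refine ⟨p, fun t ht => ?_⟩
  have := hp t ⟨ht.1.le, ht.2⟩
  rw [Function.update_of_ne ht.1.ne'] at this
  rw [abs_sub_comm]
  exact this.le

theorem exists_abs_modeEnergy_le (C : ℝ) : ∃ D, 0 ≤ D ∧ ∀ t ∈ Ioc 0 C, |modeEnergy t| ≤ D := by
  obtain ⟨D, hD⟩ := isCompact_Icc.exists_bound_of_continuousOn (continuousOn_update_modeEnergy C)
  refine ⟨max D 0, le_max_right _ _, fun t ht => ?_⟩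
  have := hD t ⟨ht.1.le, ht.2⟩
  rw [Function.update_of_ne ht.1.ne', Real.norm_eq_abs] at this
  exact this.trans (le_max_left _ _)

/-- Bounds for the inverse temperature at the sites. -/
structure ProfileBounds (β : ℝ → ℝ) (lo hi : ℝ) : Prop where
  lo_pos : 0 < lo
  le : ∀ y ∈ Icc (0 : ℝ) 1, lo ≤ β y
  ge : ∀ y ∈ Icc (0 : ℝ) 1, β y ≤ hi

theorem exists_profileBounds {β : ℝ → ℝ} (hβ : ContinuousOn β (Icc 0 1))
    (hβ_pos : ∀ y ∈ Icc (0 : ℝ) 1, 0 < β y) : ∃ lo hi, ProfileBounds β lo hi := by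
  have hne : (Icc (0 : ℝ) 1).Nonempty := ⟨0, by simp⟩
  obtain ⟨y, hy, hmin⟩ := isCompact_Icc.exists_isMinOn hne hβ
  obtain ⟨z, hz, hmax⟩ := isCompact_Icc.exists_isMaxOn hne hβ
  exact ⟨β y, β z, hβ_pos y hy, fun t ht => hmin ht, fun t ht => hmax ht⟩

theorem natCast_div_mem_Icc {n x : ℕ} (hx : x ≤ n) : (x : ℝ) / n ∈ Icc (0 : ℝ) 1 :=
  ⟨by positivity, div_le_one_of_le₀ (by exact_mod_cast hx) (by positivity)⟩

section approx

variable {β pbar rbar : ℝ → ℝ} {lo hi mmin mmax mbar : ℝ} (hβ : ProfileBounds β lo hi)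
  (hmmin : 0 < mmin) {n : ℕ} {mass : ℕ → ℝ}
  (hm : ∀ x ∈ Finset.Icc 1 n, mass x ∈ Icc mmin mmax)

theorem abs_siteCoef_le (hβ : ProfileBounds β lo hi) (hmmin : 0 < mmin)
    (hm : ∀ x ∈ Finset.Icc 1 n, mass x ∈ Icc mmin mmax) (x : ℤ) :
    |siteCoef n β mass x| ≤ √(hi / mmin) := by
  rw [siteCoef]
  split_ifs with h
  · obtain ⟨y, rfl⟩ : ∃ y : ℕ, x = y := ⟨x.toNat, by omega⟩
    have hy : y ∈ Finset.Icc 1 n := Finset.mem_Icc.2 (by omega)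
    have h1 := natCast_div_mem_Icc (n := n) (x := y) (by omega)
    rw [abs_of_nonneg (Real.sqrt_nonneg _), Int.toNat_natCast, Int.cast_natCast]
    refine Real.sqrt_le_sqrt ?_
    have h2 := hβ.le _ h1
    have h3 := hβ.ge _ h1
    have h4 := hβ.lo_pos
    exact div_le_div₀ (by linarith) h3 hmmin (hm y hy).1
  · simp

theorem abs_bondCoef_le (hβ : ProfileBounds β lo hi) (n : ℕ) (x : ℤ) : |bondCoef n β x| ≤ √hi := by
  rw [bondCoef]
  split_ifs with h
  · obtain ⟨y, rfl⟩ : ∃ y : ℕ, x = y := ⟨x.toNat, by omega⟩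
    rw [abs_of_nonneg (Real.sqrt_nonneg _), Int.cast_natCast]
    exact Real.sqrt_le_sqrt (hβ.ge _ (natCast_div_mem_Icc (by omega)))
  · simp

/-- The share of the site `x` in the total of `m / β`. -/
noncomputable def massShare (n : ℕ) (β : ℝ → ℝ) (mass : ℕ → ℝ) (x : ℕ) : ℝ :=
  mass x / β (x / n) / ∑ z ∈ Finset.Icc 1 n, mass z / β (z / n)

/-- The local approximation of `2 β(x/n) ⟨ẽ_x⟩`. -/
noncomputable def localThermal (p : Polynomial ℝ) (n : ℕ) (β : ℝ → ℝ) (mass : ℕ → ℝ) (x : ℕ) : ℝ :=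
  localEnergy p (fun z => siteCoef n β mass (x + z)) (fun z => bondCoef n β (x + z))

include hβ hmmin hm

theorem exists_modeSum_eq (pbar rbar : ℝ → ℝ) (mbar : ℝ) :
    WellDefined n β pbar rbar mbar mass ∧
    ∃ N : NormalModes n (siteCoef n β mass) (bondCoef n β),
      (∀ k, N.lam k ∈ Ioc 0 (4 * √(hi / mmin) ^ 2 * √hi ^ 2)) ∧
      (∀ x ∈ Finset.Icc 1 n, 2 * β (x / n) * thermalEnergy n β pbar rbar mbar mass x =
        N.modeSum modeEnergy x) ∧
      (∀ x ∈ Finset.Icc 1 n, ∀ h g : ℝ → ℝ, ∀ ε : ℝ, 0 ≤ ε →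
        (∀ t ∈ Ioc 0 (4 * √(hi / mmin) ^ 2 * √hi ^ 2), |h t - g t| ≤ ε) →
        |N.modeSum h x - N.modeSum g x| ≤ 2 * ε) ∧
      ∀ x ∈ Finset.Icc 1 n, ∀ p : Polynomial ℝ, N.modeSum (fun t => p.eval t) x =
        localThermal p n β mass x - p.coeff 0 *
          (massShare n β mass x + if x = n then 1 else 0) := by
  have hm0 : ∀ x ∈ Finset.Icc 1 n, 0 < mass x := fun x hx => hmmin.trans_le (hm x hx).1
  have hβ0 : ∀ x ∈ Finset.Icc 1 n, 0 < β (x / n) := fun x hx =>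
    hβ.lo_pos.trans_le (hβ.le _ (natCast_div_mem_Icc (Finset.mem_Icc.1 hx).2))
  obtain ⟨N⟩ := nonempty_normalModes hm0 hβ0
  obtain ⟨hW, hE⟩ := thermalEnergy_eq N (pbar := pbar) (rbar := rbar) (mbar := mbar) hm0 hβ0
  have ha : ∀ x ∈ Finset.Icc 1 n, 0 < siteCoef n β mass (x : ℕ) := fun x hx => by
    rw [siteCoef_natCast hx]
    exact Real.sqrt_pos.2 (div_pos (hβ0 x hx) (hm0 x hx))
  have hb : ∀ x : ℕ, 1 ≤ x → x < n → 0 < bondCoef n β x := fun x h1 h2 => by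
    rw [bondCoef_natCast ⟨h1, h2⟩]
    exact Real.sqrt_pos.2 (hβ0 x (Finset.mem_Icc.2 ⟨h1, h2.le⟩))
  have hb0 : ∀ x : ℤ, ¬(1 ≤ x ∧ x < n) → bondCoef n β x = 0 := fun x h => if_neg h
  have hlam : ∀ k, N.lam k ∈ Ioc 0 (4 * √(hi / mmin) ^ 2 * √hi ^ 2) := fun k =>
    ⟨N.lam_pos k, N.lam_le (abs_siteCoef_le hβ hmmin hm) (abs_bondCoef_le hβ n) k⟩
  refine ⟨hW, N, hlam, fun x hx => ?_, fun x hx h g ε hε hgh => ?_, fun x hx p => ?_⟩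
  · have := (hβ0 x hx).ne'
    rw [hE x hx, NormalModes.modeSum, ← mul_assoc, mul_one_div_cancel (by positivity), one_mul]
    rfl
  · exact N.abs_modeSum_sub_le ha hb hb0 hx hε fun k => hgh _ (hlam k)
  · have hsq : ∀ z ∈ Finset.Icc 1 n, (siteCoef n β mass (z : ℕ) ^ 2)⁻¹ = mass z / β (z / n) := by
      intro z hz
      rw [siteCoef_natCast hz, Real.sq_sqrt (div_pos (hβ0 z hz) (hm0 z hz)).le, inv_div]
    rw [N.modeSum_polynomial ha hb hb0 hx, hsq x hx, Finset.sum_congr rfl hsq]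
    rfl

theorem wellDefined_of_bounds (pbar rbar : ℝ → ℝ) (mbar : ℝ) :
    WellDefined n β pbar rbar mbar mass := (exists_modeSum_eq hβ hmmin hm pbar rbar mbar).1

theorem abs_thermalEnergy_sub_le {p : Polynomial ℝ} {ε : ℝ} (hε : 0 ≤ ε)
    (hp : ∀ t ∈ Ioc 0 (4 * √(hi / mmin) ^ 2 * √hi ^ 2), |modeEnergy t - p.eval t| ≤ ε)
    {x : ℕ} (hx : x ∈ Finset.Icc 1 n) :
    |2 * β (x / n) * thermalEnergy n β pbar rbar mbar mass x -
      (localThermal p n β mass x - p.coeff 0 *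
        (massShare n β mass x + if x = n then 1 else 0))| ≤ 2 * ε := by
  obtain ⟨_, N, _, h2, h3, h4⟩ := exists_modeSum_eq hβ hmmin hm pbar rbar mbar
  rw [h2 x hx, ← h4 x hx]
  exact h3 x hx _ _ ε hε hp

theorem abs_thermalEnergy_le {D : ℝ} (hD : 0 ≤ D)
    (hp : ∀ t ∈ Ioc 0 (4 * √(hi / mmin) ^ 2 * √hi ^ 2), |modeEnergy t| ≤ D)
    {x : ℕ} (hx : x ∈ Finset.Icc 1 n) :
    |2 * β (x / n) * thermalEnergy n β pbar rbar mbar mass x| ≤ 2 * D := by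
  obtain ⟨_, N, _, h2, h3, _⟩ := exists_modeSum_eq hβ hmmin hm pbar rbar mbar
  rw [h2 x hx]
  have h0 : N.modeSum (fun _ => 0) x = 0 := by simp [NormalModes.modeSum]
  have := h3 x hx modeEnergy (fun _ => 0) D hD (fun t ht => by rw [sub_zero]; exact hp t ht)
  rwa [h0, sub_zero] at this

/-- Every ratio `m_z/β(z/n)` lies between `mmin/hi` and `mmax/lo`, so no site carries more than a
constant over `n` of the total. -/
theorem abs_massShare_le {x : ℕ} (hx : x ∈ Finset.Icc 1 n) :
    |massShare n β mass x| ≤ (mmax / lo) / (mmin / hi) / n := by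
  have hx' := Finset.mem_Icc.1 hx
  have hn : (0 : ℝ) < n := by exact_mod_cast (by omega : 0 < n)
  have h1 : ∀ z ∈ Finset.Icc 1 n, mmin / hi ≤ mass z / β (z / n) ∧
      mass z / β (z / n) ≤ mmax / lo := by
    intro z hz
    have h2 := natCast_div_mem_Icc (Finset.mem_Icc.1 hz).2
    have h3 := hβ.le _ h2
    have h4 := hβ.ge _ h2
    have h5 := hβ.lo_pos
    have h6 := hm z hz
    exact ⟨div_le_div₀ (hmmin.le.trans h6.1) h6.1 (by linarith) h4,
      div_le_div₀ (hmmin.le.trans (h6.1.trans h6.2)) h6.2 h5 h3⟩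
  have hhi : 0 < hi := by
    have h2 := natCast_div_mem_Icc hx'.2
    linarith [hβ.le _ h2, hβ.ge _ h2, hβ.lo_pos]
  have h2 : n * (mmin / hi) ≤ ∑ z ∈ Finset.Icc 1 n, mass z / β (z / n) := by
    have := Finset.card_nsmul_le_sum (Finset.Icc 1 n) _ _ fun z hz => (h1 z hz).1
    simpa using this
  have h3 : 0 < mmin / hi := div_pos hmmin hhi
  have h4 := h1 x hx
  rw [massShare, abs_of_nonneg (div_nonneg (h3.le.trans h4.1)
    ((by positivity : (0 : ℝ) ≤ n * (mmin / hi)).trans h2)), div_div (mmax / lo),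
    mul_comm (mmin / hi)]
  exact div_le_div₀ (h3.le.trans (h4.1.trans h4.2)) h4.2 (by positivity) h2

end approx

/-! ## A law of large numbers for local functions of independent variables -/

theorem subgaussian_mono {Ω : Type*} [MeasurableSpace Ω] {P : Measure Ω} {Y : Ω → ℝ}
    {c d : NNReal} (h : HasSubgaussianMGF Y c P) (hcd : c ≤ d) : HasSubgaussianMGF Y d P where
  integrable_exp_mul := h.integrable_exp_mul
  mgf_le t := (h.mgf_le t).trans (Real.exp_le_exp.2 (by
    have : (c : ℝ) ≤ d := hcd
    have := mul_le_mul_of_nonneg_right this (sq_nonneg t)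
    linarith))

section localFunctions

/-- The σ-algebra generated by the variables `X i`, `i ∈ W`. -/
abbrev windowAlgebra {Ω : Type*} (X : ℕ → Ω → ℝ) (W : Set ℕ) : MeasurableSpace Ω :=
  ⨆ i ∈ W, MeasurableSpace.comap (X i) inferInstance

theorem measurable_windowAlgebra {Ω : Type*} {X : ℕ → Ω → ℝ} {Φ : (ℕ → ℝ) → ℝ} (hΦ : Measurable Φ) {W : Set ℕ}
    (hloc : ∀ ξ ξ' : ℕ → ℝ, (∀ i ∈ W, ξ i = ξ' i) → Φ ξ = Φ ξ') :
    Measurable[windowAlgebra X W] fun v => Φ (fun i => X i v) := by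
  classical
  -- Locality allows the coordinates outside `W` to be replaced by `0`, which exhibits the
  -- dependence on the variables in `W` alone.
  have h1 : (fun v => Φ (fun i => X i v)) = fun v => Φ (fun i => if i ∈ W then X i v else 0) := by
    funext v
    exact hloc _ _ fun i hi => by rw [if_pos hi]
  rw [h1]
  refine Measurable.comp hΦ (@measurable_pi_lambda _ _ _ (windowAlgebra X W) _ _ fun i => ?_)
  by_cases hi : i ∈ W
  · simp only [if_pos hi]
    exact Measurable.mono (comap_measurable (X i))
      (le_iSup₂ (f := fun (i : ℕ) (_ : i ∈ W) => MeasurableSpace.comap (X i) inferInstance) i hi)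
      le_rfl
  · simp only [if_neg hi]
    exact measurable_const

variable {Ω : Type*} [MeasurableSpace Ω] {P : Measure Ω} {X : ℕ → Ω → ℝ}

/-- Disjoint windows make a new summand independent of the sum of the previous ones, so the
sub-Gaussian parameters add. -/
theorem subgaussian_sum_of_separated (hX : ∀ i, Measurable (X i)) (hind : iIndepFun X P)
    {W : ℕ → Set ℕ} {Y : ℕ → Ω → ℝ} (hY : ∀ x, Measurable[windowAlgebra X (W x)] (Y x))
    {c : NNReal} (hc : ∀ x, HasSubgaussianMGF (Y x) c P) (s : Finset ℕ)
    (hs : ∀ x ∈ s, ∀ y ∈ s, x ≠ y → Disjoint (W x) (W y)) :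
    HasSubgaussianMGF (fun v => ∑ x ∈ s, Y x v) (s.card * c) P := by
  have hP : IsProbabilityMeasure P := hind.isProbabilityMeasure
  induction s using Finset.induction_on with
  | empty => simp
  | insert x s hx ih =>
    simp only [Finset.sum_insert hx, Finset.card_insert_of_notMem hx]
    have h1 := ih fun y hy z hz => hs y (Finset.mem_insert_of_mem hy) z (Finset.mem_insert_of_mem hz)
    have h2 : Measurable[windowAlgebra X (⋃ y ∈ s, W y)] fun v => ∑ y ∈ s, Y y v := by
      refine Finset.measurable_sum s fun y hy => (hY y).mono ?_ le_rfl
      exact biSup_mono fun i hi => Set.mem_biUnion hy hi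
    have h3 : Indep (windowAlgebra X (W x)) (windowAlgebra X (⋃ y ∈ s, W y)) P := by
      refine indep_iSup_of_disjoint (fun i => (hX i).comap_le) hind ?_
      rw [Set.disjoint_iUnion₂_right]
      exact fun y hy => hs x (Finset.mem_insert_self _ _) y (Finset.mem_insert_of_mem hy)
        (fun h => hx (h ▸ hy))
    have h4 : IndepFun (Y x) (fun v => ∑ y ∈ s, Y y v) P := by
      rw [IndepFun_iff_Indep]
      exact indep_of_indep_of_le h3 (hY x).comap_le h2.comap_le
    have h5 := (hc x).add_of_indepFun h1 h4
    refine subgaussian_mono h5 (le_of_eq ?_)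
    push_cast
    ring

/-- An exponential bound for sums of centred bounded local functions. -/
theorem measureReal_sum_ge_le (hX : ∀ i, Measurable (X i)) (hind : iIndepFun X P)
    (K : ℕ) {Φ : ℕ → (ℕ → ℝ) → ℝ} (hΦ : ∀ x, Measurable (Φ x))
    (hloc : ∀ x ξ ξ', (∀ i, x ≤ i + K → i ≤ x + K → ξ i = ξ' i) → Φ x ξ = Φ x ξ')
    {C : ℝ} (hC0 : 0 < C) (hC : ∀ x, ∀ᵐ v ∂P, |Φ x (fun i => X i v)| ≤ C) {n : ℕ} (hn : 0 < n)
    {ε : ℝ} (hε : 0 < ε) :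
    P.real {v | n * ε ≤ |∑ x ∈ Finset.Icc 1 n,
        (Φ x (fun i => X i v) - ∫ u, Φ x (fun i => X i u) ∂P)|} ≤
      (2 * K + 1) * (2 * Real.exp (-(ε ^ 2 / (2 * (2 * K + 1) ^ 2 * C ^ 2)) * n)) := by
  have hP : IsProbabilityMeasure P := hind.isProbabilityMeasure
  have hXm : Measurable fun v i => X i v := measurable_pi_lambda _ hX
  let W : ℕ → Set ℕ := fun x => {i | x ≤ i + K ∧ i ≤ x + K}
  let Y : ℕ → Ω → ℝ := fun x v => Φ x (fun i => X i v) - ∫ u, Φ x (fun i => X i u) ∂P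
  -- Hoeffding's parameter for a variable with values in `[-C, C]`: the square of the half-width,
  -- that is `C²`.
  let c : NNReal := (‖C - -C‖₊ / 2) ^ 2
  have hcC : (c : ℝ) = C ^ 2 := by
    simp only [c, NNReal.coe_pow, NNReal.coe_div, coe_nnnorm, NNReal.coe_ofNat, Real.norm_eq_abs]
    rw [abs_of_pos (by linarith)]
    ring
  have hYc : ∀ x, HasSubgaussianMGF (Y x) c P := fun x =>
    hasSubgaussianMGF_of_mem_Icc ((hΦ x).comp hXm).aemeasurable
      ((hC x).mono fun v hv => abs_le.1 hv)
  have hYm : ∀ x, Measurable[windowAlgebra X (W x)] (Y x) := fun x =>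
    (measurable_windowAlgebra (W := W x) (hΦ x) fun ξ ξ' h =>
      hloc x ξ ξ' fun i h1 h2 => h i (show i ∈ W x from ⟨h1, h2⟩)).sub
      measurable_const
  -- Distinct sites in one residue class modulo `L` are at least `2K + 1` apart, so their windows of
  -- radius `K` are disjoint.
  let L : ℕ := 2 * K + 1
  let s : ℕ → Finset ℕ := fun r => (Finset.Icc 1 n).filter fun x => x % L = r
  have hcard : ∀ r, (s r).card ≤ n := fun r =>
    (Finset.card_filter_le _ _).trans (by simp)
  have hsub : ∀ r, HasSubgaussianMGF (fun v => ∑ x ∈ s r, Y x v) (n * c) P := by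
    intro r
    refine subgaussian_mono (subgaussian_sum_of_separated hX hind hYm hYc (s r) ?_) ?_
    · intro x hx y hy hxy
      rw [Finset.mem_filter] at hx hy
      rw [Set.disjoint_left]
      rintro i ⟨h1, h2⟩ ⟨h3, h4⟩
      have h5 : x % L = y % L := hx.2.trans hy.2.symm
      rcases lt_or_gt_of_ne hxy with h | h
      · have h6 := (Nat.modEq_iff_dvd' h.le).1 h5
        have := Nat.le_of_dvd (by omega) h6
        omega
      · have h6 := (Nat.modEq_iff_dvd' h.le).1 h5.symm
        have := Nat.le_of_dvd (by omega) h6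
        omega
    · gcongr
      exact_mod_cast hcard r
  have hL : (0 : ℝ) < L := by positivity
  have hn' : (0 : ℝ) < n := by exact_mod_cast hn
  have hδ : 0 ≤ n * ε / L := by positivity
  have hbound : ∀ r, P.real {v | n * ε / L ≤ |∑ x ∈ s r, Y x v|} ≤
      2 * Real.exp (-(ε ^ 2 / (2 * (2 * K + 1) ^ 2 * C ^ 2)) * n) := by
    intro r
    have h1 := (hsub r).measure_ge_le hδ
    have h2 := (hsub r).neg.measure_ge_le hδ
    have h3 : -(n * ε / L) ^ 2 / (2 * ((n * c : NNReal) : ℝ)) =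
        -(ε ^ 2 / (2 * (2 * K + 1) ^ 2 * C ^ 2)) * n := by
      have : (L : ℝ) = 2 * K + 1 := by simp [L]
      rw [NNReal.coe_mul, NNReal.coe_natCast, hcC, this]
      field_simp
    rw [h3] at h1 h2
    have h4 : {v | n * ε / L ≤ |∑ x ∈ s r, Y x v|} ⊆
        {v | n * ε / L ≤ ∑ x ∈ s r, Y x v} ∪ {v | n * ε / L ≤ (-fun v => ∑ x ∈ s r, Y x v) v} := by
      intro v hv
      rcases le_abs.1 (show n * ε / L ≤ |∑ x ∈ s r, Y x v| from hv) with h | h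
      · exact Or.inl h
      · exact Or.inr h
    calc _ ≤ _ := measureReal_mono h4
      _ ≤ _ := measureReal_union_le _ _
      _ ≤ _ := by linarith
  have hsum : ∀ v, ∑ x ∈ Finset.Icc 1 n, Y x v = ∑ r ∈ Finset.range L, ∑ x ∈ s r, Y x v := by
    intro v
    exact (Finset.sum_fiberwise_of_maps_to
      (fun x _ => Finset.mem_range.2 (Nat.mod_lt x (by omega))) _).symm
  -- If the total deviates by `n ε`, at least one of the `L` classes deviates by `n ε / L`; a union
  -- bound over the classes follows.
  have hsubset : {v | n * ε ≤ |∑ x ∈ Finset.Icc 1 n, Y x v|} ⊆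
      ⋃ r ∈ Finset.range L, {v | n * ε / L ≤ |∑ x ∈ s r, Y x v|} := by
    intro v hv
    rw [Set.mem_ofPred_eq, hsum] at hv
    by_contra hcon
    simp only [Set.mem_iUnion, Set.mem_ofPred_eq, not_exists, not_le] at hcon
    have h1 : |∑ r ∈ Finset.range L, ∑ x ∈ s r, Y x v| < n * ε := by
      calc _ ≤ ∑ r ∈ Finset.range L, |∑ x ∈ s r, Y x v| := Finset.abs_sum_le_sum_abs _ _
        _ < ∑ r ∈ Finset.range L, n * ε / L :=
            Finset.sum_lt_sum_of_nonempty ⟨0, Finset.mem_range.2 (by omega)⟩ hcon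
        _ = n * ε := by
            rw [Finset.sum_const, Finset.card_range, nsmul_eq_mul]
            field_simp
    linarith
  calc _ ≤ P.real (⋃ r ∈ Finset.range L, {v | n * ε / L ≤ |∑ x ∈ s r, Y x v|}) :=
        measureReal_mono hsubset (measure_ne_top _ _)
    _ ≤ ∑ r ∈ Finset.range L, P.real {v | n * ε / L ≤ |∑ x ∈ s r, Y x v|} :=
        measureReal_biUnion_finset_le _ _
    _ ≤ ∑ r ∈ Finset.range L, 2 * Real.exp (-(ε ^ 2 / (2 * (2 * K + 1) ^ 2 * C ^ 2)) * n) :=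
        Finset.sum_le_sum fun r _ => hbound r
    _ = _ := by
        rw [Finset.sum_const, Finset.card_range, nsmul_eq_mul]
        simp [L]

/-- A strong law of large numbers for triangular arrays of bounded local functions of independent
variables. -/
theorem ae_tendsto_average_sub_integral (hX : ∀ i, Measurable (X i)) (hind : iIndepFun X P)
    (K : ℕ) {Φ : ℕ → ℕ → (ℕ → ℝ) → ℝ} (hΦ : ∀ n x, Measurable (Φ n x))
    (hloc : ∀ n x ξ ξ', (∀ i, x ≤ i + K → i ≤ x + K → ξ i = ξ' i) → Φ n x ξ = Φ n x ξ')
    {C : ℝ} (hC : ∀ n x, ∀ᵐ v ∂P, |Φ n x (fun i => X i v)| ≤ C) :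
    ∀ᵐ v ∂P, Tendsto (fun n : ℕ => (1 / (n : ℝ)) * ∑ x ∈ Finset.Icc 1 n,
      (Φ n x (fun i => X i v) - ∫ u, Φ n x (fun i => X i u) ∂P)) atTop (𝓝 0) := by
  have hP : IsProbabilityMeasure P := hind.isProbabilityMeasure
  let S : ℕ → Ω → ℝ := fun n v => ∑ x ∈ Finset.Icc 1 n,
      (Φ n x (fun i => X i v) - ∫ u, Φ n x (fun i => X i u) ∂P)
  let C' : ℝ := max C 1
  have hC0 : 0 < C' := lt_max_of_lt_right one_pos
  have hC' : ∀ n x, ∀ᵐ v ∂P, |Φ n x (fun i => X i v)| ≤ C' := fun n x =>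
    (hC n x).mono fun v hv => hv.trans (le_max_left _ _)
  -- Borel–Cantelli for each tolerance `1/(k + 1)`; countably many tolerances leave a single null
  -- set.
  have h1 : ∀ k : ℕ, ∀ᵐ v ∂P, ∀ᶠ n : ℕ in atTop, |S n v| < n * (1 / ((k : ℝ) + 1)) := by
    intro k
    set ε : ℝ := 1 / ((k : ℝ) + 1)
    have hε : 0 < ε := by positivity
    set q : ℝ := ε ^ 2 / (2 * (2 * K + 1) ^ 2 * C' ^ 2)
    have hq : 0 < q := by positivity
    let E : ℕ → Set Ω := fun n => {v | 0 < n ∧ n * ε ≤ |S n v|}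
    have hE : ∀ n, P (E n) ≤ ENNReal.ofReal ((2 * K + 1) * (2 * Real.exp (-q * n))) := by
      intro n
      rcases Nat.eq_zero_or_pos n with rfl | hn
      · simp [E]
      · have h2 := measureReal_sum_ge_le hX hind K (hΦ n) (hloc n) hC0 (hC' n) hn hε
        rw [← ofReal_measureReal]
        refine ENNReal.ofReal_le_ofReal (le_trans (measureReal_mono ?_) h2)
        exact fun v hv => hv.2
    have hsum : Summable fun n : ℕ => (2 * (K : ℝ) + 1) * (2 * Real.exp (-q * n)) := by
      have h3 : Summable fun n : ℕ => Real.exp (-q) ^ n :=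
        summable_geometric_of_lt_one (Real.exp_pos _).le (Real.exp_lt_one_iff.2 (by linarith))
      refine ((h3.mul_left 2).mul_left (2 * (K : ℝ) + 1)).congr fun n => ?_
      rw [← Real.exp_nat_mul, mul_comm (n : ℝ)]
    have h4 := ae_eventually_notMem (μ := P) (s := E)
      (ne_top_of_le_ne_top hsum.tsum_ofReal_ne_top (ENNReal.tsum_le_tsum hE))
    filter_upwards [h4] with v hv
    filter_upwards [hv, eventually_gt_atTop 0] with n hn hn0
    by_contra hcon
    exact hn ⟨hn0, not_lt.1 hcon⟩
  rw [← ae_all_iff] at h1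
  filter_upwards [h1] with v hv
  rw [Metric.tendsto_atTop']
  intro ε hε
  obtain ⟨k, hk⟩ := exists_nat_one_div_lt hε
  obtain ⟨N, hN⟩ := eventually_atTop.1 (hv k)
  refine ⟨max N 1, fun n hn => ?_⟩
  have h2 := hN n ((le_max_left _ _).trans hn.le)
  have hn0 : (0 : ℝ) < n := by exact_mod_cast lt_of_le_of_lt (Nat.zero_le _) hn
  rw [Real.dist_eq, sub_zero, abs_mul, abs_of_pos (by positivity)]
  calc 1 / (n : ℝ) * |S n v| < 1 / (n : ℝ) * (n * (1 / ((k : ℝ) + 1))) :=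
        mul_lt_mul_of_pos_left h2 (by positivity)
    _ = 1 / ((k : ℝ) + 1) := by field_simp
    _ < ε := hk

end localFunctions

/-! ## Expectations of the local approximations -/

/-- The admissible coefficients form a product of compact intervals, compact by Tychonoff, on which
`localEnergy p` is continuous. -/
theorem exists_abs_localEnergy_le (p : Polynomial ℝ) (A B : ℝ) :
    ∃ C, ∀ a b : ℤ → ℝ, (∀ z, |a z| ≤ A) → (∀ z, |b z| ≤ B) → |localEnergy p a b| ≤ C := by
  have hK : IsCompact ((Set.univ.pi fun _ : ℤ => Icc (-A) A) ×ˢ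
      (Set.univ.pi fun _ : ℤ => Icc (-B) B)) :=
    (isCompact_univ_pi fun _ => isCompact_Icc).prod (isCompact_univ_pi fun _ => isCompact_Icc)
  obtain ⟨C, hC⟩ := hK.exists_bound_of_continuousOn (continuous_localEnergy p).continuousOn
  exact ⟨C, fun a b ha hb => hC (a, b)
    ⟨fun z _ => abs_le.1 (ha z), fun z _ => abs_le.1 (hb z)⟩⟩

section

variable {Ω : Type*} [MeasurableSpace Ω]

theorem measurable_localEnergy (p : Polynomial ℝ) {a b : Ω → ℤ → ℝ}
    (ha : ∀ z, Measurable fun v => a v z) (hb : ∀ z, Measurable fun v => b v z) :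
    Measurable fun v => localEnergy p (a v) (b v) :=
  (continuous_localEnergy p).measurable.comp
    ((measurable_pi_lambda _ ha).prodMk (measurable_pi_lambda _ hb))

theorem measurable_localThermal {m : ℕ → Ω → ℝ} (hm : ∀ x, 1 ≤ x → Measurable (m x))
    (p : Polynomial ℝ) (n : ℕ) (β : ℝ → ℝ) (x : ℕ) :
    Measurable fun v => localThermal p n β (fun z => m z v) x := by
  refine measurable_localEnergy p (fun z => ?_) fun z => measurable_const
  by_cases h : 1 ≤ (x + z : ℤ) ∧ (x + z : ℤ) ≤ n
  · simp only [siteCoef, if_pos h]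
    exact Real.continuous_sqrt.measurable.comp (measurable_const.div (hm _ (by omega)))
  · simp only [siteCoef, if_neg h]
    exact measurable_const

theorem measurable_massShare {m : ℕ → Ω → ℝ} (hm : ∀ x, 1 ≤ x → Measurable (m x))
    (n : ℕ) (β : ℝ → ℝ) {x : ℕ} (hx : 1 ≤ x) :
    Measurable fun v => massShare n β (fun z => m z v) x :=
  ((hm x hx).div_const _).div (Finset.measurable_sum _ fun z hz =>
    (hm z (Finset.mem_Icc.1 hz).1).div_const _)

end

theorem localThermal_congr (p : Polynomial ℝ) (n : ℕ) (β : ℝ → ℝ) (x : ℕ) {mass mass' : ℕ → ℝ}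
    (h : ∀ i, 1 ≤ i → x ≤ i + p.natDegree → i ≤ x + p.natDegree → mass i = mass' i) :
    localThermal p n β mass x = localThermal p n β mass' x := by
  refine localEnergy_congr p fun z hz => ⟨?_, rfl⟩
  rw [abs_le] at hz
  simp only [siteCoef]
  split_ifs with h1
  · rw [h _ (by omega) (by omega) (by omega)]
  · rfl

/-- The local energy in a window in the bulk, with inverse temperatures `ρ` and masses `ξ`. -/
noncomputable def windowEnergy (p : Polynomial ℝ) (ρ : ℤ → ℝ) (ξ : ℕ → ℝ) : ℝ :=
  localEnergy p
    (fun z => if |z| ≤ p.natDegree then √(ρ z / ξ (z + p.natDegree).toNat) else 0)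
    (fun z => if |z| ≤ p.natDegree then √(ρ z) else 0)

/-- In the bulk the window meets neither end of the chain, so the boundary conventions disappear and
the masses may be relabelled from the left edge of the window. -/
theorem localThermal_eq_windowEnergy (p : Polynomial ℝ) {n : ℕ} (β : ℝ → ℝ) {x : ℕ} (mass : ℕ → ℝ)
    (h1 : p.natDegree < x) (h2 : x + p.natDegree < n) :
    localThermal p n β mass x =
      windowEnergy p (fun z => β (((x : ℝ) + z) / n)) (fun i => mass (x - p.natDegree + i)) := by
  refine localEnergy_congr p fun z hz => ?_
  rw [if_pos hz, if_pos hz]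
  rw [abs_le] at hz
  have e : x - p.natDegree + (z + p.natDegree).toNat = (x + z : ℤ).toNat := by omega
  rw [siteCoef, bondCoef, if_pos (by omega), if_pos (by omega), ← e]
  push_cast
  exact ⟨rfl, rfl⟩

theorem continuous_windowEnergy (p : Polynomial ℝ) (ξ : ℕ → ℝ) :
    Continuous fun ρ => windowEnergy p ρ ξ := by
  have h1 : Continuous fun (ρ : ℤ → ℝ) (z : ℤ) =>
      if |z| ≤ p.natDegree then √(ρ z / ξ (z + p.natDegree).toNat) else 0 := by
    refine continuous_pi fun z => ?_
    by_cases hz : |z| ≤ p.natDegree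
    · simp only [if_pos hz]
      exact Real.continuous_sqrt.comp ((continuous_apply z).div_const _)
    · simp only [if_neg hz]
      exact continuous_const
  have h2 : Continuous fun (ρ : ℤ → ℝ) (z : ℤ) => if |z| ≤ p.natDegree then √(ρ z) else 0 := by
    refine continuous_pi fun z => ?_
    by_cases hz : |z| ≤ p.natDegree
    · simp only [if_pos hz]
      exact Real.continuous_sqrt.comp (continuous_apply z)
    · simp only [if_neg hz]
      exact continuous_const
  exact (continuous_localEnergy p).comp (h1.prodMk h2)

theorem measurable_windowEnergy (p : Polynomial ℝ) (ρ : ℤ → ℝ) : Measurable (windowEnergy p ρ) := by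
  refine measurable_localEnergy p (fun z => ?_) fun z => measurable_const
  split_ifs
  · exact Real.continuous_sqrt.measurable.comp (measurable_const.div (measurable_pi_apply _))
  · exact measurable_const

theorem tendsto_floor_mul_add_div (y : ℝ) (hy : 0 ≤ y) (z : ℝ) :
    Tendsto (fun n : ℕ => ((⌊(n : ℝ) * y⌋₊ : ℝ) + z) / n) atTop (𝓝 y) := by
  have h1 : Tendsto (fun n : ℕ => (⌊y * (n : ℝ)⌋₊ : ℝ) / n) atTop (𝓝 y) :=
    (tendsto_nat_floor_mul_div_atTop hy).comp tendsto_natCast_atTop_atTop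
  have h2 : Tendsto (fun n : ℕ => z / (n : ℝ)) atTop (𝓝 0) :=
    tendsto_const_nhds.div_atTop tendsto_natCast_atTop_atTop
  have h3 := h1.add h2
  rw [add_zero] at h3
  refine h3.congr fun n => ?_
  rw [mul_comm, add_div]

theorem eventually_floor_bulk {y : ℝ} (hy : y ∈ Ioo (0 : ℝ) 1) (K : ℕ) :
    ∀ᶠ n : ℕ in atTop, K < ⌊(n : ℝ) * y⌋₊ ∧ ⌊(n : ℝ) * y⌋₊ + K < n := by
  have h1 : Tendsto (fun n : ℕ => (n : ℝ) * y) atTop atTop :=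
    tendsto_natCast_atTop_atTop.atTop_mul_const hy.1
  have h2 : Tendsto (fun n : ℕ => (n : ℝ) * (1 - y)) atTop atTop :=
    tendsto_natCast_atTop_atTop.atTop_mul_const (sub_pos.2 hy.2)
  filter_upwards [h1.eventually_ge_atTop ((K : ℝ) + 1), h2.eventually_gt_atTop (K : ℝ)] with n h3 h4
  constructor
  · have : K + 1 ≤ ⌊(n : ℝ) * y⌋₊ := Nat.le_floor (by push_cast; exact h3)
    omega
  · have h5 := Nat.floor_le (a := (n : ℝ) * y) (by nlinarith [hy.1, (Nat.cast_nonneg n : (0 : ℝ) ≤ n)])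
    have : ((⌊(n : ℝ) * y⌋₊ + K : ℕ) : ℝ) < n := by push_cast; linarith
    exact_mod_cast this

section expectation

variable {Ω : Type*} [MeasurableSpace Ω] {P : Measure Ω} {X : ℕ → Ω → ℝ}

/-- An i.i.d. sequence is stationary. -/
theorem integral_comp_shift (hX : ∀ i, Measurable (X i)) (hind : iIndepFun X P)
    (hlaw : ∀ i, P.map (X i) = P.map (X 0)) {Φ : (ℕ → ℝ) → ℝ} (hΦ : Measurable Φ) (s : ℕ) :
    ∫ v, Φ (fun i => X (s + i) v) ∂P = ∫ v, Φ (fun i => X i v) ∂P := by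
  have h1 := hind.map_fun_eq_infinitePi_map hX
  have h2 := (hind.precomp (add_right_injective s)).map_fun_eq_infinitePi_map
    (fun i => hX (s + i))
  -- By independence both laws are infinite products of the marginals, which are all equal.
  have h3 : P.map (fun v i => X (s + i) v) = P.map (fun v i => X i v) := by
    rw [h1]
    refine h2.trans ?_
    congr 1
    funext i
    exact (hlaw _).trans (hlaw _).symm
  have h4 : ∫ v, Φ (fun i => X (s + i) v) ∂P = ∫ ξ, Φ ξ ∂(P.map (fun v i => X (s + i) v)) :=
    (integral_map (measurable_pi_lambda _ fun i => hX (s + i)).aemeasurable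
      hΦ.aestronglyMeasurable).symm
  have h5 : ∫ v, Φ (fun i => X i v) ∂P = ∫ ξ, Φ ξ ∂(P.map (fun v i => X i v)) :=
    (integral_map (measurable_pi_lambda _ hX).aemeasurable hΦ.aestronglyMeasurable).symm
  rw [h4, h5, h3]

/-- After a shift of the window to the origin only the inverse temperatures depend on `n`. They
converge to the constant `β y`, and continuity and boundedness of the window energy allow dominated
convergence. -/
theorem exists_tendsto_integral_localThermal {β : ℝ → ℝ} {lo hi mmin mmax : ℝ}
    (hβ : ProfileBounds β lo hi) (hβc : ContinuousOn β (Icc 0 1)) (hmmin : 0 < mmin)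
    (hX : ∀ i, Measurable (X i)) (hind : iIndepFun X P)
    (hlaw : ∀ i, P.map (X i) = P.map (X 0)) (hgood : ∀ᵐ v ∂P, ∀ i, X i v ∈ Icc mmin mmax)
    {m : ℕ → Ω → ℝ} (hm : ∀ i, m (i + 1) = X i) (p : Polynomial ℝ) {y : ℝ}
    (hy : y ∈ Ioo (0 : ℝ) 1) :
    ∃ l, Tendsto (fun n : ℕ => ∫ v, localThermal p n β (fun z => m z v) ⌊(n : ℝ) * y⌋₊ ∂P)
      atTop (𝓝 l) := by
  have hP : IsProbabilityMeasure P := hind.isProbabilityMeasure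
  let ρ : ℕ → ℤ → ℝ := fun n z => β (((⌊(n : ℝ) * y⌋₊ : ℝ) + z) / n)
  obtain ⟨C, hC⟩ := exists_abs_localEnergy_le p √(hi / mmin) √hi
  have hρ : Tendsto ρ atTop (𝓝 fun _ => β y) := by
    rw [tendsto_pi_nhds]
    intro z
    have h1 : ContinuousAt β y := hβc.continuousAt (Icc_mem_nhds hy.1 hy.2)
    exact h1.tendsto.comp (tendsto_floor_mul_add_div y hy.1.le z)
  refine ⟨∫ v, windowEnergy p (fun _ => β y) (fun i => X i v) ∂P, ?_⟩
  have h1 : Tendsto (fun n : ℕ => ∫ v, windowEnergy p (ρ n) (fun i => X i v) ∂P) atTop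
      (𝓝 (∫ v, windowEnergy p (fun _ => β y) (fun i => X i v) ∂P)) := by
    refine tendsto_integral_filter_of_dominated_convergence (fun _ => C) ?_ ?_
      (integrable_const _) ?_
    · exact Eventually.of_forall fun n =>
        ((measurable_windowEnergy p (ρ n)).comp (measurable_pi_lambda _ hX)).aestronglyMeasurable
    · filter_upwards [eventually_floor_bulk hy p.natDegree] with n hn
      filter_upwards [hgood] with v hv
      have h2 : ∀ z : ℤ, |z| ≤ p.natDegree → ρ n z ∈ Icc lo hi := by
        intro z hz
        rw [abs_le] at hz
        have h3 := natCast_div_mem_Icc (n := n) (x := (⌊(n : ℝ) * y⌋₊ + z : ℤ).toNat) (by omega)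
        have h4 : (((⌊(n : ℝ) * y⌋₊ + z : ℤ).toNat : ℕ) : ℝ) = (⌊(n : ℝ) * y⌋₊ : ℝ) + z := by
          have : (((⌊(n : ℝ) * y⌋₊ + z : ℤ).toNat : ℕ) : ℤ) = (⌊(n : ℝ) * y⌋₊ : ℤ) + z := by omega
          exact_mod_cast congrArg (fun t : ℤ => (t : ℝ)) this
        rw [h4] at h3
        exact ⟨hβ.le _ h3, hβ.ge _ h3⟩
      refine hC _ _ (fun z => ?_) fun z => ?_
      · split_ifs with hz
        · rw [abs_of_nonneg (Real.sqrt_nonneg _)]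
          refine Real.sqrt_le_sqrt ?_
          have h5 := h2 z hz
          exact div_le_div₀ (hβ.lo_pos.le.trans (h5.1.trans h5.2)) h5.2 hmmin (hv _).1
        · simp
      · split_ifs with hz
        · rw [abs_of_nonneg (Real.sqrt_nonneg _)]
          exact Real.sqrt_le_sqrt (h2 z hz).2
        · simp
    · exact Eventually.of_forall fun v =>
        ((continuous_windowEnergy p fun i => X i v).tendsto _).comp hρ
  refine h1.congr' ?_
  filter_upwards [eventually_floor_bulk hy p.natDegree] with n hn
  simp only [localThermal_eq_windowEnergy p β _ hn.1 hn.2]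
  -- The extra `- 1` in the shift comes from numbering the masses from `1` and the variables `X`
  -- from `0`.
  rw [← integral_comp_shift hX hind hlaw (measurable_windowEnergy p (ρ n))
    (⌊(n : ℝ) * y⌋₊ - p.natDegree - 1)]
  refine integral_congr_ae (Eventually.of_forall fun v => ?_)
  have e : (fun i => X (⌊(n : ℝ) * y⌋₊ - p.natDegree - 1 + i) v) =
      fun i => m (⌊(n : ℝ) * y⌋₊ - p.natDegree + i) v := by
    funext i
    rw [← hm]
    congr 1
    omega
  simp only [e, ρ]

end expectation

/-! ### Limits of sequences through uniform approximation -/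

theorem exists_tendsto_of_approx {u : ℕ → ℝ}
    (h : ∀ ε > 0, ∃ v : ℕ → ℝ, (∃ l, Tendsto v atTop (𝓝 l)) ∧ ∀ᶠ n in atTop, |u n - v n| ≤ ε) :
    ∃ l, Tendsto u atTop (𝓝 l) := by
  refine cauchySeq_tendsto_of_complete ?_
  rw [Metric.cauchySeq_iff']
  intro ε hε
  obtain ⟨v, ⟨l, hl⟩, hv⟩ := h (ε / 5) (by positivity)
  have h1 := (Metric.tendsto_atTop.1 hl) (ε / 5) (by positivity)
  obtain ⟨N, hN⟩ := h1
  obtain ⟨M, hM⟩ := eventually_atTop.1 hv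
  have key : ∀ n ≥ max N M, |u n - l| < 2 * (ε / 5) := by
    intro n hn
    have h2 := hN n (le_of_max_le_left hn)
    have h3 := hM n (le_of_max_le_right hn)
    rw [Real.dist_eq] at h2
    have := abs_sub_le (u n) (v n) l
    linarith
  refine ⟨max N M, fun n hn => ?_⟩
  have h4 := key n hn
  have h5 := key _ le_rfl
  rw [Real.dist_eq]
  have := abs_sub_le (u n) l (u (max N M))
  rw [abs_sub_comm l] at this
  linarith

theorem tendsto_zero_of_approx {u : ℕ → ℝ}
    (h : ∀ ε > 0, ∃ v : ℕ → ℝ, Tendsto v atTop (𝓝 0) ∧ ∀ᶠ n in atTop, |u n - v n| ≤ ε) :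
    Tendsto u atTop (𝓝 0) := by
  rw [Metric.tendsto_atTop]
  intro ε hε
  obtain ⟨v, hl, hv⟩ := h (ε / 3) (by positivity)
  obtain ⟨N, hN⟩ := (Metric.tendsto_atTop.1 hl) (ε / 3) (by positivity)
  obtain ⟨M, hM⟩ := eventually_atTop.1 hv
  refine ⟨max N M, fun n hn => ?_⟩
  have h2 := hN n (le_of_max_le_left hn)
  have h3 := hM n (le_of_max_le_right hn)
  rw [Real.dist_eq] at *
  have := abs_sub_le (u n) (v n) 0
  linarith

/-! ## Riemann sums -/

theorem integral_natFloor (q : ℕ → ℝ) (N : ℕ) :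
    IntervalIntegrable (fun t : ℝ => q ⌊t⌋₊) volume 0 N ∧
      ∫ t in (0 : ℝ)..N, q ⌊t⌋₊ = ∑ x ∈ Finset.range N, q x := by
  induction N with
  | zero => simp
  | succ N ih =>
    -- On `(N, N + 1]` the floor equals `N` except at the right end point, a null set.
    have h1 : ∀ᵐ t ∂(volume.restrict (Set.uIoc (N : ℝ) (N + 1))), q N = q ⌊t⌋₊ := by
      rw [uIoc_of_le (by linarith)]
      have h2 : ∀ᵐ t ∂(volume : Measure ℝ), t ≠ (N : ℝ) + 1 := Measure.ae_ne volume _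
      filter_upwards [ae_restrict_mem measurableSet_Ioc, ae_restrict_of_ae h2] with t ht ht2
      congr 1
      exact ((Nat.floor_eq_iff ((Nat.cast_nonneg N).trans ht.1.le)).2
        ⟨ht.1.le, lt_of_le_of_ne ht.2 ht2⟩).symm
    have h3 : IntervalIntegrable (fun t : ℝ => q ⌊t⌋₊) volume N (N + 1) :=
      (intervalIntegrable_const (c := q N)).congr_ae h1
    have h4 : ∫ t in (N : ℝ)..(N + 1), q ⌊t⌋₊ = q N := by
      rw [← intervalIntegral.integral_congr_ae_restrict h1]
      simp
    push_cast
    refine ⟨ih.1.trans h3, ?_⟩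
    rw [← intervalIntegral.integral_add_adjacent_intervals ih.1 h3, ih.2, h4,
      Finset.sum_range_succ]

theorem integral_natFloor_mul (q : ℕ → ℝ) {n : ℕ} (hn : 0 < n) :
    ∫ y in (0 : ℝ)..1, q ⌊(n : ℝ) * y⌋₊ = (1 / (n : ℝ)) * ∑ x ∈ Finset.range n, q x := by
  have hn' : (n : ℝ) ≠ 0 := by exact_mod_cast hn.ne'
  rw [intervalIntegral.integral_comp_mul_left (fun t => q ⌊t⌋₊) hn', mul_zero, mul_one,
    (integral_natFloor q n).2, smul_eq_mul, one_div]

/-- Riemann sums of a bounded array that converges pointwise in the interior. -/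
theorem tendsto_riemann_sum {h : ℕ → ℕ → ℝ} {f g : ℝ → ℝ} {C : ℝ}
    (hC : ∀ n, ∀ x ∈ Finset.Icc 1 n, |h n x| ≤ C) (hg : ContinuousOn g (Icc 0 1))
    (hf : ∀ y ∈ Ioo (0 : ℝ) 1, Tendsto (fun n : ℕ => h n ⌊(n : ℝ) * y⌋₊) atTop (𝓝 (f y))) :
    Tendsto (fun n : ℕ => (1 / (n : ℝ)) * ∑ x ∈ Finset.Icc 1 n, g (x / n) * h n x) atTop
      (𝓝 (∫ y in (0 : ℝ)..1, g y * f y)) := by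
  obtain ⟨G, hG⟩ := isCompact_Icc.exists_bound_of_continuousOn hg
  have hG0 : 0 ≤ G := (norm_nonneg _).trans (hG 0 (by simp))
  have hC0 : 0 ≤ C := (abs_nonneg _).trans (hC 1 1 (by simp))
  -- Extension by zero takes care of the index `⌊n y⌋ = 0`, where the array is not controlled.
  let q : ℕ → ℕ → ℝ := fun n x => if x ∈ Finset.Icc 1 n then g (x / n) * h n x else 0
  have hq : ∀ n x, |q n x| ≤ G * C := by
    intro n x
    simp only [q]
    split_ifs with hx
    · rw [abs_mul]
      exact mul_le_mul (hG _ (natCast_div_mem_Icc (Finset.mem_Icc.1 hx).2)) (hC n x hx)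
        (abs_nonneg _) hG0
    · rw [abs_zero]
      positivity
  have h1 : Tendsto (fun n : ℕ => ∫ y in (0 : ℝ)..1, q n ⌊(n : ℝ) * y⌋₊) atTop
      (𝓝 (∫ y in (0 : ℝ)..1, g y * f y)) := by
    refine intervalIntegral.tendsto_integral_filter_of_dominated_convergence (fun _ => G * C)
      ?_ ?_ intervalIntegrable_const ?_
    · refine Eventually.of_forall fun n => Measurable.aestronglyMeasurable ?_
      exact (measurable_from_nat (f := q n)).comp
        (Nat.measurable_floor.comp (measurable_const.mul measurable_id))
    · exact Eventually.of_forall fun n => Eventually.of_forall fun y _ => hq n _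
    · have h2 : ∀ᵐ y ∂(volume : Measure ℝ), y ≠ 1 := Measure.ae_ne volume _
      filter_upwards [h2] with y hy1 hy
      rw [uIoc_of_le zero_le_one] at hy
      have hy' : y ∈ Ioo (0 : ℝ) 1 := ⟨hy.1, lt_of_le_of_ne hy.2 hy1⟩
      have h3 : Tendsto (fun n : ℕ => g ((⌊(n : ℝ) * y⌋₊ : ℝ) / n)) atTop (𝓝 (g y)) := by
        have h4 := tendsto_floor_mul_add_div y hy.1.le 0
        simp only [add_zero] at h4
        exact (hg.continuousAt (Icc_mem_nhds hy'.1 hy'.2)).tendsto.comp h4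
      refine (h3.mul (hf y hy')).congr' ?_
      filter_upwards [eventually_floor_bulk hy' 0] with n hn
      simp only [q]
      rw [if_pos (Finset.mem_Icc.2 (by omega))]
  -- The integral of the step function covers the indices `0, …, n - 1`; the term `x = n` is added
  -- by hand and is of order `1/n`.
  have h5 : Tendsto (fun n : ℕ => (∫ y in (0 : ℝ)..1, q n ⌊(n : ℝ) * y⌋₊) + q n n / n) atTop
      (𝓝 (∫ y in (0 : ℝ)..1, g y * f y)) := by
    have h6 : Tendsto (fun n : ℕ => q n n / n) atTop (𝓝 0) := by
      refine squeeze_zero_norm (a := fun n : ℕ => G * C / n) (fun n => ?_)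
        (tendsto_const_nhds.div_atTop tendsto_natCast_atTop_atTop)
      rw [norm_div, Real.norm_natCast]
      exact div_le_div_of_nonneg_right (hq n n) (Nat.cast_nonneg n)
    simpa using h1.add h6
  refine h5.congr' ?_
  filter_upwards [eventually_gt_atTop 0] with n hn
  have h7 : ∑ x ∈ Finset.Icc 1 n, g (x / n) * h n x = ∑ x ∈ Finset.Icc 1 n, q n x :=
    Finset.sum_congr rfl fun x hx => (if_pos hx).symm
  have h8 : ∑ x ∈ Finset.Icc 1 n, q n x = ∑ x ∈ Finset.range n, q n x + q n n := by
    have h9 := sum_Icc_sub (fun x => ∑ i ∈ Finset.range (x + 1), q n i) n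
    have h10 : ∀ x ∈ Finset.Icc 1 n, (∑ i ∈ Finset.range (x - 1 + 1), q n i) -
        ∑ i ∈ Finset.range (x + 1), q n i = -q n x := by
      intro x hx
      rw [Finset.mem_Icc] at hx
      rw [Nat.sub_add_cancel hx.1, Finset.sum_range_succ]
      ring
    rw [Finset.sum_congr rfl h10, Finset.sum_neg_distrib, Finset.sum_range_succ _ n] at h9
    have h11 : q n 0 = 0 := if_neg (by simp)
    simp only [zero_add, Finset.sum_range_one, h11] at h9
    linarith
  rw [integral_natFloor_mul (q n) hn, h7, h8]
  ring

/-! ## Random masses -/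

/-- Independent and identically distributed masses in `[mmin, mmax]`, `mmin > 0`. -/
structure IIDMasses {Ω : Type*} [MeasurableSpace Ω] (P : Measure Ω) (m : ℕ → Ω → ℝ)
    (mmin mmax : ℝ) : Prop where
  pos : 0 < mmin
  meas : ∀ x, 1 ≤ x → Measurable (m x)
  indep : iIndepFun (fun i : ℕ => m (i + 1)) P
  law : ∀ i, P.map (m (i + 1)) = P.map (m (0 + 1))
  mem : ∀ᵐ v ∂P, ∀ x, 1 ≤ x → m x v ∈ Icc mmin mmax

/-- A bound for the error of the local approximation of the thermal energy. -/
noncomputable def localError (p : Polynomial ℝ) (R ε : ℝ) (n x : ℕ) : ℝ :=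
  2 * ε + |p.coeff 0| * (R / n + if x = n then 1 else 0)

section model

variable {Ω : Type*} [MeasurableSpace Ω] {P : Measure Ω} {m : ℕ → Ω → ℝ} {mmin mmax : ℝ}
  {β pbar rbar : ℝ → ℝ} {lo hi mbar : ℝ}

theorem exists_abs_localThermal_le (hmmin : 0 < mmin) (hβ : ProfileBounds β lo hi)
    (p : Polynomial ℝ) : ∃ C, ∀ n (mass : ℕ → ℝ), (∀ x, 1 ≤ x → mass x ∈ Icc mmin mmax) →
      ∀ x, |localThermal p n β mass x| ≤ C := by
  obtain ⟨C, hC⟩ := exists_abs_localEnergy_le p √(hi / mmin) √hi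
  exact ⟨C, fun n mass hmass x => hC _ _
    (fun z => abs_siteCoef_le hβ hmmin (fun y hy => hmass y (Finset.mem_Icc.1 hy).1) _)
    (fun z => abs_bondCoef_le hβ n _)⟩

theorem abs_thermalEnergy_sub_localThermal_le (hmmin : 0 < mmin) (hβ : ProfileBounds β lo hi)
    {mass : ℕ → ℝ} (hmass : ∀ x, 1 ≤ x → mass x ∈ Icc mmin mmax)
    {p : Polynomial ℝ} {ε : ℝ} (hε : 0 ≤ ε)
    (hp : ∀ t ∈ Ioc 0 (4 * √(hi / mmin) ^ 2 * √hi ^ 2), |modeEnergy t - p.eval t| ≤ ε)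
    {n x : ℕ} (hx : x ∈ Finset.Icc 1 n) :
    |2 * β (x / n) * thermalEnergy n β pbar rbar mbar mass x - localThermal p n β mass x| ≤
      localError p ((mmax / lo) / (mmin / hi)) ε n x := by
  have hm' : ∀ y ∈ Finset.Icc 1 n, mass y ∈ Icc mmin mmax := fun y hy =>
    hmass y (Finset.mem_Icc.1 hy).1
  have h1 := abs_thermalEnergy_sub_le (pbar := pbar) (rbar := rbar) (mbar := mbar)
    hβ hmmin hm' hε hp hx
  have h2 := abs_massShare_le hβ hmmin hm' hx
  have h3 : |p.coeff 0 * (massShare n β mass x + if x = n then 1 else 0)| ≤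
      |p.coeff 0| * ((mmax / lo) / (mmin / hi) / n + if x = n then 1 else 0) := by
    rw [abs_mul]
    refine mul_le_mul_of_nonneg_left ((abs_add_le _ _).trans (add_le_add h2 ?_)) (abs_nonneg _)
    split_ifs <;> simp
  rw [localError]
  rw [abs_le] at *
  constructor <;> linarith [h1.1, h1.2, h3.1, h3.2]

theorem exists_abs_thermalEnergy_le (hmmin : 0 < mmin) (hβ : ProfileBounds β lo hi) :
    ∃ D, 0 ≤ D ∧ ∀ (pbar rbar : ℝ → ℝ) (mbar : ℝ) (n : ℕ) (mass : ℕ → ℝ),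
      (∀ x, 1 ≤ x → mass x ∈ Icc mmin mmax) → ∀ x ∈ Finset.Icc 1 n,
        |thermalEnergy n β pbar rbar mbar mass x| ≤ D := by
  obtain ⟨D, hD, hD'⟩ := exists_abs_modeEnergy_le (4 * √(hi / mmin) ^ 2 * √hi ^ 2)
  have hlo := hβ.lo_pos
  refine ⟨D / lo, by positivity, fun pbar rbar mbar n mass hmass x hx => ?_⟩
  have h1 := abs_thermalEnergy_le (pbar := pbar) (rbar := rbar) (mbar := mbar) hβ hmmin
    (fun y hy => hmass y (Finset.mem_Icc.1 hy).1) hD hD' hx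
  have h2 := hβ.le _ (natCast_div_mem_Icc (Finset.mem_Icc.1 hx).2)
  rw [abs_mul, abs_of_pos (by linarith)] at h1
  rw [le_div_iff₀ hlo]
  nlinarith [abs_nonneg (thermalEnergy n β pbar rbar mbar mass x)]

variable (hm : IIDMasses P m mmin mmax) (hβ : ProfileBounds β lo hi)
include hm hβ

theorem integrable_localThermal (p : Polynomial ℝ) (n x : ℕ) :
    Integrable (fun v => localThermal p n β (fun z => m z v) x) P := by
  have hP : IsProbabilityMeasure P := hm.indep.isProbabilityMeasure
  obtain ⟨C, hC⟩ := exists_abs_localThermal_le (mmax := mmax) hm.pos hβ p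
  exact Integrable.of_bound (measurable_localThermal hm.meas p n β x).aestronglyMeasurable C
    (hm.mem.mono fun v hv => hC n _ hv x)

/-- The definition involves choices and does not show measurability in the masses. Measurability
comes from writing the energy as an almost sure limit of explicit measurable local functions, minus
their boundary corrections, along polynomials with error `1/(k + 1)`. -/
theorem integrable_thermalEnergy (pbar rbar : ℝ → ℝ) (mbar : ℝ) {n x : ℕ}
    (hx : x ∈ Finset.Icc 1 n) :
    Integrable (fun v => thermalEnergy n β pbar rbar mbar (fun z => m z v) x) P := by
  have hP : IsProbabilityMeasure P := hm.indep.isProbabilityMeasure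
  obtain ⟨D, hD, hD'⟩ := exists_abs_thermalEnergy_le (mmax := mmax) hm.pos hβ
  refine Integrable.of_bound ?_ D (hm.mem.mono fun v hv => hD' pbar rbar mbar n _ hv x hx)
  have hx' := Finset.mem_Icc.1 hx
  have hε : ∀ k : ℕ, (0 : ℝ) < 1 / ((k : ℝ) + 1) := fun k => by positivity
  choose p hp using fun k : ℕ =>
    exists_polynomial_modeEnergy (4 * √(hi / mmin) ^ 2 * √hi ^ 2) (hε k)
  have hβx : 0 < β (x / n) := hβ.lo_pos.trans_le (hβ.le _ (natCast_div_mem_Icc hx'.2))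
  have h1 : AEStronglyMeasurable
      (fun v => 2 * β (x / n) * thermalEnergy n β pbar rbar mbar (fun z => m z v) x) P := by
    refine aestronglyMeasurable_of_tendsto_ae atTop
      (f := fun k v => localThermal (p k) n β (fun z => m z v) x - (p k).coeff 0 *
        (massShare n β (fun z => m z v) x + if x = n then 1 else 0)) (fun k => ?_) ?_
    · exact ((measurable_localThermal hm.meas (p k) n β x).sub (measurable_const.mul
        ((measurable_massShare hm.meas n β hx'.1).add measurable_const))).aestronglyMeasurable
    · filter_upwards [hm.mem] with v hv
      rw [tendsto_iff_dist_tendsto_zero]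
      refine squeeze_zero (fun _ => dist_nonneg) (fun k => ?_)
        (g := fun k : ℕ => 2 * (1 / ((k : ℝ) + 1))) ?_
      · rw [dist_comm, Real.dist_eq]
        exact abs_thermalEnergy_sub_le hβ hm.pos (fun y hy => hv y (Finset.mem_Icc.1 hy).1)
          (hε k).le (hp k) hx
      · simpa using tendsto_one_div_add_atTop_nhds_zero_nat.const_mul (2 : ℝ)
  refine (h1.const_mul (2 * β (x / n))⁻¹).congr (Eventually.of_forall fun v => ?_)
  simp only
  rw [inv_mul_cancel_left₀ (by positivity)]

theorem exists_tendsto_integral_thermalEnergy (hβc : ContinuousOn β (Icc 0 1))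
    (pbar rbar : ℝ → ℝ) (mbar : ℝ) {y : ℝ} (hy : y ∈ Ioo (0 : ℝ) 1) :
    ∃ l, Tendsto (fun n : ℕ => ∫ v, thermalEnergy n β pbar rbar mbar (fun z => m z v)
      ⌊(n : ℝ) * y⌋₊ ∂P) atTop (𝓝 l) := by
  have hP : IsProbabilityMeasure P := hm.indep.isProbabilityMeasure
  have hβy : 0 < β y := hβ.lo_pos.trans_le (hβ.le _ ⟨hy.1.le, hy.2.le⟩)
  obtain ⟨l, hl⟩ : ∃ l, Tendsto (fun n : ℕ => ∫ v, 2 * β (⌊(n : ℝ) * y⌋₊ / n) *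
      thermalEnergy n β pbar rbar mbar (fun z => m z v) ⌊(n : ℝ) * y⌋₊ ∂P) atTop (𝓝 l) := by
    refine exists_tendsto_of_approx fun ε hε => ?_
    obtain ⟨p, hp⟩ := exists_polynomial_modeEnergy (4 * √(hi / mmin) ^ 2 * √hi ^ 2)
      (ε := ε / 3) (by positivity)
    refine ⟨_, exists_tendsto_integral_localThermal hβ hβc hm.pos
      (fun i => hm.meas (i + 1) (by omega)) hm.indep hm.law
      (hm.mem.mono fun v hv i => hv (i + 1) (by omega)) (fun i => rfl) p hy, ?_⟩
    have h1 : Tendsto (fun n : ℕ => |p.coeff 0| * ((mmax / lo) / (mmin / hi) / n)) atTop (𝓝 0) := by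
      have : Tendsto (fun n : ℕ => (mmax / lo) / (mmin / hi) / (n : ℝ)) atTop (𝓝 0) :=
        tendsto_const_nhds.div_atTop tendsto_natCast_atTop_atTop
      simpa using this.const_mul |p.coeff 0|
    filter_upwards [eventually_floor_bulk hy 0, h1.eventually_le_const (by positivity : 0 < ε / 3)]
      with n hn h2
    have hx : ⌊(n : ℝ) * y⌋₊ ∈ Finset.Icc 1 n := Finset.mem_Icc.2 (by omega)
    rw [← integral_sub ((integrable_thermalEnergy hm hβ pbar rbar mbar hx).const_mul _)
      (integrable_localThermal hm hβ p n _)]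
    have h3 := norm_integral_le_of_norm_le_const (μ := P) (C := ε)
      (f := fun v => 2 * β (⌊(n : ℝ) * y⌋₊ / n) *
        thermalEnergy n β pbar rbar mbar (fun z => m z v) ⌊(n : ℝ) * y⌋₊ -
        localThermal p n β (fun z => m z v) ⌊(n : ℝ) * y⌋₊) (hm.mem.mono fun v hv => by
          have h4 := abs_thermalEnergy_sub_localThermal_le (pbar := pbar) (rbar := rbar)
            (mbar := mbar) hm.pos hβ hv (by positivity) hp hx
          rw [localError, if_neg (by omega), add_zero] at h4
          rw [Real.norm_eq_abs]
          linarith)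
    simpa using h3
  have h5 : Tendsto (fun n : ℕ => β (⌊(n : ℝ) * y⌋₊ / n)) atTop (𝓝 (β y)) := by
    have h6 := tendsto_floor_mul_add_div y hy.1.le 0
    simp only [add_zero] at h6
    exact (hβc.continuousAt (Icc_mem_nhds hy.1 hy.2)).tendsto.comp h6
  -- The approximation concerns `2β(x/n)⟨ẽ_x⟩`; the deterministic factor tends to `2β y > 0` and is
  -- divided out.
  refine ⟨_, (hl.mul ((h5.const_mul 2).inv₀ (by positivity))).congr' ?_⟩
  filter_upwards [eventually_floor_bulk hy 0] with n hn
  have h7 : 0 < β (⌊(n : ℝ) * y⌋₊ / n) :=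
    hβ.lo_pos.trans_le (hβ.le _ (natCast_div_mem_Icc (by omega)))
  rw [integral_const_mul]
  field_simp

theorem ae_tendsto_weighted_average_localThermal {w : ℕ → ℕ → ℝ} {G : ℝ}
    (hw : ∀ n x, |w n x| ≤ G) (p : Polynomial ℝ) :
    ∀ᵐ v ∂P, Tendsto (fun n : ℕ => (1 / (n : ℝ)) * ∑ x ∈ Finset.Icc 1 n,
      w n x * (localThermal p n β (fun z => m z v) x -
        ∫ u, localThermal p n β (fun z => m z u) x ∂P)) atTop (𝓝 0) := by
  have hP : IsProbabilityMeasure P := hm.indep.isProbabilityMeasure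
  obtain ⟨C, hC⟩ := exists_abs_localThermal_le (mmax := mmax) hm.pos hβ p
  have hG : 0 ≤ G := (abs_nonneg _).trans (hw 0 0)
  have hcongr : ∀ n x v, localThermal p n β (fun z => m (z - 1 + 1) v) x =
      localThermal p n β (fun z => m z v) x := fun n x v =>
    localThermal_congr p n β x fun i hi _ _ => by rw [Nat.sub_add_cancel hi]
  -- The radius is `deg p + 1` because the mass at `i` is the variable of index `i - 1`.
  have h1 := ae_tendsto_average_sub_integral (P := P) (X := fun i => m (i + 1))
    (fun i => hm.meas (i + 1) (by omega)) hm.indep (p.natDegree + 1)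
    (Φ := fun n x ξ => w n x * localThermal p n β (fun z => ξ (z - 1)) x)
    (fun n x => measurable_const.mul
      (measurable_localThermal (m := fun z (ξ : ℕ → ℝ) => ξ (z - 1))
        (fun z _ => measurable_pi_apply _) p n β x))
    (fun n x ξ ξ' h => by
      rw [localThermal_congr p n β x fun i h1 h2 h3 => h (i - 1) (by omega) (by omega)])
    (C := G * C) (fun n x => by
      filter_upwards [hm.mem] with v hv
      rw [hcongr, abs_mul]
      exact mul_le_mul (hw n x) (hC n _ hv x) (abs_nonneg _) hG)
  simp only [hcongr, integral_const_mul, ← mul_sub] at h1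
  exact h1

/-- The strong law for local functions is transferred to the thermal energies. A countable sequence
of polynomials is fixed beforehand, so that one exceptional null set serves all precisions. -/
theorem ae_tendsto_average_thermalEnergy_sub (pbar rbar : ℝ → ℝ) (mbar : ℝ) {g : ℝ → ℝ}
    (hg : ContinuousOn g (Icc 0 1)) :
    ∀ᵐ v ∂P, Tendsto (fun n : ℕ => (1 / (n : ℝ)) * ∑ x ∈ Finset.Icc 1 n,
      g (x / n) * (thermalEnergy n β pbar rbar mbar (fun z => m z v) x -
        ∫ u, thermalEnergy n β pbar rbar mbar (fun z => m z u) x ∂P)) atTop (𝓝 0) := by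
  have hP : IsProbabilityMeasure P := hm.indep.isProbabilityMeasure
  obtain ⟨G₀, hG₀⟩ := isCompact_Icc.exists_bound_of_continuousOn hg
  have hG₀0 : 0 ≤ G₀ := (norm_nonneg _).trans (hG₀ 0 (by simp))
  have hlo := hβ.lo_pos
  set G : ℝ := G₀ / (2 * lo)
  have hG0 : 0 ≤ G := by positivity
  -- The weight absorbs `1/(2β(x/n))`, since the local functions approximate `2β(x/n)⟨ẽ_x⟩`.
  let w : ℕ → ℕ → ℝ := fun n x => if x ∈ Finset.Icc 1 n then g (x / n) / (2 * β (x / n)) else 0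
  have hw : ∀ n x, |w n x| ≤ G := by
    intro n x
    simp only [w]
    split_ifs with hx
    · have h1 := natCast_div_mem_Icc (Finset.mem_Icc.1 hx).2
      have h2 := hβ.le _ h1
      rw [abs_div, abs_of_pos (by linarith : 0 < 2 * β (x / n))]
      exact div_le_div₀ hG₀0 (hG₀ _ h1) (by positivity) (by linarith)
    · simpa using hG0
  have hε : ∀ k : ℕ, (0 : ℝ) < 1 / ((k : ℝ) + 1) := fun k => by positivity
  choose p hp using fun k : ℕ =>
    exists_polynomial_modeEnergy (4 * √(hi / mmin) ^ 2 * √hi ^ 2) (hε k)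
  have h1 : ∀ᵐ v ∂P, ∀ k, Tendsto (fun n : ℕ => (1 / (n : ℝ)) * ∑ x ∈ Finset.Icc 1 n,
      w n x * (localThermal (p k) n β (fun z => m z v) x -
        ∫ u, localThermal (p k) n β (fun z => m z u) x ∂P)) atTop (𝓝 0) :=
    ae_all_iff.2 fun k => ae_tendsto_weighted_average_localThermal hm hβ hw (p k)
  filter_upwards [h1, hm.mem] with v hv1 hv2
  refine tendsto_zero_of_approx fun δ hδ => ?_
  set R : ℝ := (mmax / lo) / (mmin / hi)
  -- The final error is `2G(2ε + ε)`; the `+ 1` keeps the denominator positive when `G = 0`.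
  obtain ⟨k, hk⟩ := exists_nat_one_div_lt (show 0 < δ / (2 * G * 3 + 1) by positivity)
  set ε : ℝ := 1 / ((k : ℝ) + 1)
  refine ⟨_, hv1 k, ?_⟩
  have h2 : Tendsto (fun n : ℕ => |(p k).coeff 0| * ((R + 1) / n)) atTop (𝓝 0) := by
    have : Tendsto (fun n : ℕ => (R + 1) / (n : ℝ)) atTop (𝓝 0) :=
      tendsto_const_nhds.div_atTop tendsto_natCast_atTop_atTop
    simpa using this.const_mul |(p k).coeff 0|
  filter_upwards [h2.eventually_le_const (hε k), eventually_gt_atTop 0] with n h3 hn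
  have hn' : (0 : ℝ) < n := by exact_mod_cast hn
  have h4 : ∀ x ∈ Finset.Icc 1 n,
      |g (x / n) * (thermalEnergy n β pbar rbar mbar (fun z => m z v) x -
        ∫ u, thermalEnergy n β pbar rbar mbar (fun z => m z u) x ∂P) -
      w n x * (localThermal (p k) n β (fun z => m z v) x -
        ∫ u, localThermal (p k) n β (fun z => m z u) x ∂P)| ≤
      2 * G * localError (p k) R ε n x := by
    intro x hx
    have hβx : 0 < β (x / n) := hlo.trans_le (hβ.le _ (natCast_div_mem_Icc (Finset.mem_Icc.1 hx).2))
    let d : Ω → ℝ := fun u => 2 * β (x / n) * thermalEnergy n β pbar rbar mbar (fun z => m z u) x -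
      localThermal (p k) n β (fun z => m z u) x
    have hd : ∀ u, (∀ x, 1 ≤ x → m x u ∈ Icc mmin mmax) → |d u| ≤ localError (p k) R ε n x :=
      fun u hu => abs_thermalEnergy_sub_localThermal_le hm.pos hβ hu (hε k).le (hp k) hx
    have hdi : ∫ u, d u ∂P = 2 * β (x / n) *
        ∫ u, thermalEnergy n β pbar rbar mbar (fun z => m z u) x ∂P -
        ∫ u, localThermal (p k) n β (fun z => m z u) x ∂P := by
      rw [integral_sub ((integrable_thermalEnergy hm hβ pbar rbar mbar hx).const_mul _)
        (integrable_localThermal hm hβ (p k) n x), integral_const_mul]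
    have h5 := norm_integral_le_of_norm_le_const (μ := P) (f := d)
      (hm.mem.mono fun u hu => hd u hu)
    rw [probReal_univ, mul_one, Real.norm_eq_abs] at h5
    have h6 : g (x / n) * (thermalEnergy n β pbar rbar mbar (fun z => m z v) x -
        ∫ u, thermalEnergy n β pbar rbar mbar (fun z => m z u) x ∂P) -
      w n x * (localThermal (p k) n β (fun z => m z v) x -
        ∫ u, localThermal (p k) n β (fun z => m z u) x ∂P) = w n x * (d v - ∫ u, d u ∂P) := by
      have h7 : g (x / n) = w n x * (2 * β (x / n)) := by
        simp only [w, if_pos hx]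
        field_simp
      rw [hdi, h7]
      simp only [d]
      ring
    rw [h6, abs_mul]
    calc |w n x| * |d v - ∫ u, d u ∂P| ≤ G * (|d v| + |∫ u, d u ∂P|) :=
          mul_le_mul (hw n x) (abs_sub _ _) (abs_nonneg _) hG0
      _ ≤ G * (localError (p k) R ε n x + localError (p k) R ε n x) :=
          mul_le_mul_of_nonneg_left (add_le_add (hd v hv2) h5) hG0
      _ = _ := by ring
  -- Averaged over the sites, the correction of order `R/n` and the single one at `x = n` contribute
  -- `|p_0|(R + 1)/n`, which is eventually below `ε`.
  rw [← mul_sub, ← Finset.sum_sub_distrib, abs_mul, abs_of_pos (by positivity)]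
  calc 1 / (n : ℝ) * |_| ≤ 1 / (n : ℝ) * ∑ x ∈ Finset.Icc 1 n, 2 * G * localError (p k) R ε n x :=
        mul_le_mul_of_nonneg_left ((Finset.abs_sum_le_sum_abs _ _).trans (Finset.sum_le_sum h4))
          (by positivity)
    _ = 2 * G * (2 * ε + |(p k).coeff 0| * ((R + 1) / n)) := by
        simp only [localError, ← Finset.mul_sum, Finset.sum_add_distrib, Finset.sum_const,
          Nat.card_Icc, Finset.sum_ite_eq', Finset.mem_Icc, nsmul_eq_mul]
        rw [if_pos (by omega)]
        simp only [Nat.add_sub_cancel]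
        field_simp
    _ ≤ 2 * G * (2 * ε + ε) := by gcongr
    _ = (2 * G * 3) * ε := by ring
    _ ≤ (2 * G * 3 + 1) * (δ / (2 * G * 3 + 1)) :=
        mul_le_mul (by linarith) hk.le (hε k).le (by positivity)
    _ = δ := by field_simp

end model

end QuantumChain

/-! ### The limit theorem for i.i.d. masses with a density -/

theorem mainTheorem3
    {Ω : Type*} [MeasurableSpace Ω] (P : Measure Ω) [IsProbabilityMeasure P]
    -- the masses: i.i.d., with a smooth density supported in `[m_min, m_max]`, `m_min > 0`
    (m : ℕ → Ω → ℝ) (dens : ℝ → ℝ) (mmin mmax : ℝ)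
    (hm_meas : ∀ x, 1 ≤ x → Measurable (m x))
    (hm_indep : iIndepFun (fun x : ℕ => m (x + 1)) P)
    (hm_law : ∀ x, 1 ≤ x →
      P.map (m x) = (volume : Measure ℝ).withDensity (fun t => ENNReal.ofReal (dens t)))
    (hdens_smooth : ContDiff ℝ ∞ dens) (hdens_nonneg : ∀ t, 0 ≤ dens t)
    (hmmin : 0 < mmin) (hdens_supp : Function.support dens ⊆ Set.Icc mmin mmax)
    -- the macroscopic profiles
    (β pbar rbar : ℝ → ℝ)
    (hβ : ContinuousOn β (Set.Icc 0 1)) (hβ_pos : ∀ y ∈ Set.Icc (0 : ℝ) 1, 0 < β y)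
    (hp : ContDiffOn ℝ 1 pbar (Set.Icc 0 1)) (hr : ContDiffOn ℝ 1 rbar (Set.Icc 0 1))
    (hr0 : rbar 0 = 0) (hr1 : rbar 1 = 0) (hp_int : ∫ y in (0 : ℝ)..1, pbar y = 0) :
    -- the thermal energies are well defined, and integrable functions of the masses
    (∀ᵐ w ∂P, ∀ n : ℕ, 1 ≤ n →
      QuantumChain.WellDefined n β pbar rbar (∫ v, m 1 v ∂P) (fun x => m x w)) ∧
    (∀ n : ℕ, ∀ x ∈ Finset.Icc 1 n, Integrable (fun w =>
      QuantumChain.thermalEnergy n β pbar rbar (∫ v, m 1 v ∂P) (fun z => m z w) x) P) ∧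
    -- the limiting function `f`, and the strong law of large numbers
    ∃ f : ℝ → ℝ,
      (∀ y ∈ Set.Ioo (0 : ℝ) 1, Tendsto (fun n : ℕ => ∫ w,
          QuantumChain.thermalEnergy n β pbar rbar (∫ v, m 1 v ∂P) (fun z => m z w)
            ⌊(n : ℝ) * y⌋₊ ∂P)
        atTop (𝓝 (f y))) ∧
      IntervalIntegrable f volume 0 1 ∧
      ∀ g : ℝ → ℝ, ContinuousOn g (Set.Icc 0 1) →
        ∀ᵐ w ∂P, Tendsto (fun n : ℕ => (1 / (n : ℝ)) * ∑ x ∈ Finset.Icc 1 n,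
            g (x / n) *
              QuantumChain.thermalEnergy n β pbar rbar (∫ v, m 1 v ∂P) (fun z => m z w) x)
          atTop (𝓝 (∫ y in (0 : ℝ)..1, g y * f y)) := by
  obtain ⟨lo, hi, hb⟩ := QuantumChain.exists_profileBounds hβ hβ_pos
  have hm : QuantumChain.IIDMasses P m mmin mmax := by
    refine ⟨hmmin, hm_meas, hm_indep, fun i => ?_, ae_all_iff.2 fun x => ?_⟩
    · rw [hm_law _ (by omega), hm_law _ (by omega)]
    · by_cases hx : 1 ≤ x
      swap
      · exact Eventually.of_forall fun v h => absurd h hx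
      -- The density vanishes outside `[mmin, mmax]`, so the masses are almost surely confined
      -- there; only this bound and equality of the laws are needed below.
      have h1 : ∀ᵐ t ∂(P.map (m x)), t ∈ Icc mmin mmax := by
        rw [hm_law x hx, ae_withDensity_iff hdens_smooth.continuous.measurable.ennreal_ofReal]
        refine Eventually.of_forall fun t ht => hdens_supp fun h0 => ht ?_
        rw [h0, ENNReal.ofReal_zero]
      filter_upwards [ae_of_ae_map (hm_meas x hx).aemeasurable h1] with v hv _ using hv
  obtain ⟨D, hD, hD'⟩ := QuantumChain.exists_abs_thermalEnergy_le (mmax := mmax) hmmin hb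
  set mbar : ℝ := ∫ v, m 1 v ∂P
  let E : ℕ → ℕ → ℝ := fun n x =>
    ∫ w, QuantumChain.thermalEnergy n β pbar rbar mbar (fun z => m z w) x ∂P
  have hE : ∀ n, ∀ x ∈ Finset.Icc 1 n, |E n x| ≤ D := by
    intro n x hx
    have h1 := norm_integral_le_of_norm_le_const (μ := P)
      (f := fun w => QuantumChain.thermalEnergy n β pbar rbar mbar (fun z => m z w) x)
      (hm.mem.mono fun w hw => hD' pbar rbar mbar n _ hw x hx)
    rwa [probReal_univ, mul_one, Real.norm_eq_abs] at h1
  -- The limit is needed only inside `(0, 1)`; elsewhere an arbitrary value lets `f` be chosen on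
  -- all of `ℝ`.
  have hlim : ∀ y : ℝ, ∃ l, y ∈ Ioo (0 : ℝ) 1 →
      Tendsto (fun n : ℕ => E n ⌊(n : ℝ) * y⌋₊) atTop (𝓝 l) := by
    intro y
    by_cases hy : y ∈ Ioo (0 : ℝ) 1
    · obtain ⟨l, hl⟩ :=
        QuantumChain.exists_tendsto_integral_thermalEnergy hm hb hβ pbar rbar mbar hy
      exact ⟨l, fun _ => hl⟩
    · exact ⟨0, fun h => absurd h hy⟩
  choose f hf using hlim
  refine ⟨?_, fun n x hx => QuantumChain.integrable_thermalEnergy hm hb pbar rbar mbar hx,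
    f, hf, ?_, fun g hg => ?_⟩
  · filter_upwards [hm.mem] with w hw n _
    exact QuantumChain.wellDefined_of_bounds hb hmmin
      (fun x hx => hw x (Finset.mem_Icc.1 hx).1) pbar rbar mbar
  · rw [intervalIntegrable_iff, uIoc_of_le zero_le_one]
    have hae : ∀ᵐ y ∂(volume.restrict (Ioc (0 : ℝ) 1)), y ∈ Ioo (0 : ℝ) 1 := by
      filter_upwards [ae_restrict_mem measurableSet_Ioc,
        ae_restrict_of_ae (Measure.ae_ne volume (1 : ℝ))] with y hy hy1
      exact ⟨hy.1, lt_of_le_of_ne hy.2 hy1⟩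
    refine Integrable.of_bound (C := D) ?_ ?_
    -- The limit function is measurable as a limit of step functions and inherits the uniform bound
    -- `D`.
    · refine aestronglyMeasurable_of_tendsto_ae atTop
        (f := fun n (y : ℝ) => E n ⌊(n : ℝ) * y⌋₊) (fun n => ?_) (hae.mono hf)
      exact ((measurable_from_nat (f := E n)).comp
        (Nat.measurable_floor.comp (measurable_const.mul measurable_id))).aestronglyMeasurable
    · filter_upwards [hae] with y hy
      refine le_of_tendsto (hf y hy).norm ?_
      filter_upwards [QuantumChain.eventually_floor_bulk hy 0] with n hn
      exact hE n _ (Finset.mem_Icc.2 (by omega))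
  · filter_upwards [QuantumChain.ae_tendsto_average_thermalEnergy_sub hm hb pbar rbar mbar hg]
      with w hw
    -- The weighted average splits into its fluctuation around the mean, which vanishes almost
    -- surely, and a deterministic Riemann sum of expectations.
    have h1 := hw.add (QuantumChain.tendsto_riemann_sum hE hg hf)
    rw [zero_add] at h1
    refine h1.congr fun n => ?_
    rw [← mul_add, ← Finset.sum_add_distrib]
    congr 1
    exact Finset.sum_congr rfl fun x _ => by ring
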